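/- Let $\Omega=(0,1)^2$ and let $\mathcal T$ be a finite conforming triangulation of $\bar\Omega$ with node set $\mathcal N$ and edge set $\mathcal S$. For a node $z$ let $\omega_z$ be the union of the triangles having $z$ as a vertex, $H_z=\operatorname{diam}\omega_z$ and $h_z=H_z^{-1}|\omega_z|$; for an edge $S$ let $\omega_S$ be the union of the triangles having $S$ as an edge; and $H_T=\operatorname{diam}T$ for $T\in\mathcal T$. Fix constants $c_0>0$, $\alpha_0<\pi$ and $M$. Suppose that no angle of any triangle of $\mathcal T$ exceeds $\alpha_0$, and that for some mesh $0=x_0<x_1<\dots<x_n=1$: A1. Every $T\in\mathcal T$ has, for some $i$, its shortest edge on the line $x=x_i$ and a vertex on one of the lines $x=x_{i+1}$, $x=x_{i-1}$ (of the mesh). A2. Every node is anisotropic: for every $z\in\mathcal N$, $h_z<c_0H_z$, and $|\omega_z|\le M|T|$ for every triangle $T\subset\omega_z$ having $z$ as a vertex. A3. For every $z\in\mathcal N$ there is a rectangle $\omega_z^*\supset\omega_z$ with sides parallel to the coordinate axes and $|\omega_z^*|\le M|\omega_z|$. Let $f\in L_\infty(\Omega)$, let $u\in H_0^1(\Omega)$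 be the weak solution of $-\Delta u=f$ in $\Omega$, $u=0$ on $\partial\Omega$, and let $u_h\in S_h$ satisfy $\langle\nabla u_h,\nabla v_h\rangle=\langle f,v_h\rangle$ for all $v_h\in S_h$, where $S_h$ is the space of all functions continuous on $\bar\Omega$, affine on each $T\in\mathcal T$ and zero on $\partial\Omega$, and $\langle\cdot,\cdot\rangle$ is the inner product of $L_2(\Omega)$. Let $J_S$ be the jump in the normal derivative of $u_h$ across the interior edge $S$, and let $\operatorname{osc}(f;T)=\sup_Tf-\inf_Tf$ (essential supremum and infimum). For $1\le i\le n-1$ put $\Omega_i=(x_{i-1},x_{i+1})\times(0,1)$ and let $\mathring{\mathcal S}_i$ be the set of the edges $S\not\subset\partial\Omega$ whose relative interior lies in $\Omega_i$ and which satisfy $|S|<c_0\operatorname{diam}\omega_S$. Then there is a constant $C$ that depends only on $c_0$, $\alpha_0$ and $M$ (in particular, not on the diameters and the aspect ratios of the elements) such that $$\Bigl(\sum_{S\in\mathring{\mathcal S}_i}|\omega_S|\,J_S^2\Bigr)^{1/2}\le C\,\Bigl(\|\nabla(u_h-u)\|_{L_2(\Omega_i)}+\|H_T\operatorname{osc}(f;T)\|_{L_2(\Omega_i)}\Bigr)\qquad\text{for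 all } i=1,\dots,n-1,$$ where $H_T\operatorname{osc}(f;T)$ is understood as a piecewise constant function on $\mathcal T$. -/

import Mathlib

open MeasureTheory Filter Topology
open scoped RealInnerProductSpace ENNReal ContDiff

noncomputable section

namespace AnisoMesh

/-- The Euclidean plane; `p 0` is the `x`-coordinate and `p 1` the `y`-coordinate. -/
abbrev Plane : Type := EuclideanSpace ℝ (Fin 2)

/-- The open rectangle `(a, b) × (c, d)`. -/
def openRect (a b c d : ℝ) : Set Plane :=
  {p | a < p 0 ∧ p 0 < b ∧ c < p 1 ∧ p 1 < d}

/-- The closed rectangle `[a, b] × [c, d]`, with sides parallel to the coordinate axes. -/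
def closedRect (a b c d : ℝ) : Set Plane :=
  {p | a ≤ p 0 ∧ p 0 ≤ b ∧ c ≤ p 1 ∧ p 1 ≤ d}

/-- The domain `Ω = (0,1)²`. -/
def unitSquare : Set Plane := openRect 0 1 0 1

/-! ### The Dirichlet problem for the Laplacian -/

/-- `φ ∈ C_c^∞(Ω)`. -/
def IsTestFunction (Ω : Set Plane) (φ : Plane → ℝ) : Prop :=
  ContDiff ℝ ∞ φ ∧ HasCompactSupport φ ∧ tsupport φ ⊆ Ω

/-- The vector field `G` is the weak gradient of `u` in `Ω`. -/
def HasWeakGradient (Ω : Set Plane) (u : Plane → ℝ) (G : Plane → Plane) : Prop :=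
  ∀ φ : Plane → ℝ, IsTestFunction Ω φ →
    ∫ p in Ω, u p • gradient φ p = - ∫ p in Ω, φ p • G p

/-- `u ∈ H₀¹(Ω)` with weak gradient `G`: both are square integrable, and `u` is the limit in
the norm of `H¹(Ω)` of a sequence in `C_c^∞(Ω)`. -/
def MemH10 (Ω : Set Plane) (u : Plane → ℝ) (G : Plane → Plane) : Prop :=
  MemLp u 2 (volume.restrict Ω) ∧ MemLp G 2 (volume.restrict Ω) ∧ HasWeakGradient Ω u G ∧
  ∃ φ : ℕ → Plane → ℝ, (∀ k, IsTestFunction Ω (φ k)) ∧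
    Tendsto (fun k => eLpNorm (fun p => φ k p - u p) 2 (volume.restrict Ω)) atTop (𝓝 0) ∧
    Tendsto (fun k => eLpNorm (fun p => gradient (φ k) p - G p) 2 (volume.restrict Ω))
      atTop (𝓝 0)

/-- `u`, with weak gradient `G`, is the weak solution of `-Δu = f` in `Ω`, `u = 0` on `∂Ω`. -/
def IsWeakSolution (Ω : Set Plane) (f u : Plane → ℝ) (G : Plane → Plane) : Prop :=
  MemH10 Ω u G ∧
  ∀ φ : Plane → ℝ, IsTestFunction Ω φ → ∫ p in Ω, ⟪G p, gradient φ p⟫ = ∫ p in Ω, f p * φ p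

/-! ### Triangulations -/

/-- A (conforming, finite) triangulation of the closure of `Ω`: a finite geometric simplicial
complex whose union is the closure of `Ω` and all of whose faces are faces of triangles. A face
is represented by the finite set of its vertices. -/
structure Triangulation (Ω : Set Plane) where
  complex : Geometry.SimplicialComplex ℝ Plane
  finite : complex.faces.Finite
  space_eq : complex.space = closure Ω
  isPure : ∀ s ∈ complex.faces, ∃ t ∈ complex.faces, s ⊆ t ∧ t.card = 3

/-- The closed set (segment, triangle, ...) spanned by a face. -/
def hull (s : Finset Plane) : Set Plane := convexHull ℝ (s : Set Plane)

/-- The area `|D|`. -/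
def area (D : Set Plane) : ℝ := volume.real D

namespace Triangulation

variable {Ω : Set Plane}

/-- The set of the mesh elements (triangles). -/
def elements (𝒯 : Triangulation Ω) : Finset (Finset Plane) :=
  {t ∈ 𝒯.finite.toFinset | t.card = 3}

/-- The set of the mesh edges. -/
def edges (𝒯 : Triangulation Ω) : Finset (Finset Plane) :=
  {s ∈ 𝒯.finite.toFinset | s.card = 2}

/-- The set of the mesh nodes. -/
def nodes (𝒯 : Triangulation Ω) : Set Plane := 𝒯.complex.vertices

/-- The patch `ω_z` of the elements surrounding the node `z`. -/
def nodePatch (𝒯 : Triangulation Ω) (z : Plane) : Set Plane :=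
  ⋃ t ∈ {t ∈ 𝒯.elements | z ∈ t}, hull t

open Classical in
/-- The elements that have `S` as an edge. -/
def elementsAt (𝒯 : Triangulation Ω) (S : Finset Plane) : Finset (Finset Plane) :=
  {t ∈ 𝒯.elements | S ⊆ t}

/-- The patch `ω_S` of the elements sharing the edge `S`. -/
def edgePatch (𝒯 : Triangulation Ω) (S : Finset Plane) : Set Plane :=
  ⋃ t ∈ 𝒯.elementsAt S, hull t

/-- `H_z = diam ω_z`. -/
def nodeDiam (𝒯 : Triangulation Ω) (z : Plane) : ℝ := Metric.diam (𝒯.nodePatch z)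

/-- `h_z = H_z⁻¹ |ω_z|`. -/
def nodeWidth (𝒯 : Triangulation Ω) (z : Plane) : ℝ :=
  (𝒯.nodeDiam z)⁻¹ * area (𝒯.nodePatch z)

/-- Every angle of every element is at most `α`. -/
def MaxAngle (𝒯 : Triangulation Ω) (α : ℝ) : Prop :=
  ∀ t ∈ 𝒯.elements, ∀ a ∈ t, ∀ b ∈ t, ∀ c ∈ t, a ≠ b → b ≠ c → a ≠ c →
    EuclideanGeometry.angle a b c ≤ α

/-- Every element has, for some `i`, its shortest edge `ab` on the line `x = x_i` and its third
vertex `c` on one of the neighbouring lines `x = x_{i+1}` or `x = x_{i-1}`. -/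
def LineStructured (𝒯 : Triangulation Ω) (n : ℕ) (x : ℕ → ℝ) : Prop :=
  ∀ t ∈ 𝒯.elements, ∃ i j : ℕ, i ≤ n ∧ j ≤ n ∧ (j = i + 1 ∨ i = j + 1) ∧
    ∃ a ∈ t, ∃ b ∈ t, ∃ c ∈ t, a ≠ b ∧ b ≠ c ∧ a ≠ c ∧
      a 0 = x i ∧ b 0 = x i ∧ c 0 = x j ∧ dist a b ≤ dist a c ∧ dist a b ≤ dist b c

/-- Every node is anisotropic: `h_z < c₀ H_z`, and every element of `ω_z` has area comparable
with that of `ω_z` (the bound `|T| ≤ |ω_z|` being trivial). -/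
def AllNodesAnisotropic (𝒯 : Triangulation Ω) (c₀ M : ℝ) : Prop :=
  ∀ z ∈ 𝒯.nodes, 𝒯.nodeWidth z < c₀ * 𝒯.nodeDiam z ∧
    ∀ t ∈ 𝒯.elements, z ∈ t → area (𝒯.nodePatch z) ≤ M * area (hull t)

/-- Every node patch lies in a rectangle of comparable area whose sides are parallel to the
coordinate axes. -/
def GlobalOrientation (𝒯 : Triangulation Ω) (M : ℝ) : Prop :=
  ∀ z ∈ 𝒯.nodes, ∃ a b c d : ℝ, 𝒯.nodePatch z ⊆ closedRect a b c d ∧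
    area (closedRect a b c d) ≤ M * area (𝒯.nodePatch z)

/-! ### Linear finite elements -/

/-- The finite element space `S_h`: functions continuous on the closure of `Ω`, affine on every
element, and vanishing on `∂Ω`. -/
def FESpace (𝒯 : Triangulation Ω) : Set (Plane → ℝ) :=
  {v | ContinuousOn v (closure Ω) ∧ (∀ p ∈ frontier Ω, v p = 0) ∧
    ∀ t ∈ 𝒯.elements, ∃ g : Plane →ᵃ[ℝ] ℝ, Set.EqOn v g (hull t)}

/-- `u_h` is the finite element solution. The gradients exist at all points of `Ω` off the mesh
edges, hence almost everywhere. -/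
def IsFESolution (𝒯 : Triangulation Ω) (f uh : Plane → ℝ) : Prop :=
  uh ∈ 𝒯.FESpace ∧ ∀ v ∈ 𝒯.FESpace,
    ∫ p in Ω, ⟪gradient uh p, gradient v p⟫ = ∫ p in Ω, f p * v p

/-- The constant gradient on the element `t` of a piecewise affine function, read off at the
barycentre of `t`. -/
def elementGradient (v : Plane → ℝ) (t : Finset Plane) : Plane :=
  gradient v (t.centroid ℝ id)

/-- The unit normal to the edge `S` of the triangle `t` that points out of `t`: the component
orthogonal to `S` of the vector from the barycentre of `t` to the midpoint of `S`, normalized. -/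
def outerNormal (S t : Finset Plane) : Plane :=
  let w : Plane := (vectorSpan ℝ (S : Set Plane))ᗮ.starProjection
    (S.centroid ℝ id - t.centroid ℝ id)
  ‖w‖⁻¹ • w

/-- The jump `J_S` in the normal derivative of `v` across the interior edge `S`: the sum, over
the two elements `t` sharing `S`, of the derivatives of `v|_t` in the direction of the outer
normal of `t`. -/
def jump (𝒯 : Triangulation Ω) (v : Plane → ℝ) (S : Finset Plane) : ℝ :=
  ∑ t ∈ 𝒯.elementsAt S, ⟪elementGradient v t, outerNormal S t⟫

/-! ### The estimator and the error -/

open Classical in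
/-- The short edges in the open set `D`: edges `S` not on `∂Ω` with `|S| < c₀ diam ω_S`, whose
relative interior lies in `D`. -/
def shortEdges (𝒯 : Triangulation Ω) (c₀ : ℝ) (D : Set Plane) : Finset (Finset Plane) :=
  {S ∈ 𝒯.edges | ¬ hull S ⊆ frontier Ω ∧
    Metric.diam (hull S) < c₀ * Metric.diam (𝒯.edgePatch S) ∧ hull S \ (S : Set Plane) ⊆ D}

/-- The short-edge jump residual term `(∑_S |ω_S| J_S²)^{1/2}` over the short edges in `D`. -/
def shortEdgeEstimator (𝒯 : Triangulation Ω) (c₀ : ℝ) (uh : Plane → ℝ) (D : Set Plane) : ℝ :=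
  √(∑ S ∈ 𝒯.shortEdges c₀ D, area (𝒯.edgePatch S) * 𝒯.jump uh S ^ 2)

/-- `osc(f; D) = sup_D f - inf_D f`, with essential supremum and infimum. -/
def osc (f : Plane → ℝ) (D : Set Plane) : ℝ :=
  essSup f (volume.restrict D) - essInf f (volume.restrict D)

/-- `‖H_T osc(f; T)‖_{L²(D)}`, the norm of the function equal to `diam T * osc(f; T)` on each
element `T`. -/
def dataOscillation (𝒯 : Triangulation Ω) (f : Plane → ℝ) (D : Set Plane) : ℝ :=
  √(∑ t ∈ 𝒯.elements, (Metric.diam (hull t) * osc f (hull t)) ^ 2 * area (hull t ∩ D))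

/-- `‖∇(u_h - u)‖_{L²(D)}`, where `G` is the weak gradient of `u`. -/
def gradientError (uh : Plane → ℝ) (G : Plane → Plane) (D : Set Plane) : ℝ :=
  √(∫ p in D, ‖gradient uh p - G p‖ ^ 2)

end Triangulation

end AnisoMesh

end

noncomputable section

namespace AnisoMesh

/-! ### Coordinates in the plane -/

/-! By A1 the lines x = x_k cut the mesh into vertical strips. Inside a strip the triangles are
stacked from bottom to top; each has a vertical side of length h (its height) on one of the two
lines, and the width H of the strip. The maximal angle condition and the minimality of the vertical
side give h ≤ cH. A2 and A3 bound the vertical extent of every triangle around a node by a multiple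
of the height of any of them, so edges joining two lines ("long" edges) have slopes O(h/H).

Error and jumps are linked by test functions v with mean zero on every triangle. Then ∑∫_T ∇u_h·∇v =
∑∫_T ∇(u_h-u)·∇v + ∑∫_T (f-c_T)v for any constants c_T, and the right side is bounded by the local
errors weighted with sup_T|∇v| (`abs_sum_inner_gradient_le`). The mean-zero condition makes f enter
through its oscillation alone.

Long edges are treated one at a time (`exists_jump_le`): v is a bump in x times an even cut-off of
the distance to the edge, of scale h, whose integral vanishes on each side of the edge. This
controls the jump of ∂_y u_h. Continuity of u_h along the edge makes the jump of ∂_x u_h equal to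
minus the slope times that jump, so it is smaller by the factor h/H.

For a vertical edge a single bubble has gradient of size 1/h where 1/H is needed, which loses the
aspect ratio. So all edges on one line are treated together. The jumps J of ∂_x u_h across them form
a step function of y. By summation by parts up each strip, its discontinuity at a node is a sum of
boundedly many jumps of ∂_x u_h across long edges, which are small by the above
(`exists_sideJump_sq_le`). Hence J has a smoothing w with |w - J| ≤ E and |w'| ≲ E/h, E being the
small discontinuities at the two nodes of the edge (`exists_smooth_steps`). Test with ψ(x)w(y),
where ψ lives at the scale H, equals 1 on the line, and has vanishing moments of orders 0 and 1 on
both sides. As w is constant near the nodes, slanted sides do not see it vary; every triangle then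
contributes mean zero, and the gradient terms collapse to -∑ J∫w over the edges. The gradient of the
test function is of size (|J|+E)/H + E/h, and ∑ hH J² is absorbed (`exists_sum_partner_le`,
`sum_jump_sq_le`).

Finally the edges in Ω_i are classified as vertical edges on x = x_i or long edges in one of the two
adjacent strips, and the estimates are added (`classify_edge`, `exists_sum_edges_le`). -/

/-- The point with coordinates `x` and `y`. -/
def pt (x y : ℝ) : Plane := !₂[x, y]

@[simp] lemma pt_zero (x y : ℝ) : pt x y 0 = x := rfl

@[simp] lemma pt_one (x y : ℝ) : pt x y 1 = y := rfl

lemma pt_eta (p : Plane) : pt (p 0) (p 1) = p := by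
  ext i; fin_cases i <;> rfl

lemma pt_inj {x y x' y' : ℝ} : pt x y = pt x' y' ↔ x = x' ∧ y = y' := by
  refine ⟨fun h => ⟨by simpa using congrArg (fun p : Plane => p 0) h,
    by simpa using congrArg (fun p : Plane => p 1) h⟩, ?_⟩
  rintro ⟨rfl, rfl⟩; rfl

lemma plane_ext {p q : Plane} (h0 : p 0 = q 0) (h1 : p 1 = q 1) : p = q := by
  ext i; fin_cases i <;> assumption

lemma plane_inner (p q : Plane) : ⟪p, q⟫ = p 0 * q 0 + p 1 * q 1 := by
  simp [PiLp.inner_apply, Fin.sum_univ_two]; ring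

lemma plane_norm_sq (p : Plane) : ‖p‖ ^ 2 = p 0 ^ 2 + p 1 ^ 2 := by
  simp [EuclideanSpace.norm_sq_eq, Fin.sum_univ_two]

lemma plane_abs_apply_le (p : Plane) (i : Fin 2) : |p i| ≤ ‖p‖ := by
  simpa using PiLp.norm_apply_le p i

lemma continuous_coord (i : Fin 2) : Continuous fun p : Plane => p i := by fun_prop

lemma contDiff_coord (i : Fin 2) : ContDiff ℝ ∞ fun p : Plane => p i := by fun_prop

lemma continuous_pt : Continuous fun q : ℝ × ℝ => pt q.1 q.2 := by
  unfold pt; fun_prop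

/-- The coordinates of a point of the plane. -/
def coords : Plane ≃ᵐ ℝ × ℝ :=
  (MeasurableEquiv.toLp 2 (Fin 2 → ℝ)).symm.trans MeasurableEquiv.finTwoArrow

lemma coords_apply (p : Plane) : coords p = (p 0, p 1) := rfl

lemma coords_symm_apply (q : ℝ × ℝ) : coords.symm q = pt q.1 q.2 := by
  apply coords.injective
  rw [MeasurableEquiv.apply_symm_apply, coords_apply]; rfl

lemma measurePreserving_coords : MeasurePreserving coords :=
  (volume_preserving_finTwoArrow ℝ).comp (EuclideanSpace.volume_preserving_symm_measurableEquiv_toLp _)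

lemma setIntegral_plane {E : Type*} [NormedAddCommGroup E] [NormedSpace ℝ E]
    (F : Plane → E) (s : Set (ℝ × ℝ)) :
    ∫ p in {p : Plane | (p 0, p 1) ∈ s}, F p = ∫ q in s, F (pt q.1 q.2) := by
  have h := measurePreserving_coords.setIntegral_preimage_emb coords.measurableEmbedding
    (fun q => F (pt q.1 q.2)) s
  rw [← h]
  have : (coords ⁻¹' s) = {p : Plane | (p 0, p 1) ∈ s} := by ext p; simp [coords_apply]
  rw [this]
  simp [coords_apply, pt_eta]

/-- The affine function with the values `y₀` at `X₀` and `y₁` at `X₁`. -/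
def lerp (X₀ X₁ y₀ y₁ x : ℝ) : ℝ := y₀ + (y₁ - y₀) * ((x - X₀) / (X₁ - X₀))

lemma lerp_left (X₀ X₁ y₀ y₁ : ℝ) : lerp X₀ X₁ y₀ y₁ X₀ = y₀ := by simp [lerp]

lemma lerp_right {X₀ X₁ : ℝ} (h : X₀ < X₁) (y₀ y₁ : ℝ) : lerp X₀ X₁ y₀ y₁ X₁ = y₁ := by
  have : X₁ - X₀ ≠ 0 := (sub_pos.2 h).ne'
  simp [lerp, this]

lemma continuous_lerp (X₀ X₁ y₀ y₁ : ℝ) : Continuous (lerp X₀ X₁ y₀ y₁) := by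
  unfold lerp; fun_prop

lemma lerp_sub (X₀ X₁ y₀ y₁ z₀ z₁ x : ℝ) :
    lerp X₀ X₁ y₀ y₁ x - lerp X₀ X₁ z₀ z₁ x = lerp X₀ X₁ (y₀ - z₀) (y₁ - z₁) x := by
  simp only [lerp]; ring

lemma lerp_combo {X₀ X₁ x : ℝ} (y₀ y₁ : ℝ) : lerp X₀ X₁ y₀ y₁ x =
    (1 - (x - X₀) / (X₁ - X₀)) * y₀ + (x - X₀) / (X₁ - X₀) * y₁ := by
  simp only [lerp]; ring

lemma param_mem {X₀ X₁ x : ℝ} (h : X₀ < X₁) (hx : x ∈ Set.Icc X₀ X₁) :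
    0 ≤ (x - X₀) / (X₁ - X₀) ∧ (x - X₀) / (X₁ - X₀) ≤ 1 :=
  ⟨div_nonneg (sub_nonneg.2 hx.1) (sub_pos.2 h).le,
    (div_le_one (sub_pos.2 h)).2 (by linarith [hx.2])⟩

lemma lerp_mono {X₀ X₁ x y₀ y₁ z₀ z₁ : ℝ} (h : X₀ < X₁) (hx : x ∈ Set.Icc X₀ X₁)
    (h₀ : y₀ ≤ z₀) (h₁ : y₁ ≤ z₁) : lerp X₀ X₁ y₀ y₁ x ≤ lerp X₀ X₁ z₀ z₁ x := by
  obtain ⟨h0, h1⟩ := param_mem h hx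
  rw [lerp_combo, lerp_combo]
  have := mul_le_mul_of_nonneg_left h₀ (sub_nonneg.2 h1)
  have := mul_le_mul_of_nonneg_left h₁ h0
  linarith

lemma lerp_affine (X₀ X₁ y₀ y₁ x x' : ℝ) :
    lerp X₀ X₁ y₀ y₁ x' = lerp X₀ X₁ y₀ y₁ x + (y₁ - y₀) / (X₁ - X₀) * (x' - x) := by
  simp only [lerp]; ring

lemma hasDerivAt_lerp (X₀ X₁ y₀ y₁ x : ℝ) :
    HasDerivAt (lerp X₀ X₁ y₀ y₁) ((y₁ - y₀) / (X₁ - X₀)) x := by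
  have : lerp X₀ X₁ y₀ y₁ = fun x' => lerp X₀ X₁ y₀ y₁ x + (y₁ - y₀) / (X₁ - X₀) * (x' - x) :=
    funext fun x' => lerp_affine X₀ X₁ y₀ y₁ x x'
  rw [this]
  simpa using (((hasDerivAt_id x).sub_const x).const_mul ((y₁ - y₀) / (X₁ - X₀))).const_add
    (lerp X₀ X₁ y₀ y₁ x)

lemma convexCombo_pt (X₀ X₁ y₀ y₁ x : ℝ) (h : X₀ < X₁) :
    (1 - (x - X₀) / (X₁ - X₀)) • pt X₀ y₀ + ((x - X₀) / (X₁ - X₀)) • pt X₁ y₁ =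
      pt x (lerp X₀ X₁ y₀ y₁ x) := by
  have : X₁ - X₀ ≠ 0 := (sub_pos.2 h).ne'
  apply plane_ext
  · simp; field_simp; ring
  · simp [lerp]; ring

/-! ### Triangles with a vertical side, between two vertical lines -/

/-- The closed region between two segments that join the lines `x = X₀` and `x = X₁`. -/
def trapezoid (X₀ X₁ : ℝ) (lo up : Fin 2 → ℝ) : Set Plane :=
  {p | X₀ ≤ p 0 ∧ p 0 ≤ X₁ ∧ lerp X₀ X₁ (lo 0) (lo 1) (p 0) ≤ p 1 ∧
    p 1 ≤ lerp X₀ X₁ (up 0) (up 1) (p 0)}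

/-- The triangle `t` has two vertices on one of the lines `x = X₀`, `x = X₁` and one on the other;
`lo` and `up` are the ordinates of its lowest and highest points on these two lines. -/
structure StripTriangle (t : Finset Plane) (X₀ X₁ : ℝ) (lo up : Fin 2 → ℝ) : Prop where
  lt : X₀ < X₁
  shape : (lo 0 < up 0 ∧ lo 1 = up 1) ∨ (lo 0 = up 0 ∧ lo 1 < up 1)
  coe_eq : (t : Set Plane) = {pt X₀ (lo 0), pt X₀ (up 0), pt X₁ (lo 1), pt X₁ (up 1)}

lemma convex_trapezoid (X₀ X₁ : ℝ) (lo up : Fin 2 → ℝ) : Convex ℝ (trapezoid X₀ X₁ lo up) := by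
  intro p hp q hq a b ha hb hab
  obtain rfl : b = 1 - a := by linarith
  obtain ⟨h1, h2, h3, h4⟩ := hp
  obtain ⟨k1, k2, k3, k4⟩ := hq
  have key : ∀ y₀ y₁, lerp X₀ X₁ y₀ y₁ (a * p 0 + (1 - a) * q 0) =
      a * lerp X₀ X₁ y₀ y₁ (p 0) + (1 - a) * lerp X₀ X₁ y₀ y₁ (q 0) := by
    intro y₀ y₁; simp only [lerp]; ring
  refine ⟨?_, ?_, ?_, ?_⟩ <;>
    simp only [PiLp.add_apply, PiLp.smul_apply, smul_eq_mul, key] <;> nlinarith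

namespace StripTriangle

variable {t : Finset Plane} {X₀ X₁ : ℝ} {lo up : Fin 2 → ℝ}

lemma le (h : StripTriangle t X₀ X₁ lo up) (b : Fin 2) : lo b ≤ up b := by
  rcases h.shape with ⟨h0, h1⟩ | ⟨h0, h1⟩ <;> fin_cases b <;> simp <;> linarith

lemma pos (h : StripTriangle t X₀ X₁ lo up) : 0 < X₁ - X₀ := sub_pos.2 h.lt

lemma mem_iff (h : StripTriangle t X₀ X₁ lo up) {p : Plane} :
    p ∈ t ↔ p = pt X₀ (lo 0) ∨ p = pt X₀ (up 0) ∨ p = pt X₁ (lo 1) ∨ p = pt X₁ (up 1) := by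
  rw [← Finset.mem_coe, h.coe_eq]; simp

lemma lerp_le (h : StripTriangle t X₀ X₁ lo up) {x : ℝ} (hx : x ∈ Set.Icc X₀ X₁) :
    lerp X₀ X₁ (lo 0) (lo 1) x ≤ lerp X₀ X₁ (up 0) (up 1) x :=
  lerp_mono h.lt hx (h.le 0) (h.le 1)

lemma lerp_lt (h : StripTriangle t X₀ X₁ lo up) {x : ℝ} (hx : x ∈ Set.Ioo X₀ X₁) :
    lerp X₀ X₁ (lo 0) (lo 1) x < lerp X₀ X₁ (up 0) (up 1) x := by
  have h1 : 0 < (x - X₀) / (X₁ - X₀) := div_pos (sub_pos.2 hx.1) h.pos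
  have h2 : (x - X₀) / (X₁ - X₀) < 1 := (div_lt_one h.pos).2 (by linarith [hx.2])
  rw [lerp_combo, lerp_combo]
  rcases h.shape with ⟨h0, h3⟩ | ⟨h0, h3⟩
  · rw [h3]
    have := mul_lt_mul_of_pos_left h0 (sub_pos.2 h2); linarith
  · rw [h0]
    have := mul_lt_mul_of_pos_left h3 h1; linarith

/-- Each point of the trapezoid lies on a vertical segment between the two slanted sides, whose
points are convex combinations of vertices with the same parameter. -/
lemma hull_eq (h : StripTriangle t X₀ X₁ lo up) : hull t = trapezoid X₀ X₁ lo up := by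
  apply Set.Subset.antisymm
  · apply convexHull_min _ (convex_trapezoid _ _ _ _)
    rw [h.coe_eq]
    have h0 := h.le 0
    have h1 := h.le 1
    have hl := h.lt.le
    rintro p (rfl | rfl | rfl | rfl) <;>
      simp [trapezoid, lerp_left, lerp_right h.lt, h0, h1, hl]
  · intro p hp
    obtain ⟨h1, h2, h3, h4⟩ := hp
    have hx : p 0 ∈ Set.Icc X₀ X₁ := ⟨h1, h2⟩
    have hpar := param_mem h.lt hx
    have hv : ∀ q, q ∈ t → q ∈ hull t := fun q hq => subset_convexHull ℝ _ hq
    have hA : pt (p 0) (lerp X₀ X₁ (lo 0) (lo 1) (p 0)) ∈ hull t := by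
      rw [← convexCombo_pt _ _ _ _ _ h.lt]
      exact convex_convexHull ℝ _ (hv _ (h.mem_iff.2 (by simp))) (hv _ (h.mem_iff.2 (by simp)))
        (by linarith) hpar.1 (by ring)
    have hB : pt (p 0) (lerp X₀ X₁ (up 0) (up 1) (p 0)) ∈ hull t := by
      rw [← convexCombo_pt _ _ _ _ _ h.lt]
      exact convex_convexHull ℝ _ (hv _ (h.mem_iff.2 (by simp))) (hv _ (h.mem_iff.2 (by simp)))
        (by linarith) hpar.1 (by ring)
    have hseg : p 1 ∈ segment ℝ (lerp X₀ X₁ (lo 0) (lo 1) (p 0))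
        (lerp X₀ X₁ (up 0) (up 1) (p 0)) := by
      rw [segment_eq_Icc (h3.trans h4)]; exact ⟨h3, h4⟩
    obtain ⟨a, b, ha, hb, hab, he⟩ := hseg
    have : p = a • pt (p 0) (lerp X₀ X₁ (lo 0) (lo 1) (p 0)) +
        b • pt (p 0) (lerp X₀ X₁ (up 0) (up 1) (p 0)) := by
      apply plane_ext
      · simp; rw [← add_mul, hab, one_mul]
      · simpa using he.symm
    rw [this]
    exact convex_convexHull ℝ _ hA hB ha hb hab

lemma mem_hull (h : StripTriangle t X₀ X₁ lo up) {p : Plane} :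
    p ∈ hull t ↔ X₀ ≤ p 0 ∧ p 0 ≤ X₁ ∧ lerp X₀ X₁ (lo 0) (lo 1) (p 0) ≤ p 1 ∧
      p 1 ≤ lerp X₀ X₁ (up 0) (up 1) (p 0) := by
  rw [h.hull_eq]; rfl

end StripTriangle

lemma isCompact_hull (t : Finset Plane) : IsCompact (hull t) :=
  t.finite_toSet.isCompact_convexHull (𝕜 := ℝ)

lemma measurableSet_hull (t : Finset Plane) : MeasurableSet (hull t) :=
  (isCompact_hull t).isClosed.measurableSet

namespace StripTriangle

variable {t : Finset Plane} {X₀ X₁ : ℝ} {lo up : Fin 2 → ℝ}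

/-- Fubini on the region between two graphs; all integrals over elements are reduced to this
iterated form. -/
lemma setIntegral_hull (h : StripTriangle t X₀ X₁ lo up) {F : Plane → ℝ} (hF : Continuous F) :
    ∫ p in hull t, F p = ∫ x in X₀..X₁, ∫ y in (lerp X₀ X₁ (lo 0) (lo 1) x)..
      (lerp X₀ X₁ (up 0) (up 1) x), F (pt x y) := by
  set s : Set (ℝ × ℝ) := {q | pt q.1 q.2 ∈ hull t} with hs
  have e1 : hull t = {p : Plane | (p 0, p 1) ∈ s} := by ext p; simp [hs, pt_eta]
  have hsm : MeasurableSet s := continuous_pt.measurable (measurableSet_hull t)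
  have hc : Continuous fun q : ℝ × ℝ => F (pt q.1 q.2) := hF.comp continuous_pt
  have hint : IntegrableOn (fun q : ℝ × ℝ => F (pt q.1 q.2)) s := by
    have hcomp : IsCompact s := by
      have : s = coords.symm ⁻¹' hull t := by ext q; simp [hs, coords_symm_apply]
      have h2 : s = (fun p : Plane => (p 0, p 1)) '' hull t := by
        ext q; constructor
        · intro hq; exact ⟨pt q.1 q.2, hq, rfl⟩
        · rintro ⟨p, hp, rfl⟩; simpa [hs, pt_eta] using hp
      rw [h2]
      exact (isCompact_hull t).image (by fun_prop)
    exact hc.continuousOn.integrableOn_compact hcomp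
  have e2 : ∫ p in hull t, F p = ∫ q in s, F (pt q.1 q.2) := by
    conv_lhs => rw [e1]
    exact setIntegral_plane F s
  rw [e2, ← integral_indicator hsm, Measure.volume_eq_prod, integral_prod]
  · rw [intervalIntegral.integral_of_le h.lt.le, ← integral_Icc_eq_integral_Ioc,
      ← integral_indicator measurableSet_Icc]
    congr 1; ext x
    by_cases hx : x ∈ Set.Icc X₀ X₁
    · rw [Set.indicator_of_mem hx, intervalIntegral.integral_of_le (h.lerp_le hx),
        ← integral_Icc_eq_integral_Ioc, ← integral_indicator measurableSet_Icc]
      congr 1; ext y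
      simp only [Set.indicator_apply, hs, Set.mem_ofPred_eq, h.mem_hull, Set.mem_Icc, pt_zero,
        pt_one]
      simp [hx.1, hx.2]
    · rw [Set.indicator_of_notMem hx]
      rw [← integral_zero ℝ ℝ (μ := volume)]
      congr 1; ext y
      apply Set.indicator_of_notMem
      simp only [hs, Set.mem_ofPred_eq, h.mem_hull, pt_zero, pt_one]
      exact fun hh => hx ⟨hh.1, hh.2.1⟩
  · rw [← Measure.volume_eq_prod]
    exact hint.integrable_indicator hsm

/-- The length of the vertical side. -/
lemma height_pos (h : StripTriangle t X₀ X₁ lo up) : 0 < (up 0 - lo 0) + (up 1 - lo 1) := by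
  rcases h.shape with ⟨h0, h1⟩ | ⟨h0, h1⟩ <;> linarith

lemma area_hull (h : StripTriangle t X₀ X₁ lo up) :
    area (hull t) = ((up 0 - lo 0) + (up 1 - lo 1)) * (X₁ - X₀) / 2 := by
  have h1 := h.setIntegral_hull (F := fun _ => 1) continuous_const
  have h2 : ∫ _ in hull t, (1 : ℝ) = area (hull t) := by
    simp [area, measureReal_def]
  rw [← h2, h1]
  simp only [intervalIntegral.integral_const, smul_eq_mul, mul_one, lerp_sub]
  have hd : ∀ x ∈ Set.uIcc X₀ X₁, HasDerivAt (fun x => (up 0 - lo 0) * x +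
      ((up 1 - lo 1) - (up 0 - lo 0)) / (X₁ - X₀) * ((x - X₀) ^ 2 / 2))
      (lerp X₀ X₁ (up 0 - lo 0) (up 1 - lo 1) x) x := by
    intro x _
    have := ((hasDerivAt_id x).const_mul (up 0 - lo 0)).add
      (((((hasDerivAt_id x).sub_const X₀).pow 2).div_const 2).const_mul
        (((up 1 - lo 1) - (up 0 - lo 0)) / (X₁ - X₀)))
    convert! this using 1
    simp [lerp]; ring
  rw [intervalIntegral.integral_eq_sub_of_hasDerivAt hd
    ((continuous_lerp _ _ _ _).intervalIntegrable _ _)]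
  have := h.pos.ne'
  field_simp
  ring

lemma width_le_diam (h : StripTriangle t X₀ X₁ lo up) : X₁ - X₀ ≤ Metric.diam (hull t) := by
  have h1 := Metric.dist_le_diam_of_mem (isCompact_hull t).isBounded
    (subset_convexHull ℝ _ (h.mem_iff.2 (Or.inl rfl)) : pt X₀ (lo 0) ∈ hull t)
    (subset_convexHull ℝ _ (h.mem_iff.2 (Or.inr (Or.inr (Or.inl rfl)))) : pt X₁ (lo 1) ∈ hull t)
  have h2 := plane_abs_apply_le (pt X₁ (lo 1) - pt X₀ (lo 0)) 0
  rw [dist_comm, dist_eq_norm] at h1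
  simp only [PiLp.sub_apply, pt_zero] at h2
  linarith [le_abs_self (X₁ - X₀)]

lemma height_le_diam (h : StripTriangle t X₀ X₁ lo up) :
    (up 0 - lo 0) + (up 1 - lo 1) ≤ Metric.diam (hull t) := by
  have key : ∀ x, ∀ y y', pt x y ∈ t → pt x y' ∈ t → y' - y ≤ Metric.diam (hull t) := by
    intro x y y' hy hy'
    have h1 := Metric.dist_le_diam_of_mem (isCompact_hull t).isBounded
      (subset_convexHull ℝ _ hy : _ ∈ hull t) (subset_convexHull ℝ _ hy' : _ ∈ hull t)
    have h2 := plane_abs_apply_le (pt x y' - pt x y) 1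
    rw [dist_comm, dist_eq_norm] at h1
    simp only [PiLp.sub_apply, pt_one] at h2
    linarith [le_abs_self (y' - y)]
  rcases h.shape with ⟨h0, h1⟩ | ⟨h0, h1⟩
  · have := key X₀ (lo 0) (up 0) (h.mem_iff.2 (by simp)) (h.mem_iff.2 (by simp))
    linarith
  · have := key X₁ (lo 1) (up 1) (h.mem_iff.2 (by simp)) (h.mem_iff.2 (by simp))
    linarith

end StripTriangle

/-! ### The unit square -/

/-- The coordinates as a homeomorphism. -/
def coordsHomeo : Plane ≃ₜ ℝ × ℝ :=
  (EuclideanSpace.equiv (Fin 2) ℝ).toHomeomorph.trans Homeomorph.finTwoArrow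

lemma coordsHomeo_apply (p : Plane) : coordsHomeo p = (p 0, p 1) := rfl

lemma openRect_eq (a b c d : ℝ) :
    openRect a b c d = coordsHomeo ⁻¹' (Set.Ioo a b ×ˢ Set.Ioo c d) := by
  ext p; simp [openRect, coordsHomeo_apply, and_assoc]

lemma closedRect_eq (a b c d : ℝ) :
    closedRect a b c d = coordsHomeo ⁻¹' (Set.Icc a b ×ˢ Set.Icc c d) := by
  ext p
  simp only [closedRect, coordsHomeo_apply, Set.mem_ofPred_eq, Set.mem_preimage, Set.mem_prod,
    Set.mem_Icc]
  tauto

lemma isOpen_openRect (a b c d : ℝ) : IsOpen (openRect a b c d) := by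
  rw [openRect_eq]
  exact (isOpen_Ioo.prod isOpen_Ioo).preimage coordsHomeo.continuous

lemma interior_closedRect (a b c d : ℝ) : interior (closedRect a b c d) = openRect a b c d := by
  rw [closedRect_eq, openRect_eq, ← Homeomorph.preimage_interior, interior_prod_eq, interior_Icc,
    interior_Icc]

lemma closure_openRect {a b c d : ℝ} (hab : a < b) (hcd : c < d) :
    closure (openRect a b c d) = closedRect a b c d := by
  rw [closedRect_eq, openRect_eq, ← Homeomorph.preimage_closure, closure_prod_eq,
    closure_Ioo hab.ne, closure_Ioo hcd.ne]

lemma convex_openRect (a b c d : ℝ) : Convex ℝ (openRect a b c d) := by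
  intro p hp q hq s t hs ht hst
  obtain ⟨h1, h2, h3, h4⟩ := hp
  obtain ⟨k1, k2, k3, k4⟩ := hq
  have k : ∀ (i : Fin 2) (l r : ℝ), l < p i → p i < r → l < q i → q i < r →
      l < (s • p + t • q) i ∧ (s • p + t • q) i < r := by
    intro i l r a1 a2 a3 a4
    exact (convex_Ioo l r) ⟨a1, a2⟩ ⟨a3, a4⟩ hs ht hst
  exact ⟨(k 0 a b h1 h2 k1 k2).1, (k 0 a b h1 h2 k1 k2).2, (k 1 c d h3 h4 k3 k4).1,
    (k 1 c d h3 h4 k3 k4).2⟩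

lemma area_closedRect {a b c d : ℝ} (hab : a ≤ b) (hcd : c ≤ d) :
    area (closedRect a b c d) = (b - a) * (d - c) := by
  have h : closedRect a b c d = coords ⁻¹' (Set.Icc a b ×ˢ Set.Icc c d) := closedRect_eq _ _ _ _
  rw [area, h, measurePreserving_coords.measureReal_preimage
    (measurableSet_Icc.prod measurableSet_Icc).nullMeasurableSet, measureReal_def,
    Measure.volume_eq_prod, Measure.prod_prod, ENNReal.toReal_mul, Real.volume_Icc, Real.volume_Icc,
    ENNReal.toReal_ofReal (sub_nonneg.2 hab), ENNReal.toReal_ofReal (sub_nonneg.2 hcd)]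

lemma closure_unitSquare : closure unitSquare = closedRect 0 1 0 1 :=
  closure_openRect one_pos one_pos

lemma frontier_unitSquare : frontier unitSquare = closedRect 0 1 0 1 \ openRect 0 1 0 1 := by
  rw [frontier, closure_unitSquare, unitSquare, (isOpen_openRect _ _ _ _).interior_eq]

lemma ae_eq_closure_unitSquare : (unitSquare : Set Plane) =ᵐ[volume] closure unitSquare := by
  have h0 : volume (frontier unitSquare) = 0 :=
    (convex_openRect 0 1 0 1).addHaar_frontier volume
  rw [ae_eq_set]
  refine ⟨by simp [Set.sdiff_eq_empty.2 (subset_closure)], measure_mono_null ?_ h0⟩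
  intro p hp
  rw [frontier_unitSquare, ← closure_unitSquare]
  exact hp

lemma measurableSet_openRect (a b c d : ℝ) : MeasurableSet (openRect a b c d) :=
  (isOpen_openRect a b c d).measurableSet

/-! ### Elements of a triangulation -/

namespace Triangulation

variable {Ω : Set Plane} (𝒯 : Triangulation Ω) {s t : Finset Plane}

variable {𝒯} in
lemma mem_elements : t ∈ 𝒯.elements ↔ t ∈ 𝒯.complex.faces ∧ t.card = 3 := by
  simp [elements]

variable {𝒯} in
lemma mem_edges : t ∈ 𝒯.edges ↔ t ∈ 𝒯.complex.faces ∧ t.card = 2 := by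
  simp [edges]

variable {𝒯} in
lemma hull_subset_closure (ht : t ∈ 𝒯.complex.faces) : hull t ⊆ closure Ω := by
  rw [← 𝒯.space_eq]; exact 𝒯.complex.convexHull_subset_space ht

variable {𝒯} in
lemma subset_closure_of_mem_elements (ht : t ∈ 𝒯.elements) : hull t ⊆ closure Ω :=
  hull_subset_closure (mem_elements.1 ht).1

variable {𝒯} in
lemma inter_hull_subset (hs : s ∈ 𝒯.complex.faces) (ht : t ∈ 𝒯.complex.faces) :
    hull s ∩ hull t ⊆ convexHull ℝ ((s : Set Plane) ∩ t) :=
  𝒯.complex.inter_subset_convexHull hs ht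

lemma exists_element_of_mem {p : Plane} (hp : p ∈ closure Ω) : ∃ t ∈ 𝒯.elements, p ∈ hull t := by
  rw [← 𝒯.space_eq, 𝒯.complex.mem_space_iff] at hp
  obtain ⟨s, hs, hps⟩ := hp
  obtain ⟨t, ht, hst, hc⟩ := 𝒯.isPure s hs
  exact ⟨t, mem_elements.2 ⟨ht, hc⟩, convexHull_mono (by exact_mod_cast hst) hps⟩

/-- Starting from a point of an open set, one stays for a while in some element, in any given
direction. -/
lemma exists_element_in_direction (hΩ : IsOpen Ω) {p : Plane} (hp : p ∈ Ω) (d : Plane) :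
    ∃ t ∈ 𝒯.elements, p ∈ hull t ∧ ∃ ε : ℝ, 0 < ε ∧ p + ε • d ∈ hull t := by
  have htend : Tendsto (fun j : ℕ => p + (1 / ((j : ℝ) + 1)) • d) atTop (𝓝 p) := by
    have := (tendsto_one_div_add_atTop_nhds_zero_nat (𝕜 := ℝ)).smul_const d
    simpa using this.const_add p
  have hev : ∀ᶠ j : ℕ in atTop, p + (1 / ((j : ℝ) + 1)) • d ∈ Ω :=
    htend.eventually (hΩ.mem_nhds hp)
  -- The points p + d/(j+1) are eventually in Ω and are covered by finitely many elements, so one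
  -- element contains infinitely many of them; being closed it contains the limit p too.
  have : ∃ t ∈ 𝒯.elements, ∃ᶠ j : ℕ in atTop, p + (1 / ((j : ℝ) + 1)) • d ∈ hull t := by
    by_contra! hcon
    have h2 := (Filter.eventually_all_finset 𝒯.elements).2 fun t ht =>
      hcon t ht
    obtain ⟨j, h3, h4⟩ := (hev.and h2).exists
    obtain ⟨t, ht, h5⟩ := 𝒯.exists_element_of_mem (subset_closure h3)
    exact h4 t ht h5
  obtain ⟨t, ht, hfr⟩ := this
  refine ⟨t, ht, (isCompact_hull t).isClosed.mem_of_frequently_of_tendsto hfr htend, ?_⟩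
  obtain ⟨j, hj⟩ := hfr.exists
  exact ⟨1 / ((j : ℝ) + 1), by positivity, hj⟩

variable {𝒯} in
/-- An element containing a relative interior point of an edge has the edge as a side. -/
lemma mem_of_relInterior {a b p : Plane} (ht : t ∈ 𝒯.elements)
    (hs : s ∈ 𝒯.complex.faces) (ha : a ∈ s) (hb : b ∈ s)
    (hp : p ∈ openSegment ℝ a b) (hab : a ≠ b) (hpt : p ∈ hull t) : a ∈ t ∧ b ∈ t := by
  classical
  have hS : ({a, b} : Finset Plane) ∈ 𝒯.complex.faces := by
    refine 𝒯.complex.down_closed hs ?_ ⟨a, by simp⟩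
    intro q hq; simp at hq; rcases hq with rfl | rfl <;> assumption
  have hpS : p ∈ hull ({a, b} : Finset Plane) := by
    simp only [hull, Finset.coe_insert, Finset.coe_singleton, convexHull_pair]
    exact openSegment_subset_segment ℝ a b hp
  -- Conformity: the edge meets the element in the span of the common vertices. If one endpoint were
  -- missing from t, the point p would be the other endpoint.
  have h := inter_hull_subset hS (mem_elements.1 ht).1 ⟨hpS, hpt⟩
  constructor
  · by_contra ha'
    have : (({a, b} : Finset Plane) : Set Plane) ∩ t ⊆ {b} := by
      rintro q ⟨hq, hqt⟩
      simp at hq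
      rcases hq with rfl | rfl
      · exact absurd hqt ha'
      · rfl
    have h2 := convexHull_mono this h
    rw [convexHull_singleton, Set.mem_singleton_iff] at h2
    subst h2
    exact hab (right_mem_openSegment_iff.1 hp)
  · by_contra hb'
    have : (({a, b} : Finset Plane) : Set Plane) ∩ t ⊆ {a} := by
      rintro q ⟨hq, hqt⟩
      simp at hq
      rcases hq with rfl | rfl
      · rfl
      · exact absurd hqt hb'
    have h2 := convexHull_mono this h
    rw [convexHull_singleton, Set.mem_singleton_iff] at h2
    subst h2
    exact hab (left_mem_openSegment_iff.1 hp)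

variable {𝒯} in
-- Triangles have equally many vertices, so s has a vertex r outside t; the common face omits r and
-- lies in the side opposite to r.
lemma exists_inter_subset_erase [DecidableEq Plane] (hs : s ∈ 𝒯.elements) (ht : t ∈ 𝒯.elements)
    (hst : s ≠ t) : ∃ r ∈ s, hull s ∩ hull t ⊆ hull (s.erase r) := by
  have hsub : ¬ s ⊆ t := fun h => hst (Finset.eq_of_subset_of_card_le h
    (by rw [(mem_elements.1 hs).2, (mem_elements.1 ht).2]))
  obtain ⟨r, hr, hrt⟩ := Finset.not_subset.1 hsub
  refine ⟨r, hr, fun p hp => ?_⟩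
  refine convexHull_mono ?_ (inter_hull_subset (mem_elements.1 hs).1 (mem_elements.1 ht).1 hp)
  rintro q ⟨h1, h2⟩
  simp only [Finset.coe_erase, Set.mem_sdiff, Set.mem_singleton_iff]
  exact ⟨h1, fun h => hrt (h ▸ h2)⟩

variable {𝒯} in
-- The overlap lies in one side of s, whose affine span is proper by affine independence of the
-- vertices, hence null.
lemma aedisjoint_hull (hs : s ∈ 𝒯.elements) (ht : t ∈ 𝒯.elements) (hst : s ≠ t) :
    AEDisjoint volume (hull s) (hull t) := by
  classical
  obtain ⟨r, hr, hsub⟩ := exists_inter_subset_erase hs ht hst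
  have hind := 𝒯.complex.indep (mem_elements.1 hs).1
  have h1 := hind.notMem_affineSpan_sdiff ⟨r, hr⟩ Set.univ
  have h2 : ((↑) : s → Plane) '' (Set.univ \ {⟨r, hr⟩}) = ((s.erase r : Finset Plane) : Set Plane) := by
    ext q; simp [and_comm]
  rw [h2] at h1
  have h3 : affineSpan ℝ ((s.erase r : Finset Plane) : Set Plane) ≠ ⊤ := by
    intro h; rw [h] at h1; exact h1 (AffineSubspace.mem_top _ _ _)
  exact measure_mono_null (hsub.trans (convexHull_subset_affineSpan _))
    (Measure.addHaar_affineSubspace volume _ h3)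

lemma iUnion_hull : ⋃ t : 𝒯.elements, hull (t : Finset Plane) = closure Ω := by
  apply Set.Subset.antisymm
  · exact Set.iUnion_subset fun t => subset_closure_of_mem_elements t.2
  · intro p hp
    obtain ⟨t, ht, hpt⟩ := 𝒯.exists_element_of_mem hp
    exact Set.mem_iUnion.2 ⟨⟨t, ht⟩, hpt⟩

lemma setIntegral_eq_sum (𝒯 : Triangulation unitSquare) {F : Plane → ℝ}
    (hF : IntegrableOn F unitSquare) :
    ∫ p in unitSquare, F p = ∑ t ∈ 𝒯.elements, ∫ p in hull t, F p := by
  rw [setIntegral_congr_set ae_eq_closure_unitSquare, ← 𝒯.iUnion_hull, integral_iUnion_ae,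
    tsum_fintype, Finset.sum_coe_sort 𝒯.elements (fun t => ∫ p in hull t, F p)]
  · exact fun t => (measurableSet_hull _).nullMeasurableSet
  · intro s t hst
    exact aedisjoint_hull s.2 t.2 (fun h => hst (Subtype.ext h))
  · rw [𝒯.iUnion_hull]
    exact hF.congr_set_ae ae_eq_closure_unitSquare.symm

lemma ae_mem_interior_hull (t : Finset Plane) :
    ∀ᵐ p ∂volume.restrict (hull t), p ∈ interior (hull t) := by
  rw [ae_restrict_iff' (measurableSet_hull t)]
  have h0 : volume (frontier (hull t)) = 0 := (convex_convexHull ℝ _).addHaar_frontier volume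
  filter_upwards [measure_eq_zero_iff_ae_notMem.1 h0] with p hp hpt
  by_contra h
  exact hp ⟨subset_closure hpt, h⟩

end Triangulation

/-! ### Triangulations of the unit square into strips -/

/-- A triangulation of the unit square whose elements lie between neighbouring lines `x = x_k`,
`x = x_{k+1}`, with a vertical side that is the shortest one. -/
structure StripMesh (𝒯 : Triangulation unitSquare) (n : ℕ) (x : ℕ → ℝ) where
  x_zero : x 0 = 0
  x_last : x n = 1
  x_lt : ∀ i < n, x i < x (i + 1)
  strip : Finset Plane → ℕ
  lo : Finset Plane → Fin 2 → ℝ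
  up : Finset Plane → Fin 2 → ℝ
  strip_lt : ∀ t ∈ 𝒯.elements, strip t < n
  tri : ∀ t ∈ 𝒯.elements, StripTriangle t (x (strip t)) (x (strip t + 1)) (lo t) (up t)
  short : ∀ t ∈ 𝒯.elements, ((up t 0 - lo t 0) + (up t 1 - lo t 1)) ^ 2 ≤
      (x (strip t + 1) - x (strip t)) ^ 2 + (lo t 1 - lo t 0) ^ 2 ∧
    ((up t 0 - lo t 0) + (up t 1 - lo t 1)) ^ 2 ≤
      (x (strip t + 1) - x (strip t)) ^ 2 + (up t 1 - up t 0) ^ 2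

open Triangulation

lemma plane_dist_sq (p q : Plane) : dist p q ^ 2 = (p 0 - q 0) ^ 2 + (p 1 - q 1) ^ 2 := by
  rw [dist_eq_norm, plane_norm_sq]; simp

/-- The endpoints of the shortest edge are sorted by ordinate. Depending on whether the third vertex
is on the next or the previous line, the vertical side is the left or the right one; on the other
line `lo` and `up` coincide at the apex. -/
lemma exists_stripTriangle {t : Finset Plane} (hcard : t.card = 3) {n : ℕ} {x : ℕ → ℝ}
    (hx : ∀ i < n, x i < x (i + 1))
    (h : ∃ i j : ℕ, i ≤ n ∧ j ≤ n ∧ (j = i + 1 ∨ i = j + 1) ∧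
      ∃ a ∈ t, ∃ b ∈ t, ∃ c ∈ t, a ≠ b ∧ b ≠ c ∧ a ≠ c ∧
        a 0 = x i ∧ b 0 = x i ∧ c 0 = x j ∧ dist a b ≤ dist a c ∧ dist a b ≤ dist b c) :
    ∃ k : ℕ, ∃ lo up : Fin 2 → ℝ, k < n ∧ StripTriangle t (x k) (x (k + 1)) lo up ∧
      ((up 0 - lo 0) + (up 1 - lo 1)) ^ 2 ≤ (x (k + 1) - x k) ^ 2 + (lo 1 - lo 0) ^ 2 ∧
      ((up 0 - lo 0) + (up 1 - lo 1)) ^ 2 ≤ (x (k + 1) - x k) ^ 2 + (up 1 - up 0) ^ 2 := by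
  classical
  obtain ⟨i, j, hi, hj, hij, a, ha, b, hb, c, hc, hab, hbc, hac, ha0, hb0, hc0, hd1, hd2⟩ := h
  wlog hle : a 1 ≤ b 1 generalizing a b
  · exact this b hb a ha hab.symm hac hbc hb0 ha0 (by rwa [dist_comm])
      (by rwa [dist_comm]) (le_of_not_ge hle)
  have hlt : a 1 < b 1 := lt_of_le_of_ne hle fun h => hab (plane_ext (ha0.trans hb0.symm) h)
  have ht : t = {a, b, c} := by
    symm
    apply Finset.eq_of_subset_of_card_le
    · intro q hq; simp at hq; rcases hq with rfl | rfl | rfl <;> assumption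
    · rw [hcard, Finset.card_insert_of_notMem, Finset.card_insert_of_notMem, Finset.card_singleton]
      · simpa using hbc
      · simp [hab, hac]
  have hA : a = pt (x i) (a 1) := by rw [← ha0, pt_eta]
  have hB : b = pt (x i) (b 1) := by rw [← hb0, pt_eta]
  have hC : c = pt (x j) (c 1) := by rw [← hc0, pt_eta]
  have hs1 := pow_le_pow_left₀ dist_nonneg hd1 2
  have hs2 := pow_le_pow_left₀ dist_nonneg hd2 2
  rw [plane_dist_sq, plane_dist_sq, ha0, hb0, hc0] at hs1 hs2
  rcases hij with rfl | rfl
  · refine ⟨i, ![a 1, c 1], ![b 1, c 1], by omega, ⟨hx i (by omega), Or.inl (by simpa using hlt), ?_⟩,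
      ?_, ?_⟩
    · rw [ht]; ext q
      simp only [Finset.coe_insert, Finset.coe_singleton, Matrix.cons_val_zero, Matrix.cons_val_one,
        Set.mem_insert_iff, Set.mem_singleton_iff]
      rw [← hA, ← hB, ← hC]; tauto
    · simp; nlinarith
    · simp; nlinarith
  · refine ⟨j, ![c 1, a 1], ![c 1, b 1], by omega, ⟨hx j (by omega), Or.inr (by simpa using hlt), ?_⟩,
      ?_, ?_⟩
    · rw [ht]; ext q
      simp only [Finset.coe_insert, Finset.coe_singleton, Matrix.cons_val_zero, Matrix.cons_val_one,
        Set.mem_insert_iff, Set.mem_singleton_iff]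
      rw [← hA, ← hB, ← hC]; tauto
    · simp; nlinarith
    · simp; nlinarith

lemma exists_stripMesh {𝒯 : Triangulation unitSquare} {n : ℕ} {x : ℕ → ℝ} (h0 : x 0 = 0)
    (h1 : x n = 1) (hx : ∀ i < n, x i < x (i + 1)) (h : 𝒯.LineStructured n x) :
    Nonempty (StripMesh 𝒯 n x) := by
  have key : ∀ t ∈ 𝒯.elements, ∃ k : ℕ, ∃ lo up : Fin 2 → ℝ, k < n ∧
      StripTriangle t (x k) (x (k + 1)) lo up ∧
      ((up 0 - lo 0) + (up 1 - lo 1)) ^ 2 ≤ (x (k + 1) - x k) ^ 2 + (lo 1 - lo 0) ^ 2 ∧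
      ((up 0 - lo 0) + (up 1 - lo 1)) ^ 2 ≤ (x (k + 1) - x k) ^ 2 + (up 1 - up 0) ^ 2 :=
    fun t ht => exists_stripTriangle (mem_elements.1 ht).2 hx (h t ht)
  choose! k lo up h2 h3 h4 using key
  exact ⟨⟨h0, h1, hx, k, lo, up, h2, h3, h4⟩⟩

namespace StripMesh

variable {𝒯 : Triangulation unitSquare} {n : ℕ} {x : ℕ → ℝ} (m : StripMesh 𝒯 n x)
  {s t : Finset Plane}

/-- The lower side of an element. -/
def loAt (t : Finset Plane) (X : ℝ) : ℝ :=
  lerp (x (m.strip t)) (x (m.strip t + 1)) (m.lo t 0) (m.lo t 1) X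

/-- The upper side of an element. -/
def upAt (t : Finset Plane) (X : ℝ) : ℝ :=
  lerp (x (m.strip t)) (x (m.strip t + 1)) (m.up t 0) (m.up t 1) X

/-- The length of the vertical side of an element. -/
def height (t : Finset Plane) : ℝ := (m.up t 0 - m.lo t 0) + (m.up t 1 - m.lo t 1)

/-- The width of the strip that contains an element. -/
def width (t : Finset Plane) : ℝ := x (m.strip t + 1) - x (m.strip t)

lemma height_pos (ht : t ∈ 𝒯.elements) : 0 < m.height t := (m.tri t ht).height_pos

lemma width_pos (ht : t ∈ 𝒯.elements) : 0 < m.width t := (m.tri t ht).pos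

lemma area_hull (ht : t ∈ 𝒯.elements) : area (hull t) = m.height t * m.width t / 2 :=
  (m.tri t ht).area_hull

lemma mem_hull (ht : t ∈ 𝒯.elements) {p : Plane} : p ∈ hull t ↔
    x (m.strip t) ≤ p 0 ∧ p 0 ≤ x (m.strip t + 1) ∧ m.loAt t (p 0) ≤ p 1 ∧ p 1 ≤ m.upAt t (p 0) :=
  (m.tri t ht).mem_hull

include m in
lemma x_strictMono {i j : ℕ} (hij : i < j) (hj : j ≤ n) : x i < x j := by
  induction j, hij using Nat.le_induction with
  | base => exact m.x_lt i hj
  | succ j hij ih => exact (ih (by omega)).trans (m.x_lt j hj)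

include m in
lemma x_mono {i j : ℕ} (hij : i ≤ j) (hj : j ≤ n) : x i ≤ x j := by
  rcases hij.eq_or_lt with rfl | h
  · exact le_rfl
  · exact (m.x_strictMono h hj).le

include m in
lemma x_inj {i j : ℕ} (hi : i ≤ n) (hj : j ≤ n) (h : x i = x j) : i = j := by
  rcases lt_trichotomy i j with h1 | h1 | h1
  · exact absurd h (m.x_strictMono h1 hj).ne
  · exact h1
  · exact absurd h (m.x_strictMono h1 hi).ne'

lemma vertex_mem (ht : t ∈ 𝒯.elements) :
    pt (x (m.strip t)) (m.lo t 0) ∈ t ∧ pt (x (m.strip t)) (m.up t 0) ∈ t ∧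
      pt (x (m.strip t + 1)) (m.lo t 1) ∈ t ∧ pt (x (m.strip t + 1)) (m.up t 1) ∈ t := by
  simp [(m.tri t ht).mem_iff]

/-- The ordinates of the vertices lie in `[0, 1]`. -/
lemma bounds (ht : t ∈ 𝒯.elements) (b : Fin 2) : 0 ≤ m.lo t b ∧ m.up t b ≤ 1 := by
  have key : ∀ p ∈ t, 0 ≤ p 1 ∧ p 1 ≤ 1 := by
    intro p hp
    have := subset_closure_of_mem_elements ht (subset_convexHull ℝ _ hp)
    rw [closure_unitSquare] at this
    exact ⟨this.2.2.1, this.2.2.2⟩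
  obtain ⟨h1, h2, h3, h4⟩ := m.vertex_mem ht
  fin_cases b
  · exact ⟨(key _ h1).1, (key _ h2).2⟩
  · exact ⟨(key _ h3).1, (key _ h4).2⟩

/-- If two vertices of an element are on neighbouring lines, this determines the strip. -/
lemma strip_eq_of_mem (ht : t ∈ 𝒯.elements) {k : ℕ} (hk : k < n) {y₀ y₁ : ℝ}
    (h0 : pt (x k) y₀ ∈ t) (h1 : pt (x (k + 1)) y₁ ∈ t) : m.strip t = k := by
  have key : ∀ j ≤ n, ∀ y, pt (x j) y ∈ t → j = m.strip t ∨ j = m.strip t + 1 := by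
    intro j hj y hy
    have hlt := m.strip_lt t ht
    rcases (m.tri t ht).mem_iff.1 hy with h | h | h | h <;> have h := (pt_inj.1 h).1
    · exact Or.inl (m.x_inj hj (by omega) h)
    · exact Or.inl (m.x_inj hj (by omega) h)
    · exact Or.inr (m.x_inj hj (by omega) h)
    · exact Or.inr (m.x_inj hj (by omega) h)
  have := key k hk.le _ h0
  have := key (k + 1) hk _ h1
  omega

lemma eq_lo_or_up_zero (ht : t ∈ 𝒯.elements) {y : ℝ} (h : pt (x (m.strip t)) y ∈ t) :
    y = m.lo t 0 ∨ y = m.up t 0 := by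
  have hlt := (m.tri t ht).lt
  rcases (m.tri t ht).mem_iff.1 h with h | h | h | h <;> have h := pt_inj.1 h
  · exact Or.inl h.2
  · exact Or.inr h.2
  · exact absurd h.1 hlt.ne
  · exact absurd h.1 hlt.ne

lemma eq_lo_or_up_one (ht : t ∈ 𝒯.elements) {y : ℝ} (h : pt (x (m.strip t + 1)) y ∈ t) :
    y = m.lo t 1 ∨ y = m.up t 1 := by
  have hlt := (m.tri t ht).lt
  rcases (m.tri t ht).mem_iff.1 h with h | h | h | h <;> have h := pt_inj.1 h
  · exact absurd h.1 hlt.ne'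
  · exact absurd h.1 hlt.ne'
  · exact Or.inl h.2
  · exact Or.inr h.2

/-! ### The vertical order of the elements in a strip -/

lemma continuous_loAt (t : Finset Plane) : Continuous (m.loAt t) := continuous_lerp _ _ _ _

lemma continuous_upAt (t : Finset Plane) : Continuous (m.upAt t) := continuous_lerp _ _ _ _

/-- Two elements of a strip do not overlap on any vertical line. -/
lemma ordered_at (hs : s ∈ 𝒯.elements) (ht : t ∈ 𝒯.elements) (hk : m.strip s = m.strip t)
    (hst : s ≠ t) {X : ℝ} (hX : X ∈ Set.Ioo (x (m.strip s)) (x (m.strip s + 1))) :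
    m.upAt s X ≤ m.loAt t X ∨ m.upAt t X ≤ m.loAt s X := by
  classical
  by_contra! hcon
  obtain ⟨h1, h2⟩ := hcon
  have hls : m.loAt s X < m.upAt s X := (m.tri s hs).lerp_lt hX
  have hlt : m.loAt t X < m.upAt t X := (m.tri t ht).lerp_lt (hk ▸ hX)
  have hne : max (m.loAt s X) (m.loAt t X) < min (m.upAt s X) (m.upAt t X) := by
    simp [*]
  have hin : ∀ y, max (m.loAt s X) (m.loAt t X) ≤ y → y ≤ min (m.upAt s X) (m.upAt t X) →
      pt X y ∈ hull s ∩ hull t := by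
    intro y hy1 hy2
    rw [max_le_iff] at hy1
    rw [le_min_iff] at hy2
    exact ⟨(m.mem_hull hs).2 ⟨hX.1.le, hX.2.le, hy1.1, hy2.1⟩,
      (m.mem_hull ht).2 ⟨hk ▸ hX.1.le, hk ▸ hX.2.le, hy1.2, hy2.2⟩⟩
  -- If the sections at X overlapped, a vertical segment of positive length would lie in both
  -- triangles, hence in a single side of s. A slanted side meets the line at abscissa X only once,
  -- and the vertical side does not meet it.
  obtain ⟨r, hr, hsub⟩ := exists_inter_subset_erase hs ht hst
  have hp := hsub (hin _ le_rfl hne.le)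
  have hq := hsub (hin _ hne.le le_rfl)
  have hS := m.tri s hs
  have haff : ∀ (y₀ y₁ : ℝ), Convex ℝ {p : Plane | p 1 = lerp (x (m.strip s)) (x (m.strip s + 1)) y₀ y₁ (p 0)} := by
    intro y₀ y₁ p hp q hq a b ha hb hab
    obtain rfl : b = 1 - a := by linarith
    simp only [Set.mem_ofPred_eq, PiLp.add_apply, PiLp.smul_apply, smul_eq_mul] at *
    rw [hp, hq]; simp only [lerp]; ring
  have hline : ∀ Y : ℝ, Convex ℝ {p : Plane | p 0 = Y} := by
    intro Y p hp q hq a b ha hb hab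
    simp only [Set.mem_ofPred_eq, PiLp.add_apply, PiLp.smul_apply, smul_eq_mul] at *
    rw [hp, hq, ← add_mul, hab, one_mul]
  have onLine : ∀ y₀ y₁ : ℝ, (∀ v ∈ s, v ≠ r → v 1 = lerp (x (m.strip s)) (x (m.strip s + 1)) y₀ y₁ (v 0)) → False := by
    intro y₀ y₁ hv
    have hsub2 : hull (s.erase r) ⊆ {p : Plane | p 1 = lerp (x (m.strip s)) (x (m.strip s + 1)) y₀ y₁ (p 0)} := by
      refine convexHull_min (fun v hv' => ?_) (haff _ _)
      rw [Finset.mem_coe, Finset.mem_erase] at hv'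
      exact hv v hv'.2 hv'.1
    have e1 := hsub2 hp
    have e2 := hsub2 hq
    simp only [Set.mem_ofPred_eq, pt_zero, pt_one] at e1 e2
    rw [e1, e2] at hne
    exact lt_irrefl _ hne
  have onVert : ∀ Y : ℝ, Y ≠ X → (∀ v ∈ s, v ≠ r → v 0 = Y) → False := by
    intro Y hY hv
    have hsub2 : hull (s.erase r) ⊆ {p : Plane | p 0 = Y} := by
      refine convexHull_min (fun v hv' => ?_) (hline _)
      rw [Finset.mem_coe, Finset.mem_erase] at hv'
      exact hv v hv'.2 hv'.1
    exact hY (hsub2 hp).symm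
  have hl0 : ∀ y₀ y₁, lerp (x (m.strip s)) (x (m.strip s + 1)) y₀ y₁ (x (m.strip s)) = y₀ := fun y₀ y₁ => lerp_left _ _ _ _
  have hl1 : ∀ y₀ y₁, lerp (x (m.strip s)) (x (m.strip s + 1)) y₀ y₁ (x (m.strip s + 1)) = y₁ := fun y₀ y₁ => lerp_right hS.lt _ _
  have hmem := fun v => (hS.mem_iff (p := v)).1
  -- Which side is left depends on the removed vertex r; the apex is listed twice among the four
  -- points, so its case occurs twice.
  rcases hS.shape with ⟨h3, h4⟩ | ⟨h3, h4⟩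
  · rcases hmem r hr with e | e | e | e
    · refine onLine (m.up s 0) (m.up s 1) fun v hv hvr => ?_
      rcases hmem v hv with e' | e' | e' | e' <;>
        first
          | (refine absurd ?_ hvr; rw [e, e', h4]; done)
          | (refine absurd ?_ hvr; rw [e, e']; done)
          | simp [e', hl0, hl1, h4]
    · refine onLine (m.lo s 0) (m.lo s 1) fun v hv hvr => ?_
      rcases hmem v hv with e' | e' | e' | e' <;>
        first
          | (refine absurd ?_ hvr; rw [e, e', h4]; done)
          | (refine absurd ?_ hvr; rw [e, e']; done)
          | simp [e', hl0, hl1, h4]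
    · refine onVert _ hX.1.ne fun v hv hvr => ?_
      rcases hmem v hv with e' | e' | e' | e' <;>
        first
          | (refine absurd ?_ hvr; rw [e, e', h4]; done)
          | (refine absurd ?_ hvr; rw [e, e']; done)
          | simp [e']
    · refine onVert _ hX.1.ne fun v hv hvr => ?_
      rcases hmem v hv with e' | e' | e' | e' <;>
        first
          | (refine absurd ?_ hvr; rw [e, e', h4]; done)
          | (refine absurd ?_ hvr; rw [e, e']; done)
          | simp [e']
  · rcases hmem r hr with e | e | e | e
    · refine onVert _ hX.2.ne' fun v hv hvr => ?_
      rcases hmem v hv with e' | e' | e' | e' <;>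
        first
          | (refine absurd ?_ hvr; rw [e, e', h3]; done)
          | (refine absurd ?_ hvr; rw [e, e']; done)
          | simp [e']
    · refine onVert _ hX.2.ne' fun v hv hvr => ?_
      rcases hmem v hv with e' | e' | e' | e' <;>
        first
          | (refine absurd ?_ hvr; rw [e, e', h3]; done)
          | (refine absurd ?_ hvr; rw [e, e']; done)
          | simp [e']
    · refine onLine (m.up s 0) (m.up s 1) fun v hv hvr => ?_
      rcases hmem v hv with e' | e' | e' | e' <;>
        first
          | (refine absurd ?_ hvr; rw [e, e', h3]; done)
          | (refine absurd ?_ hvr; rw [e, e']; done)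
          | simp [e', hl0, hl1, h3]
    · refine onLine (m.lo s 0) (m.lo s 1) fun v hv hvr => ?_
      rcases hmem v hv with e' | e' | e' | e' <;>
        first
          | (refine absurd ?_ hvr; rw [e, e', h3]; done)
          | (refine absurd ?_ hvr; rw [e, e']; done)
          | simp [e', hl0, hl1, h3]

/-- The elements of a strip are ordered vertically. -/
lemma ordered (hs : s ∈ 𝒯.elements) (ht : t ∈ 𝒯.elements) (hk : m.strip s = m.strip t)
    (hst : s ≠ t) :
    (∀ X ∈ Set.Icc (x (m.strip s)) (x (m.strip s + 1)), m.upAt s X ≤ m.loAt t X) ∨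
      (∀ X ∈ Set.Icc (x (m.strip s)) (x (m.strip s + 1)), m.upAt t X ≤ m.loAt s X) := by
  set I := Set.Ioo (x (m.strip s)) (x (m.strip s + 1)) with hI
  have hlt := (m.tri s hs).lt
  have hcl : closure I = Set.Icc (x (m.strip s)) (x (m.strip s + 1)) := closure_Ioo hlt.ne
  have c1 : IsClosed {X | m.upAt s X ≤ m.loAt t X} :=
    isClosed_le (m.continuous_upAt s) (m.continuous_loAt t)
  have c2 : IsClosed {X | m.upAt t X ≤ m.loAt s X} :=
    isClosed_le (m.continuous_upAt t) (m.continuous_loAt s)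
  have hcov : I ⊆ {X | m.upAt s X ≤ m.loAt t X} ∪ {X | m.upAt t X ≤ m.loAt s X} :=
    fun X hX => m.ordered_at hs ht hk hst hX
  rw [← hcl]
  by_cases hA : I ⊆ {X | m.upAt s X ≤ m.loAt t X}
  · exact Or.inl (closure_minimal hA c1)
  by_cases hB : I ⊆ {X | m.upAt t X ≤ m.loAt s X}
  · exact Or.inr (closure_minimal hB c2)
  exfalso
  obtain ⟨X, hX, hXA⟩ := Set.not_subset.1 hA
  obtain ⟨Y, hY, hYB⟩ := Set.not_subset.1 hB
  -- The order cannot switch within the strip: the open interval is connected and covered by the two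
  -- closed conditions, so a switch would give a point Z where both hold, and there the sections
  -- would have no length.
  obtain ⟨Z, hZ, hZ1, hZ2⟩ := isPreconnected_closed_iff.1 (isPreconnected_Ioo) _ _ c1 c2 hcov
    ⟨Y, hY, (hcov hY).resolve_right hYB⟩ ⟨X, hX, (hcov hX).resolve_left hXA⟩
  have e1 : m.loAt s Z < m.upAt s Z := (m.tri s hs).lerp_lt hZ
  have e2 : m.loAt t Z < m.upAt t Z := (m.tri t ht).lerp_lt (hk ▸ hZ)
  simp only [Set.mem_ofPred_eq] at hZ1 hZ2
  linarith

lemma loAt_left (t : Finset Plane) : m.loAt t (x (m.strip t)) = m.lo t 0 := lerp_left _ _ _ _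

lemma upAt_left (t : Finset Plane) : m.upAt t (x (m.strip t)) = m.up t 0 := lerp_left _ _ _ _

lemma loAt_right (ht : t ∈ 𝒯.elements) : m.loAt t (x (m.strip t + 1)) = m.lo t 1 :=
  lerp_right (m.tri t ht).lt _ _

lemma upAt_right (ht : t ∈ 𝒯.elements) : m.upAt t (x (m.strip t + 1)) = m.up t 1 :=
  lerp_right (m.tri t ht).lt _ _

/-- On the two vertical lines the elements of a strip are ordered. -/
lemma ordered_ends (hs : s ∈ 𝒯.elements) (ht : t ∈ 𝒯.elements) (hk : m.strip s = m.strip t)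
    (hst : s ≠ t) : (∀ b, m.up s b ≤ m.lo t b) ∨ (∀ b, m.up t b ≤ m.lo s b) := by
  have hlt := (m.tri s hs).lt
  rcases m.ordered hs ht hk hst with h | h
  · left
    have h0 := h _ (Set.left_mem_Icc.2 hlt.le)
    have h1 := h _ (Set.right_mem_Icc.2 hlt.le)
    rw [m.upAt_left, hk, m.loAt_left] at h0
    rw [m.upAt_right hs, hk, m.loAt_right ht] at h1
    intro b; fin_cases b
    · exact h0
    · exact h1
  · right
    have h0 := h _ (Set.left_mem_Icc.2 hlt.le)
    have h1 := h _ (Set.right_mem_Icc.2 hlt.le)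
    rw [m.loAt_left, hk, m.upAt_left] at h0
    rw [m.loAt_right hs, hk, m.upAt_right ht] at h1
    intro b; fin_cases b
    · exact h0
    · exact h1

/-- Distinct elements of a strip lie one above the other; with a common lower side, the one
underneath would have height zero. -/
lemma eq_of_lo_eq (hs : s ∈ 𝒯.elements) (ht : t ∈ 𝒯.elements) (hk : m.strip s = m.strip t)
    (h : m.lo s = m.lo t) : s = t := by
  by_contra hst
  rcases m.ordered_ends hs ht hk hst with h1 | h1
  · have := m.height_pos hs
    have h2 := h1 0; have h3 := h1 1
    rw [← h] at h2 h3
    simp only [height] at this; linarith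
  · have := m.height_pos ht
    have h2 := h1 0; have h3 := h1 1
    rw [h] at h2 h3
    simp only [height] at this; linarith

lemma eq_of_up_eq (hs : s ∈ 𝒯.elements) (ht : t ∈ 𝒯.elements) (hk : m.strip s = m.strip t)
    (h : m.up s = m.up t) : s = t := by
  by_contra hst
  rcases m.ordered_ends hs ht hk hst with h1 | h1
  · have := m.height_pos ht
    have h2 := h1 0; have h3 := h1 1
    rw [h] at h2 h3
    simp only [height] at this; linarith
  · have := m.height_pos hs
    have h2 := h1 0; have h3 := h1 1
    rw [← h] at h2 h3
    simp only [height] at this; linarith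

/-- On a vertical line, sides of different elements of a strip do not overlap. -/
lemma side_disjoint (hs : s ∈ 𝒯.elements) (ht : t ∈ 𝒯.elements) (hk : m.strip s = m.strip t)
    (hst : s ≠ t) (b : Fin 2) : m.up s b ≤ m.lo t b ∨ m.up t b ≤ m.lo s b :=
  (m.ordered_ends hs ht hk hst).imp (fun h => h b) fun h => h b

/-! ### Neighbours across the sides of an element -/

include m in
lemma mem_unitSquare_mid {k : ℕ} (hk : k < n) {X y : ℝ} (h1 : x k < X) (h2 : X < x (k + 1))
    (h3 : 0 < y) (h4 : y < 1) : pt X y ∈ unitSquare := by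
  have := m.x_mono (Nat.zero_le k) hk.le
  have := m.x_mono (Nat.succ_le_of_lt hk) le_rfl
  rw [m.x_zero] at *
  rw [m.x_last] at *
  exact ⟨by simp; linarith, by simp; linarith, h3, h4⟩

lemma mid_mem_openSegment (X₀ X₁ y₀ y₁ : ℝ) :
    pt ((X₀ + X₁) / 2) ((y₀ + y₁) / 2) ∈ openSegment ℝ (pt X₀ y₀) (pt X₁ y₁) := by
  refine ⟨1 / 2, 1 / 2, by norm_num, by norm_num, by norm_num, ?_⟩
  apply plane_ext <;> simp <;> ring

lemma lerp_mid {X₀ X₁ : ℝ} (h : X₀ < X₁) (y₀ y₁ : ℝ) :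
    lerp X₀ X₁ y₀ y₁ ((X₀ + X₁) / 2) = (y₀ + y₁) / 2 := by
  have : X₁ - X₀ ≠ 0 := (sub_pos.2 h).ne'
  simp only [lerp]; field_simp; ring

/-- The element above the upper side of an element. -/
lemma exists_above (ht : t ∈ 𝒯.elements) (htop : ¬ (m.up t 0 = 1 ∧ m.up t 1 = 1)) :
    ∃ s ∈ 𝒯.elements, m.strip s = m.strip t ∧ m.lo s = m.up t := by
  have hT := m.tri t ht
  have hb0 := m.bounds ht 0
  have hb1 := m.bounds ht 1
  have hh := m.height_pos ht
  have hP : pt ((x (m.strip t) + x (m.strip t + 1)) / 2) ((m.up t 0 + m.up t 1) / 2) ∈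
      unitSquare := by
    refine m.mem_unitSquare_mid (m.strip_lt t ht) (by linarith [hT.lt]) (by linarith [hT.lt]) ?_ ?_
    · simp only [height] at hh; linarith
    · by_contra hc
      exact htop ⟨by linarith, by linarith⟩
  -- Leave the midpoint of the upper side upwards. The element entered contains the midpoint, hence
  -- the whole side; since it also contains points above the midpoint, the side must be its lower
  -- one.
  obtain ⟨s, hs, hps, ε, hε, hpε⟩ := 𝒯.exists_element_in_direction (isOpen_openRect _ _ _ _) hP (pt 0 1)
  obtain ⟨v1, v2, v3, v4⟩ := m.vertex_mem ht
  obtain ⟨ha, hb⟩ := mem_of_relInterior hs (mem_elements.1 ht).1 v2 v4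
    (mid_mem_openSegment _ _ _ _) (fun h => hT.lt.ne (pt_inj.1 h).1) hps
  have hk := m.strip_eq_of_mem hs (m.strip_lt t ht) ha hb
  rw [← hk] at ha hb hpε hps
  have hS := m.tri s hs
  rcases hS.mem_hull.1 hps with ⟨-, -, p3, p4⟩
  rcases hS.mem_hull.1 hpε with ⟨-, -, q3, q4⟩
  simp [lerp_mid hS.lt] at p3 p4 q3 q4
  refine ⟨s, hs, hk, ?_⟩
  have e0 := m.eq_lo_or_up_zero hs ha
  have e1 := m.eq_lo_or_up_one hs hb
  have : m.lo s 0 = m.up t 0 ∧ m.lo s 1 = m.up t 1 := by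
    rcases hS.shape with ⟨h5, h6⟩ | ⟨h5, h6⟩
    · have e1' : m.up t 1 = m.lo s 1 := by rcases e1 with e | e <;> linarith
      refine ⟨?_, e1'.symm⟩
      rcases e0 with e | e
      · exact e.symm
      · exfalso; linarith
    · have e0' : m.up t 0 = m.lo s 0 := by rcases e0 with e | e <;> linarith
      refine ⟨e0'.symm, ?_⟩
      rcases e1 with e | e
      · exact e.symm
      · exfalso; linarith
  ext b; fin_cases b
  · exact this.1
  · exact this.2

/-- The element below the lower side of an element. -/
lemma exists_below (ht : t ∈ 𝒯.elements) (hbot : ¬ (m.lo t 0 = 0 ∧ m.lo t 1 = 0)) :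
    ∃ s ∈ 𝒯.elements, m.strip s = m.strip t ∧ m.up s = m.lo t := by
  have hT := m.tri t ht
  have hb0 := m.bounds ht 0
  have hb1 := m.bounds ht 1
  have hh := m.height_pos ht
  have hP : pt ((x (m.strip t) + x (m.strip t + 1)) / 2) ((m.lo t 0 + m.lo t 1) / 2) ∈
      unitSquare := by
    refine m.mem_unitSquare_mid (m.strip_lt t ht) (by linarith [hT.lt]) (by linarith [hT.lt]) ?_ ?_
    · by_contra hc
      exact hbot ⟨by linarith, by linarith⟩
    · simp only [height] at hh; linarith
  obtain ⟨s, hs, hps, ε, hε, hpε⟩ :=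
    𝒯.exists_element_in_direction (isOpen_openRect _ _ _ _) hP (pt 0 (-1))
  obtain ⟨v1, v2, v3, v4⟩ := m.vertex_mem ht
  obtain ⟨ha, hb⟩ := mem_of_relInterior hs (mem_elements.1 ht).1 v1 v3
    (mid_mem_openSegment _ _ _ _) (fun h => hT.lt.ne (pt_inj.1 h).1) hps
  have hk := m.strip_eq_of_mem hs (m.strip_lt t ht) ha hb
  rw [← hk] at ha hb hpε hps
  have hS := m.tri s hs
  rcases hS.mem_hull.1 hps with ⟨-, -, p3, p4⟩
  rcases hS.mem_hull.1 hpε with ⟨-, -, q3, q4⟩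
  simp [lerp_mid hS.lt] at p3 p4 q3 q4
  refine ⟨s, hs, hk, ?_⟩
  have e0 := m.eq_lo_or_up_zero hs ha
  have e1 := m.eq_lo_or_up_one hs hb
  have : m.up s 0 = m.lo t 0 ∧ m.up s 1 = m.lo t 1 := by
    rcases hS.shape with ⟨h5, h6⟩ | ⟨h5, h6⟩
    · have e1' : m.lo t 1 = m.up s 1 := by rcases e1 with e | e <;> linarith
      refine ⟨?_, e1'.symm⟩
      rcases e0 with e | e
      · exfalso; linarith
      · exact e.symm
    · have e0' : m.lo t 0 = m.up s 0 := by rcases e0 with e | e <;> linarith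
      refine ⟨e0'.symm, ?_⟩
      rcases e1 with e | e
      · exfalso; linarith
      · exact e.symm
  ext b; fin_cases b
  · exact this.1
  · exact this.2

lemma vert_mid_mem_unitSquare {k : ℕ} (hk0 : 0 < k) (hk : k < n) {y₀ y₁ : ℝ} (h : y₀ < y₁)
    (h0 : 0 ≤ y₀) (h1 : y₁ ≤ 1) (m : StripMesh 𝒯 n x) : pt (x k) ((y₀ + y₁) / 2) ∈ unitSquare := by
  have e1 := m.x_strictMono hk0 hk.le
  have e2 := m.x_strictMono hk le_rfl
  rw [m.x_zero] at e1
  rw [m.x_last] at e2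
  exact ⟨e1, e2, by simp; linarith, by simp; linarith⟩

lemma mid_mem_openSegment_vert (X y₀ y₁ : ℝ) :
    pt X ((y₀ + y₁) / 2) ∈ openSegment ℝ (pt X y₀) (pt X y₁) := by
  simpa using mid_mem_openSegment X X y₀ y₁

/-- The element to the left of a vertical side. -/
lemma exists_left (ht : t ∈ 𝒯.elements) (h : m.lo t 0 < m.up t 0) (h0 : 0 < m.strip t) :
    ∃ s ∈ 𝒯.elements, m.strip s + 1 = m.strip t ∧ m.lo s 1 = m.lo t 0 ∧ m.up s 1 = m.up t 0 := by
  have hT := m.tri t ht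
  have hb := m.bounds ht 0
  -- Moving left from the midpoint of the vertical side forces the element entered into the
  -- preceding strip, and conformity makes the whole side one of its edges.
  obtain ⟨s, hs, hps, ε, hε, hpε⟩ := 𝒯.exists_element_in_direction (isOpen_openRect _ _ _ _)
    (vert_mid_mem_unitSquare h0 (m.strip_lt t ht) h hb.1 hb.2 m) (pt (-1) 0)
  obtain ⟨v1, v2, v3, v4⟩ := m.vertex_mem ht
  obtain ⟨ha, hb⟩ := mem_of_relInterior hs (mem_elements.1 ht).1 v1 v2
    (mid_mem_openSegment_vert _ _ _) (fun h' => h.ne (pt_inj.1 h').2) hps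
  have hS := m.tri s hs
  have q1 := (hS.mem_hull.1 hpε).1
  simp at q1
  have hkk : m.strip s + 1 = m.strip t := by
    have hl1 := m.strip_lt s hs
    have hl2 := m.strip_lt t ht
    have key : x (m.strip t) = x (m.strip s) ∨ x (m.strip t) = x (m.strip s + 1) := by
      rcases hS.mem_iff.1 ha with e | e | e | e <;> have e := (pt_inj.1 e).1 <;> simp [e]
    rcases key with e | e
    · linarith
    · exact (m.x_inj hl2.le hl1 e).symm
  refine ⟨s, hs, hkk, ?_⟩
  rw [← hkk] at ha hb
  have e0 := m.eq_lo_or_up_one hs ha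
  have e1 := m.eq_lo_or_up_one hs hb
  have := hS.le 1
  constructor
  · rcases e0 with e | e
    · exact e.symm
    · rcases e1 with e' | e' <;> linarith
  · rcases e1 with e | e
    · rcases e0 with e' | e' <;> linarith
    · exact e.symm

/-- The element to the right of a vertical side. -/
lemma exists_right (ht : t ∈ 𝒯.elements) (h : m.lo t 1 < m.up t 1) (hn : m.strip t + 1 < n) :
    ∃ s ∈ 𝒯.elements, m.strip s = m.strip t + 1 ∧ m.lo s 0 = m.lo t 1 ∧ m.up s 0 = m.up t 1 := by
  have hT := m.tri t ht
  have hb := m.bounds ht 1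
  obtain ⟨s, hs, hps, ε, hε, hpε⟩ := 𝒯.exists_element_in_direction (isOpen_openRect _ _ _ _)
    (vert_mid_mem_unitSquare (Nat.succ_pos _) hn h hb.1 hb.2 m) (pt 1 0)
  obtain ⟨v1, v2, v3, v4⟩ := m.vertex_mem ht
  obtain ⟨ha, hb⟩ := mem_of_relInterior hs (mem_elements.1 ht).1 v3 v4
    (mid_mem_openSegment_vert _ _ _) (fun h' => h.ne (pt_inj.1 h').2) hps
  have hS := m.tri s hs
  have q1 := (hS.mem_hull.1 hpε).2.1
  simp at q1
  have hkk : m.strip s = m.strip t + 1 := by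
    have hl1 := m.strip_lt s hs
    have key : x (m.strip t + 1) = x (m.strip s) ∨ x (m.strip t + 1) = x (m.strip s + 1) := by
      rcases hS.mem_iff.1 ha with e | e | e | e <;> have e := (pt_inj.1 e).1 <;> simp [e]
    rcases key with e | e
    · exact (m.x_inj hn.le hl1.le e).symm
    · linarith
  refine ⟨s, hs, hkk, ?_⟩
  rw [← hkk] at ha hb
  have e0 := m.eq_lo_or_up_zero hs ha
  have e1 := m.eq_lo_or_up_zero hs hb
  have := hS.le 0
  constructor
  · rcases e0 with e | e
    · exact e.symm
    · rcases e1 with e' | e' <;> linarith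
  · rcases e1 with e | e
    · rcases e0 with e' | e' <;> linarith
    · exact e.symm

end StripMesh

open Triangulation

/-! ### Consequences of the assumptions on the mesh -/

/-- The angle bound may be negative, whereas the cosine is monotone only on [0, π]; hence the
truncation `max α 0`. -/
lemma neg_one_lt_cos_max {α : ℝ} (hα : α < Real.pi) : -1 < Real.cos (max α 0) := by
  have := Real.cos_lt_cos_of_nonneg_of_le_pi (le_max_right α 0) le_rfl (max_lt hα Real.pi_pos)
  rwa [Real.cos_pi] at this

/-- A vertical vector u and a vector w with opposite vertical direction enclose an obtuse angle with
cosine -|w 1|/‖w‖. If the angle stays away from π, this yields |w 1| ≤ -c‖w‖, so w cannot be nearly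
vertical. -/
lemma sq_le_of_angle_le {α : ℝ} (hα : α < Real.pi) {u w : Plane} (hu : u 0 = 0)
    (huw : u 1 * w 1 < 0) (h : InnerProductGeometry.angle u w ≤ α) :
    w 1 ^ 2 * (1 - Real.cos (max α 0) ^ 2) ≤ w 0 ^ 2 := by
  set c := Real.cos (max α 0) with hc
  have h1 : c ≤ Real.cos (InnerProductGeometry.angle u w) :=
    Real.cos_le_cos_of_nonneg_of_le_pi (InnerProductGeometry.angle_nonneg _ _)
      (max_lt hα Real.pi_pos).le (h.trans (le_max_left _ _))
  have hun : ‖u‖ = |u 1| := by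
    rw [← Real.sqrt_sq (norm_nonneg u), plane_norm_sq, hu]; simp [Real.sqrt_sq_eq_abs]
  have hu1 : 0 < |u 1| := abs_pos.2 fun h0 => by simp [h0] at huw
  have hw1 : 0 < |w 1| := abs_pos.2 fun h0 => by simp [h0] at huw
  have hw : 0 < ‖w‖ := hw1.trans_le (plane_abs_apply_le w 1)
  rw [InnerProductGeometry.cos_angle, plane_inner, hu, hun, le_div_iff₀ (by positivity)] at h1
  have h2 : u 1 * w 1 = -(|u 1| * |w 1|) := by rw [← abs_mul, abs_of_neg huw]; ring
  rw [h2] at h1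
  have h3 : |w 1| ≤ -c * ‖w‖ := by
    have : |u 1| * |w 1| ≤ |u 1| * (-c * ‖w‖) := by nlinarith
    exact le_of_mul_le_mul_left this hu1
  have h4 := pow_le_pow_left₀ hw1.le h3 2
  rw [mul_pow, plane_norm_sq, sq_abs] at h4
  have hc2 : c ^ 2 ≤ 1 := Real.cos_sq_le_one _
  nlinarith [mul_nonneg (sub_nonneg.2 hc2) (sq_nonneg (w 0))]

/-- The constant in the bound of the height of an element by its width. -/
def angleConst (α : ℝ) : ℝ := 2 + 1 / (1 - Real.cos (max α 0) ^ 2)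

/-- If the third vertex is lower than y₁ or higher than y₂, the angle at the nearer end of the
vertical side is obtuse, and the angle bound controls the vertical overhang by the width. Minimality
of the vertical side then bounds its length. -/
lemma height_sq_le_of_angle_le {α X X' y₁ y₂ y₃ : ℝ} (hα : α < Real.pi)
    (h12 : y₁ < y₂)
    (ha : EuclideanGeometry.angle (pt X y₂) (pt X y₁) (pt X' y₃) ≤ α)
    (hb : EuclideanGeometry.angle (pt X y₁) (pt X y₂) (pt X' y₃) ≤ α)
    (h1 : (y₂ - y₁) ^ 2 ≤ (X' - X) ^ 2 + (y₃ - y₁) ^ 2)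
    (h2 : (y₂ - y₁) ^ 2 ≤ (X' - X) ^ 2 + (y₃ - y₂) ^ 2) (hX : X ≠ X') :
    (y₂ - y₁) ^ 2 ≤ angleConst α * (X' - X) ^ 2 := by
  have hH : 0 < (X' - X) ^ 2 := by
    have := sub_ne_zero.2 hX.symm
    positivity
  have hc0 : 0 ≤ 1 - Real.cos (max α 0) ^ 2 := sub_nonneg.2 (Real.cos_sq_le_one _)
  have key : ∀ d : ℝ, d ^ 2 * (1 - Real.cos (max α 0) ^ 2) ≤ (X' - X) ^ 2 → 0 ≤ max α 0 →
      d ≠ 0 → (y₂ - y₁) ^ 2 ≤ (X' - X) ^ 2 + d ^ 2 → Real.cos (max α 0) < 1 →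
      (y₂ - y₁) ^ 2 ≤ angleConst α * (X' - X) ^ 2 := by
    intro d h3 _ _ h4 h5
    have h6 := neg_one_lt_cos_max hα
    have h7 : 0 < 1 - Real.cos (max α 0) ^ 2 := by nlinarith
    have h8 : d ^ 2 ≤ 1 / (1 - Real.cos (max α 0) ^ 2) * (X' - X) ^ 2 := by
      rw [one_div, inv_mul_eq_div, le_div_iff₀ h7]; exact h3
    rw [angleConst]; nlinarith
  have hang : ∀ d : ℝ, d ≠ 0 → ∀ u w : Plane, u 0 = 0 → u 1 * w 1 < 0 → w 1 ^ 2 = d ^ 2 →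
      w 0 ^ 2 = (X' - X) ^ 2 → (y₂ - y₁) ^ 2 ≤ (X' - X) ^ 2 + d ^ 2 →
      InnerProductGeometry.angle u w ≤ α → (y₂ - y₁) ^ 2 ≤ angleConst α * (X' - X) ^ 2 := by
    intro d hd u w hu huw hw1 hw0 hle h
    have h3 := sq_le_of_angle_le hα hu huw h
    rw [hw1, hw0] at h3
    rcases (Real.cos_le_one (max α 0)).lt_or_eq with h5 | h5
    · exact key d h3 (le_max_right _ _) hd hle h5
    -- With cosine 1 the bound is zero, the angle vanishes and w is a positive multiple of u,
    -- against the opposite vertical directions.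
    · exfalso
      have hm : max α 0 = 0 := by
        by_contra hne
        have := Real.cos_lt_cos_of_nonneg_of_le_pi le_rfl (max_lt hα Real.pi_pos).le
          (lt_of_le_of_ne (le_max_right α 0) (Ne.symm hne))
        rw [Real.cos_zero, h5] at this
        exact lt_irrefl _ this
      have h0 : InnerProductGeometry.angle u w = 0 :=
        le_antisymm (h.trans (hm ▸ le_max_left α 0)) (InnerProductGeometry.angle_nonneg _ _)
      obtain ⟨-, r, hr, hrw⟩ := InnerProductGeometry.angle_eq_zero_iff.1 h0
      rw [hrw, PiLp.smul_apply, smul_eq_mul] at huw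
      nlinarith [mul_nonneg hr.le (mul_self_nonneg (u 1))]
  rcases lt_or_ge y₃ y₁ with h3 | h3
  · refine hang (y₃ - y₁) (sub_neg.2 h3).ne _ _ ?_ ?_ ?_ ?_ h1 ha
    · simp
    · simp; nlinarith
    · simp
    · simp
  rcases lt_or_ge y₂ y₃ with h4 | h4
  · refine hang (y₃ - y₂) (sub_pos.2 h4).ne' _ _ ?_ ?_ ?_ ?_ h2 hb
    · simp
    · simp; nlinarith
    · simp
    · simp
  -- Here y₃ lies between y₁ and y₂, so one of the gaps is at most half the length of the vertical
  -- side; minimality of that side leaves at most 4/3 of the squared width.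
  have h5 : (y₂ - y₁) ^ 2 ≤ 2 * (X' - X) ^ 2 := by nlinarith
  have : 0 ≤ 1 / (1 - Real.cos (max α 0) ^ 2) := by positivity
  rw [angleConst]; nlinarith

lemma angleConst_pos (α : ℝ) : 0 < angleConst α := by
  have hc0 : 0 ≤ 1 - Real.cos (max α 0) ^ 2 := sub_nonneg.2 (Real.cos_sq_le_one _)
  rw [angleConst]; positivity

lemma Triangulation.mem_nodes {Ω : Set Plane} {𝒯 : Triangulation Ω} {t : Finset Plane} {z : Plane}
    (ht : t ∈ 𝒯.elements) (hz : z ∈ t) : z ∈ 𝒯.nodes :=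
  𝒯.complex.down_closed (mem_elements.1 ht).1 (by simpa using hz) (Finset.singleton_nonempty z)

lemma Triangulation.hull_subset_nodePatch {Ω : Set Plane} {𝒯 : Triangulation Ω} {t : Finset Plane}
    {z : Plane} (ht : t ∈ 𝒯.elements) (hz : z ∈ t) : hull t ⊆ 𝒯.nodePatch z := by
  intro p hp
  simp only [nodePatch, Set.mem_iUnion]
  exact ⟨t, by simp [ht, hz], hp⟩

lemma Triangulation.volume_nodePatch_ne_top {Ω : Set Plane} (𝒯 : Triangulation Ω) (z : Plane) :
    volume (𝒯.nodePatch z) ≠ ⊤ := by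
  have : IsCompact (𝒯.nodePatch z) :=
    ({t ∈ 𝒯.elements | z ∈ t}).isCompact_biUnion fun t _ => isCompact_hull t
  exact this.measure_lt_top.ne

namespace StripMesh

variable {𝒯 : Triangulation unitSquare} {n : ℕ} {x : ℕ → ℝ} (m : StripMesh 𝒯 n x)
  {s t : Finset Plane} {z : Plane} {c₀ M : ℝ}

lemma height_sq_le {α : ℝ} (hα : α < Real.pi) (hang : 𝒯.MaxAngle α) (ht : t ∈ 𝒯.elements) :
    m.height t ^ 2 ≤ angleConst α * m.width t ^ 2 := by
  have hT := m.tri t ht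
  obtain ⟨v1, v2, v3, v4⟩ := m.vertex_mem ht
  obtain ⟨s1, s2⟩ := m.short t ht
  have hne : ∀ {y y'}, pt (x (m.strip t)) y ≠ pt (x (m.strip t + 1)) y' :=
    fun h => hT.lt.ne (pt_inj.1 h).1
  rw [height, width]
  rcases hT.shape with ⟨h1, h2⟩ | ⟨h1, h2⟩
  · rw [← h2] at s1 s2 ⊢
    simp only [sub_self, add_zero] at s1 s2 ⊢
    have hv : pt (x (m.strip t)) (m.lo t 0) ≠ pt (x (m.strip t)) (m.up t 0) :=
      fun h => h1.ne (pt_inj.1 h).2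
    exact height_sq_le_of_angle_le (y₃ := m.lo t 1) hα h1 (hang t ht _ v2 _ v1 _ v3 hv.symm hne hne)
      (hang t ht _ v1 _ v2 _ v3 hv hne hne) s1 s2 hT.lt.ne
  · rw [h1] at s1 ⊢
    simp only [sub_self, zero_add, h1] at s1 s2 ⊢
    have hv : pt (x (m.strip t + 1)) (m.lo t 1) ≠ pt (x (m.strip t + 1)) (m.up t 1) :=
      fun h => h2.ne (pt_inj.1 h).2
    have := height_sq_le_of_angle_le (X := x (m.strip t + 1)) (X' := x (m.strip t))
      (y₃ := m.up t 0) hα h2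
      (hang t ht _ v4 _ v3 _ v2 hv.symm hne.symm hne.symm)
      (hang t ht _ v3 _ v4 _ v2 hv hne.symm hne.symm) (by nlinarith) (by nlinarith) hT.lt.ne'
    nlinarith

include m in
lemma area_pos (ht : t ∈ 𝒯.elements) : 0 < area (hull t) := by
  rw [m.area_hull ht]
  have := m.height_pos ht; have := m.width_pos ht
  positivity

/-- Both areas are compared with that of the patch of the common node z. -/
lemma area_le (hA : 𝒯.AllNodesAnisotropic c₀ M) (hs : s ∈ 𝒯.elements) (ht : t ∈ 𝒯.elements)
    (hzs : z ∈ s) (hzt : z ∈ t) : area (hull s) ≤ M * area (hull t) :=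
  (measureReal_mono (hull_subset_nodePatch hs hzs) (𝒯.volume_nodePatch_ne_top z)).trans
    ((hA z (mem_nodes ht hzt)).2 t ht hzt)

/-- The vertical extent of elements is controlled by the height of their neighbours. -/
lemma extent_le (hA : 𝒯.AllNodesAnisotropic c₀ M) (hG : 𝒯.GlobalOrientation M) (hM : 0 ≤ M)
    (hs : s ∈ 𝒯.elements) (ht : t ∈ 𝒯.elements) (hzs : z ∈ s) (hzt : z ∈ t) {p q : Plane}
    (hp : p ∈ hull s) (hq : q ∈ hull s) : |p 1 - q 1| ≤ M ^ 2 / 2 * m.height t := by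
  obtain ⟨a, b, c, d, hsub, harea⟩ := hG z (mem_nodes ht hzt)
  have h1 := (hA z (mem_nodes ht hzt)).2 t ht hzt
  have hsub' : ∀ {r : Finset Plane}, r ∈ 𝒯.elements → z ∈ r → hull r ⊆ closedRect a b c d :=
    fun hr hzr => (hull_subset_nodePatch hr hzr).trans hsub
  obtain ⟨v1, v2, v3, v4⟩ := m.vertex_mem ht
  have e1 := hsub' ht hzt (subset_convexHull ℝ _ v1)
  have e2 := hsub' ht hzt (subset_convexHull ℝ _ v3)
  have hp' := hsub' hs hzs hp
  have hq' := hsub' hs hzs hq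
  have hW := m.width_pos ht
  have hwid : m.width t ≤ b - a := by
    have := e1.1; have := e2.2.1
    simp only [pt_zero] at *
    simp only [width]; linarith
  have hcd : c ≤ d := hp'.2.2.1.trans hp'.2.2.2
  rw [area_closedRect (by linarith) hcd] at harea
  -- The rectangle around the patch is at least as wide as the element t, while its area is at most
  -- M|ω_z| ≤ M²|t| = M² · height · width / 2. Dividing by the width bounds its vertical extent.
  have h3 : (d - c) * m.width t ≤ M ^ 2 / 2 * m.height t * m.width t := by
    have h4 : (d - c) * m.width t ≤ (b - a) * (d - c) := by
      rw [mul_comm]; exact mul_le_mul_of_nonneg_right hwid (sub_nonneg.2 hcd)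
    have h5 := mul_le_mul_of_nonneg_left h1 hM
    rw [m.area_hull ht] at h5
    nlinarith
  have h4 := le_of_mul_le_mul_right h3 hW
  refine le_trans ?_ h4
  rw [abs_le]
  constructor <;> linarith [hp'.2.2.1, hp'.2.2.2, hq'.2.2.1, hq'.2.2.2]

lemma height_le (hA : 𝒯.AllNodesAnisotropic c₀ M) (hG : 𝒯.GlobalOrientation M) (hM : 0 ≤ M)
    (hs : s ∈ 𝒯.elements) (ht : t ∈ 𝒯.elements) (hzs : z ∈ s) (hzt : z ∈ t) :
    m.height s ≤ M ^ 2 / 2 * m.height t := by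
  obtain ⟨v1, v2, v3, v4⟩ := m.vertex_mem hs
  rcases (m.tri s hs).shape with ⟨h1, h2⟩ | ⟨h1, h2⟩
  · have := m.extent_le hA hG hM hs ht hzs hzt (subset_convexHull ℝ _ v2) (subset_convexHull ℝ _ v1)
    simp only [pt_one] at this
    have h3 := le_abs_self (m.up s 0 - m.lo s 0)
    simp only [height] at *; linarith
  · have := m.extent_le hA hG hM hs ht hzs hzt (subset_convexHull ℝ _ v4) (subset_convexHull ℝ _ v3)
    simp only [pt_one] at this
    have h3 := le_abs_self (m.up s 1 - m.lo s 1)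
    simp only [height] at *; linarith

include m in
-- The elements at z do not overlap, fill the patch, and each has at least the fraction 1/M of its
-- area.
lemma card_le (hA : 𝒯.AllNodesAnisotropic c₀ M) (ht : t ∈ 𝒯.elements) (hzt : z ∈ t) :
    (({t ∈ 𝒯.elements | z ∈ t}).card : ℝ) ≤ M := by
  set N := {t ∈ 𝒯.elements | z ∈ t} with hN
  have h1 := (hA z (mem_nodes ht hzt)).2
  have hpos : 0 < area (𝒯.nodePatch z) := (m.area_pos ht).trans_le
    (measureReal_mono (hull_subset_nodePatch ht hzt) (𝒯.volume_nodePatch_ne_top z))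
  have h2 : area (𝒯.nodePatch z) = ∑ t ∈ N, area (hull t) := by
    refine measureReal_biUnion_finset₀ ?_ (fun t _ => (measurableSet_hull t).nullMeasurableSet)
      (fun t _ => (isCompact_hull t).measure_lt_top.ne)
    intro s hs t ht hst
    simp only [Finset.coe_filter, Set.mem_ofPred_eq] at hs ht
    exact aedisjoint_hull hs.1 ht.1 hst
  have h3 : N.card • area (𝒯.nodePatch z) ≤ ∑ t ∈ N, M * area (hull t) := by
    refine Finset.card_nsmul_le_sum _ _ _ fun t ht => ?_
    simp only [hN, Finset.mem_filter] at ht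
    exact h1 t ht.1 ht.2
  rw [← Finset.mul_sum, ← h2, nsmul_eq_mul] at h3
  exact le_of_mul_le_mul_right h3 hpos

end StripMesh

/-! ### Piecewise affine functions -/

lemma centroid_eq_smul_sum {s : Finset Plane} (hs : s.Nonempty) :
    s.centroid ℝ id = ((s.card : ℝ)⁻¹) • ∑ p ∈ s, p := by
  rw [Finset.centroid_def, Finset.affineCombination_eq_linear_combination _ _ _
    (Finset.sum_centroidWeights_eq_one_of_nonempty ℝ s hs), Finset.smul_sum]
  simp [Finset.centroidWeights_apply]

lemma StripTriangle.mem_interior {t : Finset Plane} {X₀ X₁ : ℝ} {lo up : Fin 2 → ℝ}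
    (h : StripTriangle t X₀ X₁ lo up) {p : Plane} (h1 : X₀ < p 0) (h2 : p 0 < X₁)
    (h3 : lerp X₀ X₁ (lo 0) (lo 1) (p 0) < p 1) (h4 : p 1 < lerp X₀ X₁ (up 0) (up 1) (p 0)) :
    p ∈ interior (hull t) := by
  have hc := continuous_coord 0
  have hc1 := continuous_coord 1
  have hO : IsOpen {p : Plane | X₀ < p 0 ∧ p 0 < X₁ ∧ lerp X₀ X₁ (lo 0) (lo 1) (p 0) < p 1 ∧
      p 1 < lerp X₀ X₁ (up 0) (up 1) (p 0)} :=
    (isOpen_lt continuous_const hc).inter ((isOpen_lt hc continuous_const).inter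
      ((isOpen_lt ((continuous_lerp _ _ _ _).comp hc) hc1).inter
        (isOpen_lt hc1 ((continuous_lerp _ _ _ _).comp hc))))
  refine interior_maximal (fun q hq => ?_) hO ⟨h1, h2, h3, h4⟩
  exact h.mem_hull.2 ⟨hq.1.le, hq.2.1.le, hq.2.2.1.le, hq.2.2.2.le⟩

/-- Being an interior point, the barycentre is a place where the gradient of a piecewise affine
function is that of the affine piece. -/
lemma StripTriangle.centroid_mem_interior {t : Finset Plane} {X₀ X₁ : ℝ} {lo up : Fin 2 → ℝ}
    (h : StripTriangle t X₀ X₁ lo up) : t.centroid ℝ id ∈ interior (hull t) := by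
  classical
  have hpos := h.pos
  have hne : X₁ - X₀ ≠ 0 := hpos.ne'
  have hlt := h.lt
  rcases h.shape with ⟨h1, h2⟩ | ⟨h1, h2⟩
  · have ht : t = {pt X₀ (lo 0), pt X₀ (up 0), pt X₁ (lo 1)} := by
      ext p; rw [h.mem_iff, ← h2]; simp
    have hc : t.centroid ℝ id = pt ((2 * X₀ + X₁) / 3) ((lo 0 + up 0 + lo 1) / 3) := by
      have n1 : pt X₀ (lo 0) ∉ ({pt X₀ (up 0), pt X₁ (lo 1)} : Finset Plane) := by
        simp [pt_inj, h1.ne, h.lt.ne]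
      have n2 : pt X₀ (up 0) ∉ ({pt X₁ (lo 1)} : Finset Plane) := by simp [pt_inj, h.lt.ne]
      rw [ht, centroid_eq_smul_sum (by simp), Finset.card_insert_of_notMem n1,
        Finset.card_insert_of_notMem n2, Finset.card_singleton, Finset.sum_insert n1,
        Finset.sum_insert n2, Finset.sum_singleton]
      apply plane_ext <;> simp <;> ring
    rw [hc]
    have hl : ∀ y₀ y₁, lerp X₀ X₁ y₀ y₁ ((2 * X₀ + X₁) / 3) = (2 * y₀ + y₁) / 3 := by
      intro y₀ y₁; simp only [lerp]; field_simp; ring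
    refine h.mem_interior ?_ ?_ ?_ ?_ <;> simp only [pt_zero, pt_one, hl] <;> linarith
  · have ht : t = {pt X₀ (lo 0), pt X₁ (lo 1), pt X₁ (up 1)} := by
      ext p; rw [h.mem_iff, ← h1]; simp
    have hc : t.centroid ℝ id = pt ((X₀ + 2 * X₁) / 3) ((lo 0 + lo 1 + up 1) / 3) := by
      have n1 : pt X₀ (lo 0) ∉ ({pt X₁ (lo 1), pt X₁ (up 1)} : Finset Plane) := by
        simp [pt_inj, h.lt.ne]
      have n2 : pt X₁ (lo 1) ∉ ({pt X₁ (up 1)} : Finset Plane) := by simp [pt_inj, h2.ne]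
      rw [ht, centroid_eq_smul_sum (by simp), Finset.card_insert_of_notMem n1,
        Finset.card_insert_of_notMem n2, Finset.card_singleton, Finset.sum_insert n1,
        Finset.sum_insert n2, Finset.sum_singleton]
      apply plane_ext <;> simp <;> ring
    rw [hc]
    have hl : ∀ y₀ y₁, lerp X₀ X₁ y₀ y₁ ((X₀ + 2 * X₁) / 3) = (y₀ + 2 * y₁) / 3 := by
      intro y₀ y₁; simp only [lerp]; field_simp; ring
    refine h.mem_interior ?_ ?_ ?_ ?_ <;> simp only [pt_zero, pt_one, hl] <;> linarith

namespace StripMesh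

variable {𝒯 : Triangulation unitSquare} {n : ℕ} {x : ℕ → ℝ} (m : StripMesh 𝒯 n x)
  {s t : Finset Plane} {v : Plane → ℝ}

include m in
lemma elementGradient_spec (hv : v ∈ 𝒯.FESpace) (ht : t ∈ 𝒯.elements) :
    (∀ p ∈ interior (hull t), gradient v p = elementGradient v t) ∧
      ∀ p ∈ hull t, ∀ q ∈ hull t, v q - v p = ⟪elementGradient v t, q - p⟫ := by
  obtain ⟨g, hg⟩ := hv.2.2 t ht
  set L : Plane →L[ℝ] ℝ := LinearMap.toContinuousLinearMap g.linear with hL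
  set G : Plane := (InnerProductSpace.toDual ℝ Plane).symm L with hG
  have hsub : ∀ p q, g q - g p = ⟪G, q - p⟫ := by
    intro p q
    rw [hG, InnerProductSpace.toDual_symm_apply, hL, LinearMap.coe_toContinuousLinearMap']
    have := g.linearMap_vsub q p
    simpa using this.symm
  have hgrad : ∀ p ∈ interior (hull t), gradient v p = G := by
    intro p hp
    apply HasGradientAt.gradient
    rw [hasGradientAt_iff_hasFDerivAt]
    have h1 : HasFDerivAt (fun q => g p + L (q - p)) L p := by
      simpa using (L.hasFDerivAt.comp p ((hasFDerivAt_id p).sub_const p)).const_add (g p)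
    have h2 : (InnerProductSpace.toDual ℝ Plane) G = L := by simp [hG]
    rw [h2]
    refine h1.congr_of_eventuallyEq ?_
    filter_upwards [mem_interior_iff_mem_nhds.1 hp] with q hq
    rw [hg hq]
    have := hsub p q
    rw [hG, InnerProductSpace.toDual_symm_apply] at this
    linarith
  have hc : elementGradient v t = G := hgrad _ (m.tri t ht).centroid_mem_interior
  refine ⟨fun p hp => by rw [hc, hgrad p hp], fun p hp q hq => ?_⟩
  rw [hc, hg hp, hg hq, hsub]

/-- Continuity across the common side of two elements of a strip. -/
lemma gradient_jump (hv : v ∈ 𝒯.FESpace) (hs : s ∈ 𝒯.elements) (ht : t ∈ 𝒯.elements)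
    (hk : m.strip s = m.strip t) (h : m.lo s = m.up t) :
    (elementGradient v s 0 - elementGradient v t 0) * m.width t +
      (elementGradient v s 1 - elementGradient v t 1) * (m.up t 1 - m.up t 0) = 0 := by
  obtain ⟨v1, v2, v3, v4⟩ := m.vertex_mem ht
  obtain ⟨w1, w2, w3, w4⟩ := m.vertex_mem hs
  rw [h, hk] at w1 w3
  have e1 := (m.elementGradient_spec hv ht).2 _ (subset_convexHull ℝ _ v2) _
    (subset_convexHull ℝ _ v4)
  have e2 := (m.elementGradient_spec hv hs).2 _ (subset_convexHull ℝ _ w1) _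
    (subset_convexHull ℝ _ w3)
  rw [plane_inner] at e1 e2
  simp only [PiLp.sub_apply, pt_zero, pt_one] at e1 e2
  simp only [width]; linarith

/-- The function vanishes at both ends of a horizontal boundary edge, hence so does its derivative
along it. This removes the boundary terms in the summation by parts up a strip. -/
lemma gradient_zero_of_boundary (hv : v ∈ 𝒯.FESpace) (ht : t ∈ 𝒯.elements) {y : ℝ}
    (hy : y = 0 ∨ y = 1) (h0 : pt (x (m.strip t)) y ∈ t) (h1 : pt (x (m.strip t + 1)) y ∈ t) :
    elementGradient v t 0 = 0 := by
  have hfr : ∀ {X}, pt X y ∈ t → v (pt X y) = 0 := by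
    intro X hX
    apply hv.2.1
    rw [frontier_unitSquare]
    refine ⟨?_, ?_⟩
    · rw [← closure_unitSquare]
      exact subset_closure_of_mem_elements ht (subset_convexHull ℝ _ hX)
    · rintro ⟨-, -, h3, h4⟩
      simp only [pt_one] at h3 h4
      rcases hy with rfl | rfl <;> linarith
  have e1 := (m.elementGradient_spec hv ht).2 _ (subset_convexHull ℝ _ h0) _
    (subset_convexHull ℝ _ h1)
  rw [hfr h0, hfr h1, plane_inner] at e1
  simp only [PiLp.sub_apply, pt_zero, pt_one, sub_self, mul_zero, add_zero] at e1
  have := m.width_pos ht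
  rcases mul_eq_zero.1 e1.symm with h | h
  · exact h
  · exact absurd h this.ne'

lemma gradient_zero_of_top (hv : v ∈ 𝒯.FESpace) (ht : t ∈ 𝒯.elements)
    (h : m.up t 0 = 1 ∧ m.up t 1 = 1) : elementGradient v t 0 = 0 := by
  obtain ⟨v1, v2, v3, v4⟩ := m.vertex_mem ht
  exact m.gradient_zero_of_boundary hv ht (Or.inr rfl) (h.1 ▸ v2) (h.2 ▸ v4)

lemma gradient_zero_of_bot (hv : v ∈ 𝒯.FESpace) (ht : t ∈ 𝒯.elements)
    (h : m.lo t 0 = 0 ∧ m.lo t 1 = 0) : elementGradient v t 0 = 0 := by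
  obtain ⟨v1, v2, v3, v4⟩ := m.vertex_mem ht
  exact m.gradient_zero_of_boundary hv ht (Or.inl rfl) (h.1 ▸ v1) (h.2 ▸ v3)

end StripMesh

/-! ### Normal jumps -/

lemma starProjection_orthogonal_vectorSpan_pair {S : Set Plane} {p q N : Plane} (hS : S = {p, q})
    (hpq : p ≠ q) (hN : ‖N‖ = 1) (hNpq : ⟪N, q - p⟫ = 0) (u : Plane) :
    (vectorSpan ℝ S)ᗮ.starProjection u = ⟪N, u⟫ • N := by
  subst hS
  have hN2 : N 0 ^ 2 + N 1 ^ 2 = 1 := by rw [← plane_norm_sq, hN]; norm_num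
  rw [plane_inner] at hNpq
  simp only [PiLp.sub_apply] at hNpq
  apply Submodule.eq_starProjection_of_mem_of_inner_eq_zero
  · rw [vectorSpan_pair, Submodule.mem_orthogonal_singleton_iff_inner_right, vsub_eq_sub,
      inner_smul_right, plane_inner (p - q)]
    simp only [PiLp.sub_apply]
    rw [show (p 0 - q 0) * N 0 + (p 1 - q 1) * N 1 = 0 by linarith, mul_zero]
  · intro w hw
    rw [vectorSpan_pair, Submodule.mem_orthogonal_singleton_iff_inner_right, vsub_eq_sub,
      plane_inner] at hw
    simp only [PiLp.sub_apply] at hw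
    have hpar : w 0 * N 1 - w 1 * N 0 = 0 := by
      by_contra hne
      have h0 : (p 0 - q 0) * (w 0 * N 1 - w 1 * N 0) = 0 := by
        linear_combination N 1 * hw + w 1 * hNpq
      have h1 : (p 1 - q 1) * (w 0 * N 1 - w 1 * N 0) = 0 := by
        linear_combination (-N 0) * hw - w 0 * hNpq
      exact hpq (plane_ext (sub_eq_zero.1 ((mul_eq_zero.1 h0).resolve_right hne))
        (sub_eq_zero.1 ((mul_eq_zero.1 h1).resolve_right hne)))
    rw [plane_inner, plane_inner]
    simp only [PiLp.sub_apply, PiLp.smul_apply, smul_eq_mul]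
    linear_combination (-(u 0 * w 0) - u 1 * w 1) * hN2 + (u 0 * N 1 - u 1 * N 0) * hpar

/-- The outer normal, up to the choice of one of the two unit normals of the edge. -/
lemma outerNormal_eq {p q r N : Plane} {S t : Finset Plane} (hS : (S : Set Plane) = {p, q})
    (ht : (t : Set Plane) = {p, q, r}) (hpq : p ≠ q) (hN : ‖N‖ = 1)
    (hNpq : ⟪N, q - p⟫ = 0) (hr : 0 < ⟪N, r - p⟫) : outerNormal S t = -N := by
  classical
  have hpr : p ≠ r := by rintro rfl; simp at hr
  have hqr : q ≠ r := by rintro rfl; exact hr.ne' hNpq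
  have hS' : S = {p, q} := by apply Finset.coe_injective; simpa using hS
  have ht' : t = {p, q, r} := by apply Finset.coe_injective; simpa using ht
  have hSc : S.centroid ℝ id = (2⁻¹ : ℝ) • (p + q) := by
    rw [hS', centroid_eq_smul_sum (by simp), Finset.card_pair hpq, Finset.sum_pair hpq]; norm_num
  have htc : t.centroid ℝ id = (3⁻¹ : ℝ) • (p + q + r) := by
    have n1 : p ∉ ({q, r} : Finset Plane) := by simp [hpq, hpr]
    rw [ht', centroid_eq_smul_sum (by simp), Finset.card_insert_of_notMem n1,
      Finset.card_pair hqr, Finset.sum_insert n1, Finset.sum_pair hqr, add_assoc]; norm_num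
  -- The distance of the barycentre from a side is a third of that of the opposite vertex; only the
  -- sign matters after normalization.
  have hin : ⟪N, S.centroid ℝ id - t.centroid ℝ id⟫ = -(⟪N, r - p⟫ / 3) := by
    rw [inner_sub_right] at hNpq hr
    rw [hSc, htc, inner_sub_right, inner_sub_right, inner_smul_right, inner_smul_right,
      inner_add_right, inner_add_right, inner_add_right]
    linarith
  simp only [outerNormal]
  rw [starProjection_orthogonal_vectorSpan_pair hS hpq hN hNpq, hin, norm_smul, hN, mul_one,
    Real.norm_eq_abs, abs_neg, abs_of_pos (by positivity), smul_smul, mul_neg,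
    inv_mul_cancel₀ (by positivity), neg_one_smul]

/-! ### Cut-off functions of one variable -/

lemma deriv_eq_zero_of_eqOn_const {f : ℝ → ℝ} {U : Set ℝ} (hU : IsOpen U) {c : ℝ}
    (h : ∀ t ∈ U, f t = c) {t : ℝ} (ht : t ∈ U) : deriv f t = 0 := by
  have : f =ᶠ[𝓝 t] fun _ => c := by filter_upwards [hU.mem_nhds ht] with s hs using h s hs
  rw [this.deriv_eq, deriv_const]

lemma exists_deriv_bound {f : ℝ → ℝ} (hf : ContDiff ℝ ∞ f) {c d a b : ℝ}
    (h0 : ∀ t ≤ a, f t = c) (h1 : ∀ t, b ≤ t → f t = d) :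
    ∃ B : ℝ, 0 < B ∧ ∀ t, |f t| ≤ B ∧ |deriv f t| ≤ B := by
  have hc : Continuous (deriv f) := hf.continuous_deriv (by simp)
  have hs : HasCompactSupport (deriv f) := by
    refine HasCompactSupport.intro (isCompact_Icc (a := a) (b := b)) fun t ht => ?_
    rw [Set.mem_Icc, not_and_or, not_le, not_le] at ht
    rcases ht with ht | ht
    · exact deriv_eq_zero_of_eqOn_const isOpen_Iio (fun s hs => h0 s (le_of_lt hs)) ht
    · exact deriv_eq_zero_of_eqOn_const isOpen_Ioi (fun s hs => h1 s (le_of_lt hs)) ht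
  obtain ⟨B₁, hB₁⟩ := hs.exists_bound_of_continuous hc
  obtain ⟨B₂, hB₂⟩ := (isCompact_Icc (a := a) (b := b)).exists_bound_of_continuousOn
    hf.continuous.continuousOn
  refine ⟨|B₁| + |B₂| + |c| + |d| + 1, by positivity, fun t => ⟨?_, ?_⟩⟩
  · have e1 := abs_nonneg B₁
    have e2 := abs_nonneg B₂
    have e3 := abs_nonneg c
    have e4 := abs_nonneg d
    rcases le_total t a with h | h
    · rw [h0 t h]; linarith
    rcases le_total b t with h' | h'
    · rw [h1 t h']; linarith
    have := hB₂ t ⟨h, h'⟩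
    rw [Real.norm_eq_abs] at this
    linarith [le_abs_self B₂]
  · have := hB₁ t
    rw [Real.norm_eq_abs] at this
    have := le_abs_self B₁
    have e2 := abs_nonneg B₂
    have e3 := abs_nonneg c
    have e4 := abs_nonneg d
    linarith

/-- A cut-off function with two vanishing moments on `[0, 1]`. -/
lemma exists_cutoff : ∃ Ψ : ℝ → ℝ, ContDiff ℝ ∞ Ψ ∧ (∀ t ≤ 1 / 4, Ψ t = 1) ∧
    (∀ t, 1 ≤ t → Ψ t = 0) ∧ ∫ t in (0 : ℝ)..1, Ψ t = 0 ∧ ∫ t in (0 : ℝ)..1, t * Ψ t = 0 := by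
  -- The cut-off is θ'' with θ = t²/2 near and to the left of 0 and θ = 0 near 1. Then θ'' = 1 on
  -- the left, and both moments over [0, 1] are boundary terms, of θ' and of tθ' - θ, that vanish at
  -- both ends.
  set θ : ℝ → ℝ := fun t => t ^ 2 / 2 * Real.smoothTransition (3 - 4 * t) with hθ
  have hsm : ContDiff ℝ ∞ θ := by
    have : ContDiff ℝ ∞ fun t : ℝ => Real.smoothTransition (3 - 4 * t) :=
      Real.smoothTransition.contDiff.comp (by fun_prop)
    exact ContDiff.mul (by fun_prop) this
  have h1 : ContDiff ℝ ∞ (deriv θ) := ((contDiff_infty_iff_deriv).1 hsm).2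
  have h2 : ContDiff ℝ ∞ (deriv (deriv θ)) := ((contDiff_infty_iff_deriv).1 h1).2
  have hlow : ∀ t < 1 / 2, θ t = t ^ 2 / 2 := by
    intro t ht
    rw [hθ]; simp only
    rw [Real.smoothTransition.one_of_one_le (by linarith), mul_one]
  have hhigh : ∀ t > 3 / 4, θ t = 0 := by
    intro t ht
    rw [hθ]; simp only
    rw [Real.smoothTransition.zero_of_nonpos (by linarith), mul_zero]
  have d1low : ∀ t < 1 / 2, deriv θ t = t := by
    intro t ht
    have : θ =ᶠ[𝓝 t] fun t => t ^ 2 / 2 := by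
      filter_upwards [isOpen_Iio.mem_nhds ht] with s hs using hlow s hs
    rw [this.deriv_eq]
    simp
  have d2low : ∀ t < 1 / 2, deriv (deriv θ) t = 1 := by
    intro t ht
    have : deriv θ =ᶠ[𝓝 t] fun t => t := by
      filter_upwards [isOpen_Iio.mem_nhds ht] with s hs using d1low s hs
    rw [this.deriv_eq]; simp
  have d1high : ∀ t > 3 / 4, deriv θ t = 0 := fun t ht =>
    deriv_eq_zero_of_eqOn_const isOpen_Ioi (c := 0) (fun s hs => hhigh s hs) ht
  have d2high : ∀ t > 3 / 4, deriv (deriv θ) t = 0 := fun t ht =>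
    deriv_eq_zero_of_eqOn_const isOpen_Ioi (c := 0) (fun s hs => d1high s hs) ht
  have hd : ∀ t, HasDerivAt θ (deriv θ t) t := fun t =>
    (hsm.differentiable (by simp) t).hasDerivAt
  have hdd : ∀ t, HasDerivAt (deriv θ) (deriv (deriv θ) t) t := fun t =>
    (h1.differentiable (by simp) t).hasDerivAt
  refine ⟨deriv (deriv θ), h2, fun t ht => d2low t (by linarith),
    fun t ht => d2high t (by linarith), ?_, ?_⟩
  · rw [intervalIntegral.integral_eq_sub_of_hasDerivAt (fun t _ => hdd t)
      (h2.continuous.intervalIntegrable _ _), d1high 1 (by norm_num), d1low 0 (by norm_num), sub_zero]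
  · have hprim : ∀ t ∈ Set.uIcc (0 : ℝ) 1, HasDerivAt (fun t => t * deriv θ t - θ t)
        (t * deriv (deriv θ) t) t := by
      intro t _
      have := ((hasDerivAt_id t).mul (hdd t)).sub (hd t)
      convert! this using 1
      simp
    rw [intervalIntegral.integral_eq_sub_of_hasDerivAt hprim
      ((continuous_id.mul h2.continuous).intervalIntegrable _ _), d1high 1 (by norm_num),
      hhigh 1 (by norm_num), hlow 0 (by norm_num)]
    norm_num

/-- Confines the test function of a long edge to the middle half of the strip, where the two
triangles at the edge are not thin. -/
lemma exists_bump : ∃ b : ℝ → ℝ, ContDiff ℝ ∞ b ∧ (∀ t ≤ 1 / 4, b t = 0) ∧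
    (∀ t, 3 / 4 ≤ t → b t = 0) ∧ 0 < ∫ t in (0 : ℝ)..1, b t := by
  have c1 : ContDiff ℝ ∞ fun t : ℝ => Real.smoothTransition (4 * t - 1) :=
    Real.smoothTransition.contDiff.comp (by fun_prop)
  have c2 : ContDiff ℝ ∞ fun t : ℝ => Real.smoothTransition (3 - 4 * t) :=
    Real.smoothTransition.contDiff.comp (by fun_prop)
  refine ⟨fun t => Real.smoothTransition (4 * t - 1) * Real.smoothTransition (3 - 4 * t),
    c1.mul c2, fun t ht => ?_, fun t ht => ?_, ?_⟩
  · simp only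
    rw [Real.smoothTransition.zero_of_nonpos (by linarith), zero_mul]
  · simp only
    rw [Real.smoothTransition.zero_of_nonpos (x := 3 - 4 * t) (by linarith), mul_zero]
  · refine intervalIntegral.integral_pos one_pos (c1.mul c2).continuous.continuousOn
      (fun t _ => mul_nonneg (Real.smoothTransition.nonneg _) (Real.smoothTransition.nonneg _))
      ⟨1 / 2, by norm_num, ?_⟩
    exact mul_pos (Real.smoothTransition.pos_of_pos (by norm_num))
      (Real.smoothTransition.pos_of_pos (by norm_num))

/-! ### Smoothing of a step function -/

section Steps

variable {ι : Type*} (L : Finset ι) (a b J : ι → ℝ)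

/-- The jump at `z` of the function with the value `J t` on `[a t, b t]`. -/
def stepJump (z : ℝ) : ℝ := ∑ s ∈ L, J s * ((if a s = z then 1 else 0) - (if b s = z then 1 else 0))

/-- The breakpoints of a step function. -/
def breakpoints : Finset ℝ := L.image a ∪ L.image b

/-- Abel summation. With c the indicator of {z ≤ y} it recovers the value of the step function from
its jumps to the left. -/
lemma sum_stepJump_mul (c : ℝ → ℝ) :
    ∑ z ∈ breakpoints L a b, stepJump L a b J z * c z = ∑ s ∈ L, J s * (c (a s) - c (b s)) := by
  simp only [stepJump, Finset.sum_mul]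
  rw [Finset.sum_comm]
  refine Finset.sum_congr rfl fun s hs => ?_
  have ha : a s ∈ breakpoints L a b :=
    Finset.mem_union_left _ (Finset.mem_image_of_mem a hs)
  have hb : b s ∈ breakpoints L a b :=
    Finset.mem_union_right _ (Finset.mem_image_of_mem b hs)
  have : ∀ z, J s * ((if a s = z then 1 else 0) - if b s = z then 1 else 0) * c z =
      (if a s = z then J s * c z else 0) - (if b s = z then J s * c z else 0) := by
    intro z; split_ifs <;> ring
  simp only [this, Finset.sum_sub_distrib, Finset.sum_ite_eq, ha, hb, if_true]
  ring

/-- A smooth transition from `0` to `1` inside `[a, b]`. -/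
def smoothStep (a b y : ℝ) : ℝ := Real.smoothTransition (4 * ((y - a) / (b - a)) - 1)

lemma contDiff_smoothStep (a b : ℝ) : ContDiff ℝ ∞ (smoothStep a b) :=
  Real.smoothTransition.contDiff.comp (by fun_prop)

lemma smoothStep_eq_zero {a b y : ℝ} (hab : a < b) (h : y ≤ a + (b - a) / 4) :
    smoothStep a b y = 0 := by
  apply Real.smoothTransition.zero_of_nonpos
  have : (y - a) / (b - a) ≤ 1 / 4 := by rw [div_le_iff₀ (sub_pos.2 hab)]; linarith
  linarith

lemma smoothStep_eq_one {a b y : ℝ} (hab : a < b) (h : b - (b - a) / 4 ≤ y) :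
    smoothStep a b y = 1 := by
  apply Real.smoothTransition.one_of_one_le
  have : 1 / 2 ≤ (y - a) / (b - a) := by rw [le_div_iff₀ (sub_pos.2 hab)]; linarith
  linarith

lemma deriv_smoothStep (a b y : ℝ) : deriv (smoothStep a b) y =
    deriv Real.smoothTransition (4 * ((y - a) / (b - a)) - 1) * (4 / (b - a)) := by
  have h1 : HasDerivAt Real.smoothTransition
      (deriv Real.smoothTransition (4 * ((y - a) / (b - a)) - 1)) (4 * ((y - a) / (b - a)) - 1) :=
    ((Real.smoothTransition.contDiff (n := 1)).differentiable (by simp) _).hasDerivAt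
  have h2 : HasDerivAt (fun y => 4 * ((y - a) / (b - a)) - 1) (4 / (b - a)) y := by
    have := ((((hasDerivAt_id y).sub_const a).div_const (b - a)).const_mul 4).sub_const 1
    convert! this using 1
    ring
  exact (h1.comp y h2).deriv

/-- The smoothing is the sum of the jumps, each multiplied by a smooth transition placed in the
middle half of one interval that has the breakpoint as an end. On a given interval at most the
transitions belonging to its two ends vary, so value and derivative are off by no more than these
two jumps. Near all ends of intervals no transition is under way, whence the last property, and
outside the intervals the jumps cancel. -/
lemma exists_smooth_steps : ∃ K : ℝ, 0 < K ∧ ∀ {ι : Type} [Nonempty ι] (L : Finset ι)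
    (a b J : ι → ℝ), (∀ t ∈ L, a t < b t) →
    (∀ s ∈ L, ∀ t ∈ L, s ≠ t → b s ≤ a t ∨ b t ≤ a s) →
    ∃ w : ℝ → ℝ, ContDiff ℝ ∞ w ∧
      (∀ t ∈ L, ∀ y ∈ Set.Icc (a t) (b t),
        |w y - J t| ≤ |stepJump L a b J (a t)| + |stepJump L a b J (b t)| ∧
        |deriv w y| ≤ K / (b t - a t) * (|stepJump L a b J (a t)| + |stepJump L a b J (b t)|)) ∧
      (∀ y, (∀ t ∈ L, y ∉ Set.Icc (a t) (b t)) → w y = 0 ∧ deriv w y = 0) ∧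
      (∀ y y', (∀ t ∈ L, (y ≤ a t + (b t - a t) / 4 ∧ y' ≤ a t + (b t - a t) / 4) ∨
        (b t - (b t - a t) / 4 ≤ y ∧ b t - (b t - a t) / 4 ≤ y')) → w y = w y') := by
  obtain ⟨B, hB, hBd⟩ := exists_deriv_bound (f := Real.smoothTransition) (a := 0) (b := 1)
    (c := 0) (d := 1) Real.smoothTransition.contDiff
    (fun t ht => Real.smoothTransition.zero_of_nonpos ht)
    (fun t ht => Real.smoothTransition.one_of_one_le ht)
  refine ⟨4 * B, by positivity, ?_⟩
  classical
  intro ι _ L a b J hab hdis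
  set D := stepJump L a b J with hD
  set Z := breakpoints L a b with hZ
  have hsel : ∀ z ∈ Z, ∃ s, s ∈ L ∧ (z = a s ∨ z = b s) := by
    intro z hz
    rw [hZ, breakpoints, Finset.mem_union, Finset.mem_image, Finset.mem_image] at hz
    rcases hz with ⟨s, hs, rfl⟩ | ⟨s, hs, rfl⟩
    · exact ⟨s, hs, Or.inl rfl⟩
    · exact ⟨s, hs, Or.inr rfl⟩
  choose! sel hselL hselz using hsel
  set w : ℝ → ℝ := fun y => ∑ z ∈ Z, D z * smoothStep (a (sel z)) (b (sel z)) y with hw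
  have hwd : ∀ y, deriv w y = ∑ z ∈ Z, D z * deriv (smoothStep (a (sel z)) (b (sel z))) y := by
    intro y
    have : HasDerivAt w (∑ z ∈ Z, D z * deriv (smoothStep (a (sel z)) (b (sel z))) y) y := by
      rw [hw]
      exact HasDerivAt.fun_sum fun z _ =>
        (((contDiff_smoothStep _ _).differentiable (by simp) y).hasDerivAt).const_mul (D z)
    exact this.deriv
  have dzero : ∀ s ∈ L, ∀ y, y ≤ a s ∨ b s ≤ y → deriv (smoothStep (a s) (b s)) y = 0 := by
    intro s hs y hy
    have h := hab s hs
    rcases hy with hy | hy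
    · exact deriv_eq_zero_of_eqOn_const (isOpen_Iio (a := a s + (b s - a s) / 4)) (c := 0)
        (fun u hu => smoothStep_eq_zero h (le_of_lt hu)) (by simp; linarith)
    · exact deriv_eq_zero_of_eqOn_const (isOpen_Ioi (a := b s - (b s - a s) / 4)) (c := 1)
        (fun u hu => smoothStep_eq_one h (le_of_lt hu)) (by simp; linarith)
  -- Terms survive only for breakpoints whose transition was put into the interval t; these are
  -- among its two ends.
  have hbd : ∀ t, ∀ c : ℝ, 0 ≤ c → ∀ F : ℝ → ℝ, (∀ z ∈ Z, sel z ≠ t → F z = 0) →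
      (∀ z ∈ Z, |F z| ≤ c) → |∑ z ∈ Z, D z * F z| ≤ c * (|D (a t)| + |D (b t)|) := by
    intro t c hc F hF0 hFc
    have h1 : ∀ z ∈ Z, |D z * F z| ≤
        (if a t = z then c * |D z| else 0) + (if b t = z then c * |D z| else 0) := by
      intro z hz
      have hn : 0 ≤ c * |D z| := by positivity
      by_cases h : sel z = t
      · have h2 : |D z * F z| ≤ c * |D z| := by
          rw [abs_mul, mul_comm]
          exact mul_le_mul_of_nonneg_right (hFc z hz) (abs_nonneg _)
        have h3 := hselz z hz
        rw [h] at h3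
        rcases h3 with h3 | h3
        · rw [if_pos h3.symm]; split_ifs <;> linarith
        · rw [if_pos h3.symm]; split_ifs <;> linarith
      · rw [hF0 z hz h, mul_zero, abs_zero]
        split_ifs <;> linarith
    refine (Finset.abs_sum_le_sum_abs _ _).trans ((Finset.sum_le_sum h1).trans ?_)
    rw [Finset.sum_add_distrib, Finset.sum_ite_eq, Finset.sum_ite_eq, mul_add]
    have hn : ∀ z, 0 ≤ c * |D z| := fun z => by positivity
    have := hn (a t); have := hn (b t)
    split_ifs <;> linarith
  refine ⟨w, ?_, ?_, ?_, ?_⟩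
  · exact ContDiff.sum fun z _ => contDiff_const.mul (contDiff_smoothStep _ _)
  · intro t ht y hy
    have habt := hab t ht
    constructor
    -- The unsmoothed value: the sum of all jumps at breakpoints up to the left end of t. Comparing
    -- term by term with w leaves only the transitions inside t.
    · have hJ : J t = ∑ z ∈ Z, D z * (if z ≤ a t then 1 else 0) := by
        rw [hD, hZ, sum_stepJump_mul L a b J (fun z => if z ≤ a t then 1 else 0),
          Finset.sum_eq_single t]
        · rw [if_pos le_rfl, if_neg (not_le.2 habt)]; ring
        · intro s hs hst
          have habs := hab s hs
          rcases hdis s hs t ht hst with h | h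
          · rw [if_pos (by linarith), if_pos h]; ring
          · rw [if_neg (by linarith), if_neg (by linarith)]; ring
        · exact fun h => absurd ht h
      have : w y - J t = ∑ z ∈ Z, D z *
          (smoothStep (a (sel z)) (b (sel z)) y - (if z ≤ a t then 1 else 0)) := by
        rw [hJ, hw]; simp only [mul_sub, Finset.sum_sub_distrib]
      rw [this]
      refine (hbd t 1 zero_le_one _ ?_ ?_).trans (by rw [one_mul])
      · intro z hz hzt
        have hs := hselL z hz
        have habs := hab _ hs
        rcases hdis _ hs t ht hzt with h | h
        · rw [smoothStep_eq_one habs (by linarith [hy.1]), if_pos, sub_self]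
          rcases hselz z hz with e | e <;> rw [e] <;> linarith
        · rw [smoothStep_eq_zero habs (by linarith [hy.2]), if_neg, sub_self]
          rcases hselz z hz with e | e <;> rw [e] <;> linarith
      · intro z _
        have h0 := Real.smoothTransition.nonneg
          (4 * ((y - a (sel z)) / (b (sel z) - a (sel z))) - 1)
        have h1 := Real.smoothTransition.le_one
          (4 * ((y - a (sel z)) / (b (sel z) - a (sel z))) - 1)
        rw [abs_le, smoothStep]
        split_ifs <;> constructor <;> linarith
    · rw [hwd]
      have hF : ∀ z ∈ Z, sel z ≠ t → deriv (smoothStep (a (sel z)) (b (sel z))) y = 0 := by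
        intro z hz hzt
        have hs := hselL z hz
        rcases hdis _ hs t ht hzt with h | h
        · exact dzero _ hs _ (Or.inr (h.trans hy.1))
        · exact dzero _ hs _ (Or.inl (hy.2.trans h))
      have hpos := sub_pos.2 habt
      refine hbd t (4 * B / (b t - a t)) (by positivity) _ hF fun z hz => ?_
      by_cases h : sel z = t
      · rw [h, deriv_smoothStep, abs_mul, abs_of_pos (a := 4 / (b t - a t)) (by positivity)]
        have := mul_le_mul_of_nonneg_right (hBd (4 * ((y - a t) / (b t - a t)) - 1)).2
          (show 0 ≤ 4 / (b t - a t) by positivity)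
        calc _ ≤ _ := this
          _ = _ := by ring
      · rw [hF z hz h, abs_zero]; positivity
  · intro y hy
    have hout : ∀ s ∈ L, y < a s ∨ b s < y := by
      intro s hs
      have := hy s hs
      rw [Set.mem_Icc, not_and_or, not_le, not_le] at this
      exact this
    constructor
    -- At a point outside all intervals the step function is zero, and every transition is already
    -- complete or not yet begun.
    · have h0 : ∑ z ∈ Z, D z * (if z ≤ y then 1 else 0) = 0 := by
        rw [hD, hZ, sum_stepJump_mul L a b J (fun z => if z ≤ y then 1 else 0)]
        refine Finset.sum_eq_zero fun s hs => ?_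
        have habs := hab s hs
        rcases hout s hs with h | h
        · rw [if_neg (by linarith), if_neg (by linarith)]; ring
        · rw [if_pos (by linarith), if_pos (by linarith)]; ring
      rw [← h0, hw]
      refine Finset.sum_congr rfl fun z hz => ?_
      have hs := hselL z hz
      have habs := hab _ hs
      rcases hout _ hs with h | h
      · rw [smoothStep_eq_zero habs (by linarith), if_neg]
        rcases hselz z hz with e | e <;> rw [e] <;> linarith
      · rw [smoothStep_eq_one habs (by linarith), if_pos]
        rcases hselz z hz with e | e <;> rw [e] <;> linarith
    · rw [hwd]
      refine Finset.sum_eq_zero fun z hz => ?_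
      have hs := hselL z hz
      rw [dzero _ hs, mul_zero]
      exact (hout _ hs).imp le_of_lt le_of_lt
  · intro y y' h
    refine Finset.sum_congr rfl fun z hz => ?_
    have hs := hselL z hz
    have habs := hab _ hs
    rcases h _ hs with ⟨h1, h2⟩ | ⟨h1, h2⟩
    · rw [smoothStep_eq_zero habs h1, smoothStep_eq_zero habs h2]
    · rw [smoothStep_eq_one habs h1, smoothStep_eq_one habs h2]

end Steps

/-! ### Test functions of product form -/

/-- A product in sheared coordinates. -/
def shearProd (χ w : ℝ → ℝ) (e σ : ℝ) (p : Plane) : ℝ := χ (p 0) * w (p 1 - (e + σ * p 0))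

section ShearProd

variable {χ w : ℝ → ℝ} (hχ : ContDiff ℝ ∞ χ) (hw : ContDiff ℝ ∞ w) (e σ : ℝ)

include hχ hw

lemma contDiff_shearProd : ContDiff ℝ ∞ (shearProd χ w e σ) := by
  have h0 := contDiff_coord 0
  have h1 := contDiff_coord 1
  exact (hχ.comp h0).mul (hw.comp (h1.sub (contDiff_const.add (contDiff_const.mul h0))))

lemma inner_gradient_shearProd (g p : Plane) : ⟪g, gradient (shearProd χ w e σ) p⟫ =
    g 0 * (deriv χ (p 0) * w (p 1 - (e + σ * p 0)) -
      σ * (χ (p 0) * deriv w (p 1 - (e + σ * p 0)))) +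
    g 1 * (χ (p 0) * deriv w (p 1 - (e + σ * p 0))) := by
  rw [real_inner_comm, inner_gradient_left]
  have hv := (contDiff_shearProd hχ hw e σ).differentiable (by simp) p
  have hline : HasDerivAt (fun τ : ℝ => p + τ • g) g 0 := by
    simpa using ((hasDerivAt_id (0 : ℝ)).smul_const g).const_add p
  have h1 : HasDerivAt (fun τ : ℝ => shearProd χ w e σ (p + τ • g))
      (fderiv ℝ (shearProd χ w e σ) p g) 0 := by
    have hv' : HasFDerivAt (shearProd χ w e σ) (fderiv ℝ (shearProd χ w e σ) p)
      (p + (0 : ℝ) • g) := by simpa using hv.hasFDerivAt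
    exact hv'.comp_hasDerivAt 0 hline
  have hχ' : ∀ y, HasDerivAt χ (deriv χ y) y := fun y =>
    (hχ.differentiable (by simp) y).hasDerivAt
  have hw' : ∀ y, HasDerivAt w (deriv w y) y := fun y =>
    (hw.differentiable (by simp) y).hasDerivAt
  have e1 : HasDerivAt (fun τ : ℝ => p 0 + τ * g 0) (g 0) 0 := by
    simpa using ((hasDerivAt_id (0 : ℝ)).mul_const (g 0)).const_add (p 0)
  have e2 : HasDerivAt (fun τ : ℝ => p 1 + τ * g 1 - (e + σ * (p 0 + τ * g 0)))
      (g 1 - σ * g 0) 0 := by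
    have := (((hasDerivAt_id (0 : ℝ)).mul_const (g 1)).const_add (p 1)).fun_sub
      ((e1.const_mul σ).const_add e)
    simpa using this
  have e3 : HasDerivAt (fun τ : ℝ => χ (p 0 + τ * g 0)) (deriv χ (p 0) * g 0) 0 := by
    simpa [Function.comp_def] using (hχ' (p 0 + 0 * g 0)).comp 0 e1
  have e4 : HasDerivAt (fun τ : ℝ => w (p 1 + τ * g 1 - (e + σ * (p 0 + τ * g 0))))
      (deriv w (p 1 - (e + σ * p 0)) * (g 1 - σ * g 0)) 0 := by
    simpa [Function.comp_def] using (hw' (p 1 + 0 * g 1 - (e + σ * (p 0 + 0 * g 0)))).comp 0 e2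
  have h2 := e3.mul e4
  have h3 := h1.unique h2
  rw [h3]
  simp only [zero_mul, add_zero]
  ring

lemma norm_sq_gradient_shearProd (p : Plane) : ‖gradient (shearProd χ w e σ) p‖ ^ 2 =
    (deriv χ (p 0) * w (p 1 - (e + σ * p 0)) -
      σ * (χ (p 0) * deriv w (p 1 - (e + σ * p 0)))) ^ 2 +
    (χ (p 0) * deriv w (p 1 - (e + σ * p 0))) ^ 2 := by
  have h0 := inner_gradient_shearProd hχ hw e σ (pt 1 0) p
  have h1 := inner_gradient_shearProd hχ hw e σ (pt 0 1) p
  rw [plane_inner] at h0 h1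
  simp only [pt_zero, pt_one, one_mul, zero_mul, add_zero, zero_add] at h0 h1
  rw [plane_norm_sq, h0, h1]

end ShearProd

/-- The integrals over a triangle of a product and of its derivatives, if one factor is constant
along the sides of the triangle, where the other one does not vanish. -/
lemma StripTriangle.integrals_shearProd {t : Finset Plane} {X₀ X₁ : ℝ} {lo up : Fin 2 → ℝ}
    (h : StripTriangle t X₀ X₁ lo up) {χ w : ℝ → ℝ} (hχ : ContDiff ℝ ∞ χ) (hw : ContDiff ℝ ∞ w)
    (e σ : ℝ) {r₀ r₁ wu wl : ℝ}
    (hr : ∀ x ∈ Set.Icc X₀ X₁, x ∉ Set.Icc r₀ r₁ → χ x = 0)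
    (hup : ∀ x ∈ Set.Icc r₀ r₁, w (lerp X₀ X₁ (up 0) (up 1) x - (e + σ * x)) = wu)
    (hlo : ∀ x ∈ Set.Icc r₀ r₁, w (lerp X₀ X₁ (lo 0) (lo 1) x - (e + σ * x)) = wl) :
    let A : ℝ → ℝ := fun x => ∫ y in (lerp X₀ X₁ (lo 0) (lo 1) x - (e + σ * x))..
      (lerp X₀ X₁ (up 0) (up 1) x - (e + σ * x)), w y
    let κ : ℝ := ((up 1 - up 0) / (X₁ - X₀) - σ) * wu - ((lo 1 - lo 0) / (X₁ - X₀) - σ) * wl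
    (∫ p in hull t, χ (p 0) * deriv w (p 1 - (e + σ * p 0)) = (wu - wl) * ∫ x in X₀..X₁, χ x) ∧
    (∫ p in hull t, deriv χ (p 0) * w (p 1 - (e + σ * p 0)) =
      χ X₁ * A X₁ - χ X₀ * A X₀ - κ * ∫ x in X₀..X₁, χ x) ∧
    (∫ p in hull t, χ (p 0) * w (p 1 - (e + σ * p 0)) =
      A r₀ * (∫ x in X₀..X₁, χ x) + κ * ∫ x in X₀..X₁, χ x * (x - r₀)) := by
  intro A κ
  have hχc : Continuous χ := hχ.continuous
  have hwc : Continuous w := hw.continuous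
  have hχ'c : Continuous (deriv χ) := hχ.continuous_deriv (by simp)
  have hw'c : Continuous (deriv w) := hw.continuous_deriv (by simp)
  have h0c := continuous_coord 0
  have h1c := continuous_coord 1
  have hsh : Continuous fun p : Plane => p 1 - (e + σ * p 0) := by fun_prop
  have hle := h.lt.le
  have hu : Set.uIcc X₀ X₁ = Set.Icc X₀ X₁ := Set.uIcc_of_le hle
  set U : ℝ → ℝ := fun x => lerp X₀ X₁ (up 0) (up 1) x - (e + σ * x) with hU
  set V : ℝ → ℝ := fun x => lerp X₀ X₁ (lo 0) (lo 1) x - (e + σ * x) with hV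
  have hell : ∀ x, HasDerivAt (fun x => e + σ * x) σ x := fun x => by
    simpa using ((hasDerivAt_id x).const_mul σ).const_add e
  have hUd : ∀ x, HasDerivAt U ((up 1 - up 0) / (X₁ - X₀) - σ) x := fun x =>
    (hasDerivAt_lerp _ _ _ _ x).sub (hell x)
  have hVd : ∀ x, HasDerivAt V ((lo 1 - lo 0) / (X₁ - X₀) - σ) x := fun x =>
    (hasDerivAt_lerp _ _ _ _ x).sub (hell x)
  have hUc : Continuous U := continuous_iff_continuousAt.2 fun x => (hUd x).continuousAt
  have hVc : Continuous V := continuous_iff_continuousAt.2 fun x => (hVd x).continuousAt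
  set A' : ℝ → ℝ := fun x => w (U x) * ((up 1 - up 0) / (X₁ - X₀) - σ) -
    w (V x) * ((lo 1 - lo 0) / (X₁ - X₀) - σ) with hA'
  have hA'c : Continuous A' :=
    ((hwc.comp hUc).mul continuous_const).sub ((hwc.comp hVc).mul continuous_const)
  have hAd : ∀ x, HasDerivAt A (A' x) x := by
    intro x
    have hprim : ∀ y, HasDerivAt (fun y => ∫ z in (0 : ℝ)..y, w z) (w y) y := fun y =>
      intervalIntegral.integral_hasDerivAt_right (hwc.intervalIntegrable _ _)
        (hwc.stronglyMeasurableAtFilter _ _) hwc.continuousAt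
    have hAeq : A = fun x => (∫ z in (0 : ℝ)..U x, w z) - ∫ z in (0 : ℝ)..V x, w z := by
      ext x
      exact (intervalIntegral.integral_interval_sub_left (hwc.intervalIntegrable _ _)
        (hwc.intervalIntegrable _ _)).symm
    rw [hAeq]
    exact ((hprim (U x)).comp x (hUd x)).sub ((hprim (V x)).comp x (hVd x))
  have hAc : Continuous A := continuous_iff_continuousAt.2 fun x => (hAd x).continuousAt
  -- The section integral A has by Leibniz the derivative w(U)U' - w(V)V'. As w is constant along
  -- both sides over the support of χ, this is the constant κ: A is affine there.
  have hA'κ : ∀ x ∈ Set.Icc r₀ r₁, A' x = κ := by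
    intro x hx
    simp only [hA', hU, hV, hup x hx, hlo x hx, κ]; ring
  refine ⟨?_, ?_, ?_⟩
  · rw [h.setIntegral_hull (F := fun p => χ (p 0) * deriv w (p 1 - (e + σ * p 0)))
      ((hχc.comp h0c).mul (hw'c.comp hsh)),
      ← intervalIntegral.integral_const_mul]
    refine intervalIntegral.integral_congr fun x hx => ?_
    rw [hu] at hx
    simp only [pt_zero, pt_one]
    rw [intervalIntegral.integral_const_mul, intervalIntegral.integral_comp_sub_right (deriv w),
      intervalIntegral.integral_deriv_eq_sub (fun y _ => hw.differentiable (by simp) y)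
        (hw'c.intervalIntegrable _ _)]
    by_cases hx' : x ∈ Set.Icc r₀ r₁
    · rw [hup x hx', hlo x hx']; ring
    · rw [hr x hx hx']; ring
  · rw [h.setIntegral_hull (F := fun p => deriv χ (p 0) * w (p 1 - (e + σ * p 0)))
      ((hχ'c.comp h0c).mul (hwc.comp hsh))]
    have e1 : ∀ x ∈ Set.uIcc X₀ X₁, (∫ y in (lerp X₀ X₁ (lo 0) (lo 1) x)..
        (lerp X₀ X₁ (up 0) (up 1) x), deriv χ (pt x y 0) * w (pt x y 1 - (e + σ * pt x y 0))) =
        A x * deriv χ x := by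
      intro x _
      simp only [pt_zero, pt_one]
      rw [intervalIntegral.integral_const_mul, intervalIntegral.integral_comp_sub_right w, mul_comm]
    -- Integration by parts in x moves the derivative from χ to A; the boundary terms on the two
    -- vertical lines are kept, since ψ will equal 1 on one of them.
    rw [intervalIntegral.integral_congr e1,
      intervalIntegral.integral_mul_deriv_eq_deriv_mul (fun x _ => hAd x)
        (fun x _ => (hχ.differentiable (by simp) x).hasDerivAt) (hA'c.intervalIntegrable _ _)
        (hχ'c.intervalIntegrable _ _)]
    have e2 : ∀ x ∈ Set.uIcc X₀ X₁, A' x * χ x = κ * χ x := by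
      intro x hx
      rw [hu] at hx
      by_cases hx' : x ∈ Set.Icc r₀ r₁
      · rw [hA'κ x hx']
      · rw [hr x hx hx']; ring
    rw [intervalIntegral.integral_congr e2, intervalIntegral.integral_const_mul]
    ring
  · rw [h.setIntegral_hull (F := fun p => χ (p 0) * w (p 1 - (e + σ * p 0)))
      ((hχc.comp h0c).mul (hwc.comp hsh))]
    have e1 : ∀ x ∈ Set.uIcc X₀ X₁, (∫ y in (lerp X₀ X₁ (lo 0) (lo 1) x)..
        (lerp X₀ X₁ (up 0) (up 1) x), χ (pt x y 0) * w (pt x y 1 - (e + σ * pt x y 0))) =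
        A r₀ * χ x + κ * (χ x * (x - r₀)) := by
      intro x hx
      rw [hu] at hx
      simp only [pt_zero, pt_one]
      rw [intervalIntegral.integral_const_mul, intervalIntegral.integral_comp_sub_right w]
      change χ x * A x = _
      by_cases hx' : x ∈ Set.Icc r₀ r₁
      · have h3 : ∫ y in r₀..x, A' y = A x - A r₀ :=
          intervalIntegral.integral_eq_sub_of_hasDerivAt (fun y _ => hAd y)
            (hA'c.intervalIntegrable _ _)
        have h4 : ∫ y in r₀..x, A' y = ∫ y in r₀..x, κ := by
          refine intervalIntegral.integral_congr fun y hy => ?_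
          rw [Set.uIcc_of_le hx'.1] at hy
          exact hA'κ y ⟨hy.1, hy.2.trans hx'.2⟩
        rw [h4, intervalIntegral.integral_const, smul_eq_mul] at h3
        linear_combination (-χ x) * h3
      · rw [hr x hx hx']; ring
    rw [intervalIntegral.integral_congr e1, intervalIntegral.integral_add
      (f := fun x => A r₀ * χ x) (g := fun x => κ * (χ x * (x - r₀)))
      ((continuous_const.mul hχc).intervalIntegrable _ _)
      ((continuous_const.mul (hχc.mul (continuous_id.sub continuous_const))).intervalIntegrable _ _),
      intervalIntegral.integral_const_mul, intervalIntegral.integral_const_mul]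

/-! ### The residual of the finite element solution -/

/-- The Cauchy–Schwarz inequality against the constant 1, from the nonnegativity of ∫(h - c)² at the
mean value c. -/
lemma sq_setIntegral_le {s : Set Plane} (hs : volume s ≠ ⊤) {h : Plane → ℝ}
    (h1 : IntegrableOn h s) (h2 : IntegrableOn (fun p => h p ^ 2) s) :
    (∫ p in s, h p) ^ 2 ≤ area s * ∫ p in s, h p ^ 2 := by
  have key : ∀ c : ℝ, 0 ≤ (∫ p in s, h p ^ 2) - 2 * c * (∫ p in s, h p) + c ^ 2 * area s := by
    intro c
    have hc : IntegrableOn (fun _ : Plane => c ^ 2) s := integrableOn_const hs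
    have h3 : ∫ p in s, (h p - c) ^ 2 =
        (∫ p in s, h p ^ 2) - 2 * c * (∫ p in s, h p) + c ^ 2 * area s := by
      have e : ∀ p, (h p - c) ^ 2 = (h p ^ 2 - 2 * c * h p) + c ^ 2 := fun p => by ring
      simp_rw [e]
      rw [integral_add (μ := volume.restrict s) (f := fun p => h p ^ 2 - 2 * c * h p)
        (Integrable.sub h2 (h1.const_mul _)) hc,
        integral_sub h2 (h1.const_mul _), integral_const_mul, setIntegral_const, smul_eq_mul]
      simp only [area]; ring
    rw [← h3]
    exact integral_nonneg fun p => sq_nonneg _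
  have hA : 0 ≤ area s := measureReal_nonneg
  have h0 : 0 ≤ ∫ p in s, h p ^ 2 := integral_nonneg fun p => sq_nonneg _
  rcases hA.eq_or_lt with hA | hA
  · have hz : ∫ p in s, h p = 0 := by
      refine setIntegral_measure_zero _ ?_
      exact (measureReal_eq_zero_iff hs).1 hA.symm
    rw [hz, ← hA]; simp
  · have := key ((∫ p in s, h p) / area s)
    have e : (∫ p in s, h p ^ 2) - 2 * ((∫ p in s, h p) / area s) * (∫ p in s, h p) +
        ((∫ p in s, h p) / area s) ^ 2 * area s =
        ((area s * ∫ p in s, h p ^ 2) - (∫ p in s, h p) ^ 2) / area s := by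
      field_simp; ring
    rw [e] at this
    have := mul_nonneg this hA.le
    rw [div_mul_cancel₀ _ hA.ne'] at this
    linarith

/-- The squared error of the gradient plus the squared oscillation of the data on an element. -/
def localError (f uh : Plane → ℝ) (G : Plane → Plane) (t : Finset Plane) : ℝ :=
  (∫ p in hull t, ‖elementGradient uh t - G p‖ ^ 2) +
    (Metric.diam (hull t) * osc f (hull t)) ^ 2 * area (hull t)

lemma localError_nonneg (f uh : Plane → ℝ) (G : Plane → Plane) (t : Finset Plane) :
    0 ≤ localError f uh G t :=
  add_nonneg (integral_nonneg fun _ => sq_nonneg _)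
    (mul_nonneg (sq_nonneg _) measureReal_nonneg)

lemma isBounded_unitSquare : Bornology.IsBounded (unitSquare : Set Plane) := by
  refine (Metric.isBounded_iff_subset_closedBall 0).2 ⟨2, fun p hp => ?_⟩
  obtain ⟨h1, h2, h3, h4⟩ := hp
  rw [mem_closedBall_zero_iff]
  have := plane_norm_sq p
  nlinarith [norm_nonneg p]

lemma isTestFunction_of_eq_zero {v : Plane → ℝ} (hv : ContDiff ℝ ∞ v) {K : Set Plane}
    (hK : IsClosed K) (hKΩ : K ⊆ unitSquare) (h0 : ∀ p, p ∉ K → v p = 0) :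
    IsTestFunction unitSquare v := by
  have hsub : tsupport v ⊆ K := by
    refine closure_minimal (fun p hp => ?_) hK
    by_contra h
    exact hp (h0 p h)
  refine ⟨hv, ?_, hsub.trans hKΩ⟩
  exact Metric.isCompact_of_isClosed_isBounded (isClosed_tsupport v)
    (isBounded_unitSquare.subset (hsub.trans hKΩ))

section Residual

variable {𝒯 : Triangulation unitSquare} {f u uh v : Plane → ℝ} {G : Plane → Plane}

lemma volume_hull_ne_top (t : Finset Plane) : volume (hull t) ≠ ⊤ :=
  (isCompact_hull t).measure_lt_top.ne

lemma restrict_hull_le {t : Finset Plane} (ht : t ∈ 𝒯.elements) :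
    volume.restrict (hull t) ≤ volume.restrict unitSquare := by
  rw [Measure.restrict_congr_set ae_eq_closure_unitSquare]
  exact Measure.restrict_mono (𝒯.subset_closure_of_mem_elements ht) le_rfl

/-- Essential bounds of real functions are meaningful only in the presence of boundedness, which f ∈
L_∞ provides on each element. -/
lemma ae_abs_sub_essInf_le (hf : MemLp f ⊤ (volume.restrict unitSquare)) {t : Finset Plane}
    (ht : t ∈ 𝒯.elements) :
    ∀ᵐ p ∂volume.restrict (hull t), |f p - essInf f (volume.restrict (hull t))| ≤
      osc f (hull t) := by
  have hf' := hf.mono_measure (restrict_hull_le ht)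
  have hb : ∀ᵐ p ∂volume.restrict (hull t), ‖f p‖ ≤
      (eLpNormEssSup f (volume.restrict (hull t))).toReal := by
    have h1 := ae_le_eLpNormEssSup (f := f) (μ := volume.restrict (hull t))
    have h2 : eLpNormEssSup f (volume.restrict (hull t)) ≠ ⊤ := by
      have := hf'.2; rw [eLpNorm_exponent_top] at this; exact this.ne
    filter_upwards [h1] with p hp
    rw [← toReal_enorm]
    exact ENNReal.toReal_mono h2 hp
  have hup : IsBoundedUnder (· ≤ ·) (ae (volume.restrict (hull t))) f :=
    ⟨_, eventually_map.2 (hb.mono fun p hp => (abs_le.1 hp).2)⟩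
  have hlo : IsBoundedUnder (· ≥ ·) (ae (volume.restrict (hull t))) f :=
    ⟨_, eventually_map.2 (hb.mono fun p hp => (abs_le.1 hp).1)⟩
  filter_upwards [ae_le_essSup hup, ae_essInf_le hlo] with p h1 h2
  rw [abs_of_nonneg (sub_nonneg.2 h2), osc]
  exact sub_le_sub_right h1 _

/-- The weak form of the Poisson equation, tested with a function of mean zero on the elements. -/
lemma abs_sum_inner_gradient_le (hf : MemLp f ⊤ (volume.restrict unitSquare))
    (hu : IsWeakSolution unitSquare f u G) (hv : IsTestFunction unitSquare v)
    {D : Finset (Finset Plane)} (hD : D ⊆ 𝒯.elements)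
    (h0 : ∀ t ∈ 𝒯.elements, t ∉ D → ∀ p ∈ interior (hull t), v p = 0)
    (hmean : ∀ t ∈ D, ∫ p in hull t, v p = 0) {a : Finset Plane → ℝ}
    (ha : ∀ t ∈ D, ∀ p ∈ hull t, ‖gradient v p‖ ≤ a t)
    (hav : ∀ t ∈ D, ∀ p ∈ hull t, |v p| ≤ Metric.diam (hull t) * a t) :
    |∑ t ∈ D, ∫ p in hull t, ⟪elementGradient uh t, gradient v p⟫| ≤
      ∑ t ∈ D, a t * √(2 * area (hull t) * localError f uh G t) := by
  have hvc : Continuous v := hv.1.continuous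
  have hgc : Continuous (gradient v) :=
    (InnerProductSpace.toDual ℝ Plane).symm.continuous.comp (hv.1.continuous_fderiv (by simp))
  have : IsFiniteMeasure (volume.restrict (unitSquare : Set Plane)) :=
    ⟨by rw [Measure.restrict_apply_univ]; exact isBounded_unitSquare.measure_lt_top⟩
  have hGi : IntegrableOn G unitSquare := hu.1.2.1.integrable (by norm_num)
  have hfi : IntegrableOn f unitSquare := hf.integrable le_top
  obtain ⟨B₁, hB₁⟩ := hv.2.1.exists_bound_of_continuous hvc
  have hgsupp : HasCompactSupport (gradient v) := by
    refine hv.2.1.fderiv (𝕜 := ℝ) |>.comp_left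
      (g := (InnerProductSpace.toDual ℝ Plane).symm) (map_zero _)
  obtain ⟨B₂, hB₂⟩ := hgsupp.exists_bound_of_continuous hgc
  have hGv : IntegrableOn (fun p => ⟪G p, gradient v p⟫) unitSquare := by
    refine Integrable.mono' (hGi.norm.mul_const B₂)
      (hGi.aestronglyMeasurable.inner hgc.aestronglyMeasurable) (ae_of_all _ fun p => ?_)
    exact (norm_inner_le_norm _ _).trans
      (mul_le_mul_of_nonneg_left (hB₂ p) (norm_nonneg _))
  have hfv : IntegrableOn (fun p => f p * v p) unitSquare :=
    Integrable.mul_bdd (c := B₁) hfi hvc.aestronglyMeasurable (ae_of_all _ hB₁)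
  have hsum {F : Plane → ℝ} (hF : IntegrableOn F unitSquare)
      (hz : ∀ t ∈ 𝒯.elements, t ∉ D → ∀ p ∈ interior (hull t), F p = 0) :
      ∫ p in unitSquare, F p = ∑ t ∈ D, ∫ p in hull t, F p := by
    rw [𝒯.setIntegral_eq_sum hF]
    refine (Finset.sum_subset hD fun t ht htD => ?_).symm
    rw [integral_congr_ae ((ae_mem_interior_hull t).mono fun p hp => hz t ht htD p hp)]
    simp
  have hgz : ∀ t ∈ 𝒯.elements, t ∉ D → ∀ p ∈ interior (hull t), gradient v p = 0 := by
    intro t ht htD p hp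
    have : v =ᶠ[𝓝 p] fun _ => 0 := by
      filter_upwards [isOpen_interior.mem_nhds hp] with q hq using h0 t ht htD q hq
    rw [this.gradient_eq, gradient_fun_const]
  have e1 := hu.2 v hv
  rw [hsum hGv fun t ht htD p hp => by rw [hgz t ht htD p hp, inner_zero_right],
    hsum hfv fun t ht htD p hp => by rw [h0 t ht htD p hp, mul_zero]] at e1
  -- The weak equation is inserted in the form 0 = -∑∫ G·∇v + ∑∫ f v, so that the discrete gradient
  -- is replaced by the error.
  have e2 : ∑ t ∈ D, ∫ p in hull t, ⟪elementGradient uh t, gradient v p⟫ =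
      ∑ t ∈ D, ((∫ p in hull t, ⟪elementGradient uh t, gradient v p⟫) -
        (∫ p in hull t, ⟪G p, gradient v p⟫) + ∫ p in hull t, f p * v p) := by
    rw [Finset.sum_add_distrib, Finset.sum_sub_distrib, e1]; ring
  rw [e2]
  refine (Finset.abs_sum_le_sum_abs _ _).trans (Finset.sum_le_sum fun t htD => ?_)
  have ht := hD htD
  have hle := restrict_hull_le ht
  have hfin := volume_hull_ne_top t
  have hne : (hull t).Nonempty := by
    have : t.Nonempty := Finset.card_pos.1 (by rw [(mem_elements.1 ht).2]; norm_num)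
    obtain ⟨q, hq⟩ := this
    exact ⟨q, subset_convexHull ℝ _ hq⟩
  have ha0 : 0 ≤ a t := by
    obtain ⟨q, hq⟩ := hne
    exact (norm_nonneg _).trans (ha t htD q hq)
  set g := elementGradient uh t
  set A := area (hull t)
  set d := Metric.diam (hull t)
  set o := osc f (hull t)
  set E := ∫ p in hull t, ‖g - G p‖ ^ 2
  have hA : 0 ≤ A := measureReal_nonneg
  have hE : 0 ≤ E := integral_nonneg fun _ => sq_nonneg _
  have hG2 : MemLp (fun p => g - G p) 2 (volume.restrict (hull t)) := by
    have : IsFiniteMeasure (volume.restrict (hull t)) :=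
      ⟨by rw [Measure.restrict_apply_univ]; exact hfin.lt_top⟩
    exact (memLp_const g).sub (hu.1.2.1.mono_measure hle)
  have hG1 : IntegrableOn (fun p => ‖g - G p‖) (hull t) := by
    have : IsFiniteMeasure (volume.restrict (hull t)) :=
      ⟨by rw [Measure.restrict_apply_univ]; exact hfin.lt_top⟩
    exact (hG2.integrable (by norm_num)).norm
  have hG1sq : IntegrableOn (fun p => ‖g - G p‖ ^ 2) (hull t) := hG2.integrable_norm_pow (by norm_num)
  have hGt : IntegrableOn (fun p => ⟪G p, gradient v p⟫) (hull t) := Integrable.mono_measure hGv hle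
  have hcg : IntegrableOn (fun p => ⟪g, gradient v p⟫) (hull t) :=
    (continuous_const.inner hgc).continuousOn.integrableOn_compact (isCompact_hull t)
  have b1 : |(∫ p in hull t, ⟪g, gradient v p⟫) - ∫ p in hull t, ⟪G p, gradient v p⟫| ≤
      a t * √(A * E) := by
    rw [← integral_sub hcg hGt]
    have : ‖∫ p in hull t, (⟪g, gradient v p⟫ - ⟪G p, gradient v p⟫)‖ ≤
        ∫ p in hull t, a t * ‖g - G p‖ := by
      refine norm_integral_le_of_norm_le (hG1.const_mul _) ?_
      rw [ae_restrict_iff' (measurableSet_hull t)]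
      refine ae_of_all _ fun p hp => ?_
      rw [← inner_sub_left, mul_comm]
      exact (norm_inner_le_norm _ _).trans (mul_le_mul_of_nonneg_left (ha t htD p hp) (norm_nonneg _))
    rw [integral_const_mul] at this
    refine this.trans (mul_le_mul_of_nonneg_left ?_ ha0)
    exact Real.le_sqrt_of_sq_le (sq_setIntegral_le hfin hG1 hG1sq)
  have ho := ae_abs_sub_essInf_le hf ht
  set c := essInf f (volume.restrict (hull t))
  have b2 : |∫ p in hull t, f p * v p| ≤ a t * √(A * ((d * o) ^ 2 * A)) := by
    have hft : IntegrableOn (fun p => f p * v p) (hull t) := Integrable.mono_measure hfv hle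
    have hvt : IntegrableOn v (hull t) :=
      hvc.continuousOn.integrableOn_compact (isCompact_hull t)
    -- Because v has mean zero on the element, the essential infimum of f can be subtracted.
    -- Together with |v| ≤ diam(T) · a this produces the weighted oscillation.
    have e3 : ∫ p in hull t, f p * v p = ∫ p in hull t, (f p * v p - c * v p) := by
      rw [integral_sub hft (hvt.const_mul c), integral_const_mul, hmean t htD]; ring
    have hd0 : 0 ≤ d * a t := by
      obtain ⟨q, hq⟩ := hne
      exact (abs_nonneg _).trans (hav t htD q hq)
    have h3 : ‖∫ p in hull t, (f p * v p - c * v p)‖ ≤ (o * (d * a t)) * volume.real (hull t) := by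
      refine norm_setIntegral_le_of_norm_le_const_ae hfin.lt_top ?_
      filter_upwards [ho, ae_restrict_mem (measurableSet_hull t)] with p h1 hpt
      rw [← sub_mul, norm_mul]
      have h2 := hav t htD p hpt
      exact mul_le_mul h1 h2 (abs_nonneg _) ((abs_nonneg _).trans h1)
    have h4 : √(A * ((d * o) ^ 2 * A)) = |d * o| * A := by
      rw [show A * ((d * o) ^ 2 * A) = (d * o * A) ^ 2 by ring, Real.sqrt_sq_eq_abs, abs_mul,
        abs_of_nonneg hA]
    rw [e3, h4]
    refine h3.trans ?_
    have : (o * (d * a t)) * A = a t * (d * o * A) := by ring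
    change (o * (d * a t)) * A ≤ _
    rw [this]
    exact mul_le_mul_of_nonneg_left (mul_le_mul_of_nonneg_right (le_abs_self _) hA) ha0
  have hO : 0 ≤ (d * o) ^ 2 * A := mul_nonneg (sq_nonneg _) hA
  have b3 : √(A * E) + √(A * ((d * o) ^ 2 * A)) ≤ √(2 * A * (E + (d * o) ^ 2 * A)) := by
    refine Real.le_sqrt_of_sq_le ?_
    have s1 := Real.sq_sqrt (mul_nonneg hA hE)
    have s2 := Real.sq_sqrt (mul_nonneg hA hO)
    nlinarith [sq_nonneg (√(A * E) - √(A * ((d * o) ^ 2 * A)))]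
  calc _ ≤ |(∫ p in hull t, ⟪g, gradient v p⟫) - ∫ p in hull t, ⟪G p, gradient v p⟫| +
        |∫ p in hull t, f p * v p| := abs_add_le _ _
    _ ≤ a t * (√(A * E) + √(A * ((d * o) ^ 2 * A))) := by rw [mul_add]; exact add_le_add b1 b2
    _ ≤ _ := mul_le_mul_of_nonneg_left b3 ha0

end Residual

/-- The standing assumptions on the mesh, the data and the solutions. -/
structure DiscreteProblem (c₀ α M : ℝ) (𝒯 : Triangulation unitSquare) (f u uh : Plane → ℝ)
    (G : Plane → Plane) : Prop where
  angle_lt : α < Real.pi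
  one_le : 1 ≤ M
  maxAngle : 𝒯.MaxAngle α
  anisotropic : 𝒯.AllNodesAnisotropic c₀ M
  oriented : 𝒯.GlobalOrientation M
  data : MemLp f ⊤ (volume.restrict unitSquare)
  weak : IsWeakSolution unitSquare f u G
  discrete : uh ∈ 𝒯.FESpace

/-! ### The jump across one edge joining two vertical lines -/

lemma norm_gradient_shearProd_le {χ w : ℝ → ℝ} (hχ : ContDiff ℝ ∞ χ) (hw : ContDiff ℝ ∞ w)
    (e σ : ℝ) (p : Plane) : ‖gradient (shearProd χ w e σ) p‖ ≤
      |deriv χ (p 0)| * |w (p 1 - (e + σ * p 0))| +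
        (|σ| + 1) * (|χ (p 0)| * |deriv w (p 1 - (e + σ * p 0))|) := by
  have h := norm_sq_gradient_shearProd hχ hw e σ p
  set A := deriv χ (p 0) * w (p 1 - (e + σ * p 0))
  set B := χ (p 0) * deriv w (p 1 - (e + σ * p 0))
  rw [← abs_mul, ← abs_mul]
  change _ ≤ |A| + (|σ| + 1) * |B|
  have h1 : |A - σ * B| ≤ |A| + |σ| * |B| := by rw [← abs_mul]; exact abs_sub _ _
  refine abs_le_of_sq_le_sq' (a := ‖gradient (shearProd χ w e σ) p‖) ?_ (by positivity) |>.2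
  rw [h, ← sq_abs (A - σ * B), ← sq_abs B]
  nlinarith [abs_nonneg (A - σ * B), abs_nonneg B, abs_nonneg A, abs_nonneg σ,
    mul_nonneg (abs_nonneg σ) (abs_nonneg B)]

lemma setIntegral_inner_gradient_shearProd {χ w : ℝ → ℝ} (hχ : ContDiff ℝ ∞ χ)
    (hw : ContDiff ℝ ∞ w) (e σ : ℝ) (g : Plane) (t : Finset Plane) :
    ∫ p in hull t, ⟪g, gradient (shearProd χ w e σ) p⟫ =
      g 0 * ((∫ p in hull t, deriv χ (p 0) * w (p 1 - (e + σ * p 0))) -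
        σ * ∫ p in hull t, χ (p 0) * deriv w (p 1 - (e + σ * p 0))) +
      g 1 * ∫ p in hull t, χ (p 0) * deriv w (p 1 - (e + σ * p 0)) := by
  have h0c := continuous_coord 0
  have h1c := continuous_coord 1
  have hsh : Continuous fun p : Plane => p 1 - (e + σ * p 0) := by fun_prop
  have i1 : IntegrableOn (fun p : Plane => deriv χ (p 0) * w (p 1 - (e + σ * p 0))) (hull t) :=
    (((hχ.continuous_deriv (by simp)).comp h0c).mul
      (hw.continuous.comp hsh)).continuousOn.integrableOn_compact (isCompact_hull t)
  have i2 : IntegrableOn (fun p : Plane => χ (p 0) * deriv w (p 1 - (e + σ * p 0))) (hull t) :=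
    ((hχ.continuous.comp h0c).mul
      ((hw.continuous_deriv (by simp)).comp hsh)).continuousOn.integrableOn_compact
        (isCompact_hull t)
  have i3 : Integrable (fun p : Plane => deriv χ (p 0) * w (p 1 - (e + σ * p 0)) -
      σ * (χ (p 0) * deriv w (p 1 - (e + σ * p 0)))) (volume.restrict (hull t)) :=
    Integrable.sub i1 (Integrable.const_mul i2 σ)
  simp_rw [inner_gradient_shearProd hχ hw]
  rw [integral_add (i3.const_mul (g 0)) (Integrable.const_mul i2 (g 1)),
    integral_const_mul, integral_const_mul, integral_sub i1 (Integrable.const_mul i2 σ),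
    integral_const_mul]

namespace StripMesh

variable {𝒯 : Triangulation unitSquare} {n : ℕ} {x : ℕ → ℝ} (m : StripMesh 𝒯 n x)
  {s t : Finset Plane} {c₀ α M : ℝ} {f u uh : Plane → ℝ} {G : Plane → Plane}

/-- The length of the vertical section is affine across the strip, from the height to zero; over the
middle half it is at least a quarter of the height. -/
lemma height_div_four_le (ht : t ∈ 𝒯.elements) {X : ℝ}
    (h1 : x (m.strip t) + m.width t / 4 ≤ X) (h2 : X ≤ x (m.strip t) + 3 * m.width t / 4) :
    m.height t / 4 ≤ m.upAt t X - m.loAt t X := by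
  have hw := m.width_pos ht
  have h := m.tri t ht
  rw [upAt, loAt, lerp_sub, lerp_combo]
  have e : x (m.strip t + 1) - x (m.strip t) = m.width t := rfl
  rw [e]
  set θ := (X - x (m.strip t)) / m.width t
  have t1 : 1 / 4 ≤ θ := by rw [le_div_iff₀ hw]; linarith
  have t2 : θ ≤ 3 / 4 := by rw [div_le_iff₀ hw]; linarith
  have a0 := h.le 0
  have a1 := h.le 1
  simp only [height]
  nlinarith [mul_nonneg (sub_nonneg.2 a0) (sub_nonneg.2 t2),
    mul_nonneg (sub_nonneg.2 a1) (sub_nonneg.2 t1)]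

lemma upAt_le_one (ht : t ∈ 𝒯.elements) {X : ℝ}
    (hX : X ∈ Set.Icc (x (m.strip t)) (x (m.strip t + 1))) : m.upAt t X ≤ 1 := by
  have h := lerp_mono (m.tri t ht).lt hX (m.bounds ht 0).2 (m.bounds ht 1).2
  refine h.trans ?_
  rw [lerp_combo]; ring_nf; rfl

lemma loAt_nonneg (ht : t ∈ 𝒯.elements) {X : ℝ}
    (hX : X ∈ Set.Icc (x (m.strip t)) (x (m.strip t + 1))) : 0 ≤ m.loAt t X := by
  have h := lerp_mono (m.tri t ht).lt hX (m.bounds ht 0).1 (m.bounds ht 1).1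
  refine le_trans ?_ h
  rw [lerp_combo]; ring_nf; rfl

lemma height_le_mul_width (hα : α < Real.pi) (hang : 𝒯.MaxAngle α) (ht : t ∈ 𝒯.elements) :
    m.height t ≤ √(angleConst α) * m.width t := by
  have h := m.height_sq_le hα hang ht
  have h0 := (angleConst_pos α).le
  refine abs_le_of_sq_le_sq' ?_ (mul_nonneg (Real.sqrt_nonneg _) (m.width_pos ht).le) |>.2
  rwa [mul_pow, Real.sq_sqrt h0]

end StripMesh

lemma deriv_comp_div {k : ℝ → ℝ} (hk : ContDiff ℝ ∞ k) (c η z : ℝ) :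
    deriv (fun z => k ((z - c) / η)) z = deriv k ((z - c) / η) / η := by
  have := ((hk.differentiable (by simp) ((z - c) / η)).hasDerivAt).comp z
    (((hasDerivAt_id z).sub_const c).div_const η)
  rw [mul_one_div] at this
  exact this.deriv

lemma contDiff_comp_div {k : ℝ → ℝ} (hk : ContDiff ℝ ∞ k) (c η : ℝ) :
    ContDiff ℝ ∞ (fun z => k ((z - c) / η)) :=
  hk.comp ((contDiff_id.sub contDiff_const).div_const η)

namespace StripMesh

/-- The scale η of the cut-off across a long edge is an eighth of the smaller height; by
comparability it is not much less than either. -/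
lemma le_mul_min_div {hs ht M : ℝ} (hht : 0 < ht) (hM : 1 ≤ M) (hts : ht ≤ M * hs) :
    ht ≤ 8 * M * (min hs ht / 8) := by
  have h : ht ≤ M * min hs ht := by
    rcases min_choice hs ht with h | h <;> rw [h]
    · exact hts
    · exact le_mul_of_one_le_left hht.le hM
  linarith

/-- Arithmetic: square the tested inequality, replace 1/η by 8M/h, and cancel a factor H. The
constant contains |M| + 1 because it must be positive before M ≥ 1 is known. -/
lemma jump_sq_le {H β η hs ht M K δ ms mt : ℝ} (hH : 0 < H) (hβ : 0 < β) (hη : 0 < η)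
    (hht : 0 < ht) (hhs : 0 < hs) (hM : 1 ≤ M) (hms : 0 ≤ ms) (hmt : 0 ≤ mt)
    (hlow : ht ≤ 8 * M * η) (hst : hs ≤ M * ht)
    (h : H * β * |δ| ≤ K / η * √(2 * (hs * H / 2) * ms) + K / η * √(2 * (ht * H / 2) * mt)) :
    ht * H * δ ^ 2 ≤ 128 * (K ^ 2 + 1) * (|M| + 1) ^ 4 / β ^ 2 * (ms + mt) := by
  have h1 : (H * β * |δ|) ^ 2 ≤ 2 * (K / η) ^ 2 * (hs * H * ms + ht * H * mt) := by
    have s1 := Real.sq_sqrt (by positivity : 0 ≤ 2 * (hs * H / 2) * ms)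
    have s2 := Real.sq_sqrt (by positivity : 0 ≤ 2 * (ht * H / 2) * mt)
    have h2 := pow_le_pow_left₀ (by positivity) h 2
    set a := √(2 * (hs * H / 2) * ms)
    set b := √(2 * (ht * H / 2) * mt)
    calc _ ≤ _ := h2
      _ ≤ 2 * (K / η) ^ 2 * (a ^ 2 + b ^ 2) := by
        have := mul_nonneg (sq_nonneg (K / η)) (sq_nonneg (a - b))
        nlinarith
      _ = _ := by rw [s1, s2]; ring
  have h3 : (hs * H * ms + ht * H * mt) ≤ M * ht * H * (ms + mt) := by
    have e1 : hs * H * ms ≤ M * ht * H * ms := by gcongr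
    have e2 : 1 * ht * H * mt ≤ M * ht * H * mt := by gcongr
    linarith
  have h4 : (1 / η) ^ 2 ≤ (8 * M / ht) ^ 2 := by
    refine pow_le_pow_left₀ (by positivity) ?_ 2
    rw [div_le_div_iff₀ hη hht]; linarith
  have h5 : H * (H * β ^ 2 * δ ^ 2) * ht ≤ H * (128 * K ^ 2 * M ^ 3 * (ms + mt)) := by
    calc H * (H * β ^ 2 * δ ^ 2) * ht = (H * β * |δ|) ^ 2 * ht := by
          rw [mul_pow, sq_abs]; ring
      _ ≤ 2 * (K / η) ^ 2 * (M * ht * H * (ms + mt)) * ht := by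
          refine mul_le_mul_of_nonneg_right (h1.trans ?_) hht.le
          gcongr
      _ = 2 * K ^ 2 * (1 / η) ^ 2 * (M * ht * H * (ms + mt)) * ht := by ring
      _ ≤ 2 * K ^ 2 * (8 * M / ht) ^ 2 * (M * ht * H * (ms + mt)) * ht := by gcongr
      _ = H * (128 * K ^ 2 * M ^ 3 * (ms + mt)) := by field_simp; ring
  rw [mul_assoc] at h5
  have h6 := le_of_mul_le_mul_left h5 hH
  rw [div_mul_eq_mul_div, le_div_iff₀ (by positivity)]
  calc ht * H * δ ^ 2 * β ^ 2 = H * β ^ 2 * δ ^ 2 * ht := by ring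
    _ ≤ 128 * K ^ 2 * M ^ 3 * (ms + mt) := h6
    _ ≤ 128 * (K ^ 2 + 1) * (|M| + 1) ^ 4 * (ms + mt) := by
      have hM' : M ^ 3 ≤ (|M| + 1) ^ 4 := by
        rw [abs_of_pos (by linarith)]
        calc M ^ 3 ≤ (M + 1) ^ 3 := by gcongr; linarith
          _ ≤ (M + 1) ^ 4 := pow_le_pow_right₀ (by linarith) (by norm_num)
      have : K ^ 2 ≤ K ^ 2 + 1 := by linarith
      gcongr

set_option maxHeartbeats 1600000 in
/-- The estimate of the jump of the gradient across an edge that joins two vertical lines. -/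
theorem exists_jump_le (c₀ α M : ℝ) : ∃ C : ℝ, 0 < C ∧
    ∀ {𝒯 : Triangulation unitSquare} {n : ℕ} {x : ℕ → ℝ} (m : StripMesh 𝒯 n x)
      {f u uh : Plane → ℝ} {G : Plane → Plane}, DiscreteProblem c₀ α M 𝒯 f u uh G →
    ∀ {s t : Finset Plane}, s ∈ 𝒯.elements → t ∈ 𝒯.elements → m.strip s = m.strip t →
      m.lo t = m.up s →
      m.height t * m.width t * (elementGradient uh t 1 - elementGradient uh s 1) ^ 2 ≤
        C * (localError f uh G s + localError f uh G t) := by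
  obtain ⟨Ψ, hΨ, hΨ1, hΨ0, hΨm, -⟩ := exists_cutoff
  obtain ⟨b, hb, hb0, hb1, hbm⟩ := exists_bump
  -- For r ≥ 0 the factor Ψ(-r) is 1, and conversely; so this even function has vanishing integral
  -- on each half-axis and the value 1 at 0.
  set k : ℝ → ℝ := fun r => Ψ r * Ψ (-r) with hk
  have hkc : ContDiff ℝ ∞ k := hΨ.mul (hΨ.comp contDiff_neg)
  have hk1 : ∀ r, 1 ≤ |r| → k r = 0 := by
    intro r hr
    rcases le_abs.1 hr with h | h
    · simp [hk, hΨ0 r h]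
    · simp [hk, hΨ0 (-r) h]
  have hk0 : k 0 = 1 := by simp [hk, hΨ1 0 (by norm_num)]
  have hkint : ∀ c, 1 ≤ c → ∫ r in (0 : ℝ)..c, k r = 0 := by
    intro c hc
    rw [← intervalIntegral.integral_add_adjacent_intervals (b := 1)
      (hkc.continuous.intervalIntegrable _ _) (hkc.continuous.intervalIntegrable _ _)]
    have e1 : ∫ r in (0 : ℝ)..1, k r = ∫ r in (0 : ℝ)..1, Ψ r := by
      refine intervalIntegral.integral_congr fun r hr => ?_
      rw [Set.uIcc_of_le zero_le_one] at hr
      simp [hk, hΨ1 (-r) (by linarith [hr.1])]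
    have e2 : ∫ r in (1 : ℝ)..c, k r = ∫ r in (1 : ℝ)..c, (0 : ℝ) := by
      refine intervalIntegral.integral_congr fun r hr => ?_
      rw [Set.uIcc_of_le hc] at hr
      exact hk1 r (hr.1.trans (le_abs_self r))
    rw [e1, e2, hΨm]; simp
  have hkneg : ∀ r, k (-r) = k r := fun r => by simp only [hk, neg_neg, mul_comm]
  have hkint' : ∀ c, 1 ≤ c → ∫ r in (-c : ℝ)..0, k r = 0 := by
    intro c hc
    have := intervalIntegral.integral_comp_neg (a := 0) (b := c) k
    simp only [hkneg, neg_zero] at this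
    rw [← this, hkint c hc]
  obtain ⟨B₁, hB₁, hkb⟩ := exists_deriv_bound hkc (a := -1) (b := 1) (c := 0) (d := 0)
    (fun r hr => hk1 r (le_abs.2 (Or.inr (by linarith)))) (fun r hr => hk1 r (le_abs.2 (Or.inl hr)))
  obtain ⟨B₂, hB₂, hbb⟩ := exists_deriv_bound hb hb0 hb1
  set β := ∫ r in (0 : ℝ)..1, b r with hβ
  set c₂ := √(angleConst α) with hc₂
  -- K/η bounds |∇v|: the summand c₂ comes from the x-derivative of χ, turned from 1/H into c₂/η,
  -- and M²/2 · c₂ + 1 from the slope of the edge and the derivative across it.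
  set K := B₂ * B₁ * (c₂ + (M ^ 2 / 2 * c₂ + 1)) with hK
  have hc₂0 : 0 ≤ c₂ := Real.sqrt_nonneg _
  refine ⟨128 * (K ^ 2 + 1) * (|M| + 1) ^ 4 / β ^ 2, by positivity, ?_⟩
  intro 𝒯 n x m f u uh G P s t hs ht hst hlu
  have hM := P.one_le
  have hS := m.tri s hs
  have hT : StripTriangle t (x (m.strip s)) (x (m.strip s + 1)) (m.lo t) (m.up t) :=
    hst ▸ m.tri t ht
  have hws := m.width_pos hs
  have hwt : m.width t = m.width s := by simp only [width, hst]
  have hhs := m.height_pos hs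
  have hht := m.height_pos ht
  set H := m.width s with hH
  set X₀ := x (m.strip s) with hX₀
  set X₁ := x (m.strip s + 1) with hX₁
  have hX : X₁ - X₀ = H := rfl
  -- Over the middle half of the strip both sections have length at least 2η, so the cut-off region
  -- around the edge stays strictly inside s ∪ t.
  set η := min (m.height s) (m.height t) / 8 with hη
  have hη0 : 0 < η := by have := lt_min hhs hht; simp only [hη]; linarith
  have hηs : η ≤ m.height s / 8 := by
    have := min_le_left (m.height s) (m.height t); simp only [hη]; linarith
  have hηt : η ≤ m.height t / 8 := by
    have := min_le_right (m.height s) (m.height t); simp only [hη]; linarith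
  set σ := (m.up s 1 - m.up s 0) / H with hσ
  set e := m.up s 0 - σ * X₀ with he
  have hline : ∀ X, m.upAt s X = e + σ * X := by
    intro X
    have := lerp_affine X₀ X₁ (m.up s 0) (m.up s 1) X₀ X
    rw [lerp_left, hX] at this
    change lerp X₀ X₁ (m.up s 0) (m.up s 1) X = _
    rw [this]; simp only [he, hσ]; ring
  have hline' : ∀ X, m.loAt t X = e + σ * X := by
    intro X
    rw [← hline]; simp only [loAt, upAt, hlu, hst]
  set χ : ℝ → ℝ := fun X => b ((X - X₀) / H) with hχ
  set w : ℝ → ℝ := fun z => k ((z - 0) / η) with hw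
  have hχc : ContDiff ℝ ∞ χ := contDiff_comp_div hb X₀ H
  have hwc : ContDiff ℝ ∞ w := contDiff_comp_div hkc 0 η
  have hχ0 : ∀ X, X ∉ Set.Icc (X₀ + H / 4) (X₀ + 3 * H / 4) → χ X = 0 := by
    intro X hX'
    rw [Set.mem_Icc, not_and_or, not_le, not_le] at hX'
    rcases hX' with h | h
    · exact hb0 _ (by rw [div_le_iff₀ hws]; linarith)
    · exact hb1 _ (by rw [le_div_iff₀ hws]; linarith)
  have hw0 : ∀ z, η ≤ |z| → w z = 0 := by
    intro z hz
    refine hk1 _ ?_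
    rw [sub_zero, abs_div, abs_of_pos hη0, le_div_iff₀ hη0, one_mul]; exact hz
  have hw00 : w 0 = 1 := by simp only [hw, sub_zero, zero_div, hk0]
  have hgt : ∀ X ∈ Set.Icc (X₀ + H / 4) (X₀ + 3 * H / 4), 2 * η ≤ m.upAt t X - (e + σ * X) := by
    intro X hX'
    have := m.height_div_four_le ht (X := X) (by rw [← hst, hwt]; exact hX'.1)
      (by rw [← hst, hwt]; exact hX'.2)
    rw [hline'] at this; linarith
  have hgs : ∀ X ∈ Set.Icc (X₀ + H / 4) (X₀ + 3 * H / 4), m.loAt s X - (e + σ * X) ≤ -(2 * η) := by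
    intro X hX'
    have := m.height_div_four_le hs (X := X) hX'.1 hX'.2
    rw [hline] at this; linarith
  have hsub : ∀ X ∈ Set.Icc (X₀ + H / 4) (X₀ + 3 * H / 4), X ∈ Set.Icc X₀ X₁ := fun X hX' =>
    ⟨by linarith [hX'.1], by linarith [hX'.2]⟩
  have hr₀ : X₀ + H / 4 ∈ Set.Icc (X₀ + H / 4) (X₀ + 3 * H / 4) := ⟨le_rfl, by linarith⟩
  have hχint : ∫ X in X₀..X₁, χ X = H * β := by
    have e1 := intervalIntegral.integral_comp_div (a := X₀ - X₀) (b := X₁ - X₀) b hws.ne'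
    rw [sub_self, hX, zero_div, div_self hws.ne', smul_eq_mul] at e1
    rw [← e1]
    have e2 := intervalIntegral.integral_comp_sub_right (a := X₀) (b := X₁) (fun X => b (X / H)) X₀
    rw [sub_self, hX] at e2
    exact e2
  have hwint : ∀ c c', ∫ z in c..c', w z = η * ∫ r in (c / η)..(c' / η), k r := by
    intro c c'
    have e1 := intervalIntegral.integral_comp_div (a := c) (b := c') k hη0.ne'
    rw [smul_eq_mul] at e1
    rw [← e1]; simp only [hw, sub_zero]
  have hχX₀ : χ X₀ = 0 := hχ0 _ fun h => by linarith [h.1]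
  have hχX₁ : χ X₁ = 0 := hχ0 _ fun h => by linarith [h.2]
  obtain ⟨t1, t2, t3⟩ := hT.integrals_shearProd hχc hwc e σ (r₀ := X₀ + H / 4)
    (r₁ := X₀ + 3 * H / 4) (wu := 0) (wl := 1) (fun X _ h => hχ0 X h)
    (fun X hX' => hw0 _ (by
      have := hgt X hX'; simp only [upAt, ← hst] at this
      exact le_trans (by linarith) (le_abs_self _)))
    (fun X _ => by
      have := hline' X; simp only [loAt, ← hst] at this
      rw [this, sub_self, hw00])
  obtain ⟨s1, s2, s3⟩ := hS.integrals_shearProd hχc hwc e σ (r₀ := X₀ + H / 4)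
    (r₁ := X₀ + 3 * H / 4) (wu := 1) (wl := 0) (fun X _ h => hχ0 X h)
    (fun X _ => by
      have := hline X; simp only [upAt] at this
      rw [this, sub_self, hw00])
    (fun X hX' => hw0 _ (by
      have := hgs X hX'; simp only [loAt] at this
      exact le_trans (by linarith) (neg_le_abs _)))
  beta_reduce at t2 t3 s2 s3
  -- The shear follows the common edge and w vanishes on the other slanted sides, so the constant κ
  -- is zero on both triangles.
  have hlo01 : (m.lo t 1 - m.lo t 0) / (X₁ - X₀) = σ := by rw [hlu, hX]
  have hup01 : (m.up s 1 - m.up s 0) / (X₁ - X₀) = σ := rfl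
  rw [hlo01, hχX₀, hχX₁] at t2
  rw [hup01, hχX₀, hχX₁] at s2
  rw [hlo01] at t3
  rw [hup01] at s3
  -- A section of t starts on the edge and reaches beyond the support of the cut-off, so it sees the
  -- whole half-axis integral, which is zero. This makes the mean of v on t vanish.
  have At : ∫ y in (lerp X₀ X₁ (m.lo t 0) (m.lo t 1) (X₀ + H / 4) - (e + σ * (X₀ + H / 4)))..
      (lerp X₀ X₁ (m.up t 0) (m.up t 1) (X₀ + H / 4) - (e + σ * (X₀ + H / 4))), w y = 0 := by
    have h1 := hline' (X₀ + H / 4)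
    have h2 := hgt _ hr₀
    simp only [loAt, upAt, ← hst] at h1 h2
    rw [h1, sub_self, hwint, zero_div, hkint _ (by rw [le_div_iff₀ hη0]; linarith), mul_zero]
  have As : ∫ y in (lerp X₀ X₁ (m.lo s 0) (m.lo s 1) (X₀ + H / 4) - (e + σ * (X₀ + H / 4)))..
      (lerp X₀ X₁ (m.up s 0) (m.up s 1) (X₀ + H / 4) - (e + σ * (X₀ + H / 4))), w y = 0 := by
    have h1 := hline (X₀ + H / 4)
    have h2 := hgs _ hr₀
    simp only [loAt, upAt] at h1 h2
    have h3 := hkint' (-((lerp X₀ X₁ (m.lo s 0) (m.lo s 1) (X₀ + H / 4) -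
      (e + σ * (X₀ + H / 4))) / η)) (by rw [← neg_div, le_div_iff₀ hη0]; linarith)
    rw [neg_neg] at h3
    rw [h1, sub_self, hwint, zero_div, h3, mul_zero]
  rw [At] at t3
  rw [As] at s3
  set v := shearProd χ w e σ with hv
  have hvc : ContDiff ℝ ∞ v := contDiff_shearProd hχc hwc e σ
  have hvt : ∫ p in hull t, v p = 0 := by
    change ∫ p in hull t, χ (p 0) * w (p 1 - (e + σ * p 0)) = 0
    rw [t3]; ring
  have hvs : ∫ p in hull s, v p = 0 := by
    change ∫ p in hull s, χ (p 0) * w (p 1 - (e + σ * p 0)) = 0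
    rw [s3]; ring
  have gt := setIntegral_inner_gradient_shearProd hχc hwc e σ (elementGradient uh t) t
  have gs := setIntegral_inner_gradient_shearProd hχc hwc e σ (elementGradient uh s) s
  rw [t1, t2, hχint] at gt
  rw [s1, s2, hχint] at gs
  have hvK : ∀ p, ¬ (p 0 ∈ Set.Icc (X₀ + H / 4) (X₀ + 3 * H / 4) ∧
      |p 1 - (e + σ * p 0)| ≤ η) → v p = 0 := by
    intro p hp
    rw [not_and_or, not_le] at hp
    simp only [hv, shearProd]
    rcases hp with h | h
    · rw [hχ0 _ h, zero_mul]
    · rw [hw0 _ h.le, mul_zero]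
  have hst' : s ≠ t := by
    rintro rfl
    have h1 := congrFun hlu 0
    have h2 := congrFun hlu 1
    simp only [height] at hhs
    linarith
  have htest : IsTestFunction unitSquare v := by
    refine isTestFunction_of_eq_zero hvc (K := {p | p 0 ∈ Set.Icc (X₀ + H / 4) (X₀ + 3 * H / 4) ∧
      |p 1 - (e + σ * p 0)| ≤ η}) ?_ ?_ hvK
    · have h0c := continuous_coord 0
      have h1c := continuous_coord 1
      exact (isClosed_Icc.preimage h0c).inter (isClosed_le
        (h1c.sub (continuous_const.add (continuous_const.mul h0c))).abs continuous_const)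
    · rintro p ⟨hp, hp'⟩
      rw [abs_le] at hp'
      have h1 := hgt _ hp
      have h2 := hgs _ hp
      have h3 := m.upAt_le_one ht (X := p 0) (by rw [← hst]; exact hsub _ hp)
      have h4 := m.loAt_nonneg hs (X := p 0) (hsub _ hp)
      rw [← pt_eta p]
      exact m.mem_unitSquare_mid (m.strip_lt s hs) (by linarith [hp.1]) (by linarith [hp.2])
        (by linarith) (by linarith)
  have hvanish : ∀ r ∈ 𝒯.elements, r ∉ ({s, t} : Finset (Finset Plane)) →
      ∀ p ∈ interior (hull r), v p = 0 := by
    intro r hr hrst p hp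
    rw [Finset.mem_insert, Finset.mem_singleton, not_or] at hrst
    by_contra hne
    obtain ⟨hpI, hpη⟩ := not_imp_comm.1 (hvK p) hne
    rw [abs_le] at hpη
    obtain ⟨q1, q2, q3, q4⟩ := (m.mem_hull hr).1 (interior_subset hp)
    have hks := m.strip_lt s hs
    have hkr := m.strip_lt r hr
    have hk : m.strip r = m.strip s := by
      rcases lt_trichotomy (m.strip r) (m.strip s) with h | h | h
      · have := m.x_mono (i := m.strip r + 1) (j := m.strip s) h hks.le
        linarith [hpI.1]
      · exact h
      · have := m.x_mono (i := m.strip s + 1) (j := m.strip r) h hkr.le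
        linarith [hpI.2]
    have h1 := hgt _ hpI
    have h2 := hgs _ hpI
    have hI := hsub _ hpI
    -- Another element of the strip is below s or above t, away from the support; between s and t
    -- there is no room, as they share a side.
    rcases m.ordered hs hr hk.symm (Ne.symm hrst.1) with h3 | h3
    · rcases m.ordered ht hr (hst.symm.trans hk.symm) (Ne.symm hrst.2) with h4 | h4
      · have := h4 (p 0) (by rw [← hst]; exact hI)
        linarith
      · have h5 := h4 (p 0) (by rw [← hst]; exact hI)
        have h6 := h3 (p 0) hI
        rw [hline'] at h5
        rw [hline] at h6
        have h7 := (m.tri r hr).lerp_lt (x := p 0)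
          (by rw [hk]; exact ⟨by linarith [hpI.1], by linarith [hpI.2]⟩)
        change m.loAt r (p 0) < m.upAt r (p 0) at h7
        linarith
    · have := h3 (p 0) hI
      linarith
  have hvs1 : pt X₁ (m.up s 1) ∈ s := (m.vertex_mem hs).2.2.2
  have hvs0 : pt X₀ (m.up s 0) ∈ s := (m.vertex_mem hs).2.1
  have hvt0 : pt X₀ (m.up s 0) ∈ t := by
    have := (m.vertex_mem ht).1; rwa [hlu, ← hst] at this
  have hhH : m.height s ≤ c₂ * H := m.height_le_mul_width P.angle_lt P.maxAngle hs
  have hσle : |σ| ≤ M ^ 2 / 2 * c₂ := by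
    have h1 := m.extent_le P.anisotropic P.oriented (by linarith) hs hs hvs1 hvs1
      (subset_convexHull ℝ _ hvs1) (subset_convexHull ℝ _ hvs0)
    rw [pt_one, pt_one] at h1
    rw [hσ, abs_div, abs_of_pos hws, div_le_iff₀ hws]
    rw [mul_assoc]
    exact h1.trans (mul_le_mul_of_nonneg_left hhH (by positivity))
  -- The height of s is at most c₂H, so derivatives along the strip are no larger than those across
  -- the edge.
  have hHη : 1 / H ≤ c₂ / η := by
    rw [div_le_div_iff₀ hws hη0]; linarith
  have hB : 0 < B₂ * B₁ := by positivity
  have hKB : B₂ * B₁ ≤ K := by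
    have h1 : 0 ≤ M ^ 2 / 2 * c₂ := by positivity
    rw [hK]; nlinarith
  have hgrad : ∀ p, ‖gradient v p‖ ≤ K / η := by
    intro p
    refine (norm_gradient_shearProd_le hχc hwc e σ p).trans ?_
    have d1 : |deriv χ (p 0)| ≤ B₂ / H := by
      rw [hχ, deriv_comp_div hb, abs_div, abs_of_pos hws]
      exact div_le_div_of_nonneg_right (hbb _).2 hws.le
    have d2 : |deriv w (p 1 - (e + σ * p 0))| ≤ B₁ / η := by
      rw [hw, deriv_comp_div hkc, abs_div, abs_of_pos hη0]
      exact div_le_div_of_nonneg_right (hkb _).2 hη0.le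
    have d3 : |w (p 1 - (e + σ * p 0))| ≤ B₁ := (hkb _).1
    have d4 : |χ (p 0)| ≤ B₂ := (hbb _).1
    calc _ ≤ B₂ / H * B₁ + (M ^ 2 / 2 * c₂ + 1) * (B₂ * (B₁ / η)) := by gcongr
      _ = B₂ * B₁ * (1 / H) + B₂ * B₁ * (M ^ 2 / 2 * c₂ + 1) / η := by ring
      _ ≤ B₂ * B₁ * (c₂ / η) + B₂ * B₁ * (M ^ 2 / 2 * c₂ + 1) / η := by gcongr
      _ = K / η := by rw [hK]; ring
  have hvle : ∀ p, |v p| ≤ B₂ * B₁ := by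
    intro p
    rw [hv, shearProd, abs_mul]
    exact mul_le_mul (hbb _).1 (hkb _).1 (abs_nonneg _) hB₂.le
  have hdiam : ∀ r ∈ 𝒯.elements, η ≤ m.height r → ∀ p, |v p| ≤ Metric.diam (hull r) * (K / η) := by
    intro r hr hηr p
    have h1 := (m.tri r hr).height_le_diam
    change m.height r ≤ _ at h1
    refine (hvle p).trans (hKB.trans ?_)
    rw [mul_div_assoc', le_div_iff₀ hη0, mul_comm]
    exact mul_le_mul_of_nonneg_right (hηr.trans h1) (hB.le.trans hKB)
  have key := abs_sum_inner_gradient_le (uh := uh) P.data P.weak htest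
    (D := {s, t}) (by
      intro r hr
      rw [Finset.mem_insert, Finset.mem_singleton] at hr
      rcases hr with rfl | rfl <;> assumption) hvanish
    (by
      intro r hr
      rw [Finset.mem_insert, Finset.mem_singleton] at hr
      rcases hr with rfl | rfl <;> assumption) (a := fun _ => K / η)
    (fun r _ p _ => hgrad p)
    (by
      intro r hr p _
      rw [Finset.mem_insert, Finset.mem_singleton] at hr
      rcases hr with rfl | rfl
      · exact hdiam _ hs (by linarith) p
      · exact hdiam _ ht (by linarith) p)
  rw [Finset.sum_pair hst', Finset.sum_pair hst', gt, gs, m.area_hull hs, m.area_hull ht, hwt,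
    ← hH] at key
  have hgj := m.gradient_jump P.discrete ht hs hst.symm hlu
  set ms := localError f uh G s
  set mt := localError f uh G t
  have hms : 0 ≤ ms := localError_nonneg _ _ _ _
  have hmt : 0 ≤ mt := localError_nonneg _ _ _ _
  set δ := elementGradient uh t 1 - elementGradient uh s 1 with hδ
  have hδ0 : elementGradient uh t 0 - elementGradient uh s 0 = -(σ * δ) := by
    have : σ * H = m.up s 1 - m.up s 0 := by rw [hσ]; field_simp
    rw [← this] at hgj
    have h2 : H * (elementGradient uh t 0 - elementGradient uh s 0 + σ * δ) = 0 := by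
      rw [← hgj]; simp only [hδ, ← hH]; ring
    rcases mul_eq_zero.1 h2 with h | h
    · exact absurd h hws.ne'
    · linarith
  -- The two triangles contribute Hβ(σδ₀ - δ), where δ₀ and δ are the jumps of the partial
  -- derivatives. Continuity gives δ₀ = -σδ, so no cancellation can occur.
  have hcomb : |H * β * (1 + σ ^ 2) * δ| ≤ K / η * √(2 * (m.height s * H / 2) * ms) +
      K / η * √(2 * (m.height t * H / 2) * mt) := by
    refine le_of_eq_of_le ?_ key
    rw [← abs_neg]
    congr 1
    have : elementGradient uh t 0 = elementGradient uh s 0 - σ * δ := by linarith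
    rw [this]; simp only [hδ]; ring
  have hlow : H * β * |δ| ≤ |H * β * (1 + σ ^ 2) * δ| := by
    rw [abs_mul, abs_of_pos (by positivity : 0 < H * β * (1 + σ ^ 2))]
    refine mul_le_mul_of_nonneg_right ?_ (abs_nonneg _)
    have : 0 ≤ H * β * σ ^ 2 := by positivity
    linarith
  have hts : m.height s ≤ M * m.height t := by
    have := area_le P.anisotropic hs ht hvs0 hvt0
    rw [m.area_hull hs, m.area_hull ht, hwt, ← hH] at this
    refine le_of_mul_le_mul_right ?_ hws
    linarith
  have hst2 : m.height t ≤ M * m.height s := by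
    have := area_le P.anisotropic ht hs hvt0 hvs0
    rw [m.area_hull hs, m.area_hull ht, hwt, ← hH] at this
    refine le_of_mul_le_mul_right ?_ hws
    linarith
  have hηlow : m.height t ≤ 8 * M * η := le_mul_min_div hht hM hst2
  rw [hwt]
  exact jump_sq_le hws hbm hη0 hht hhs hM hms hmt hηlow hts (hlow.trans hcomb)

end StripMesh

/-! ### Summation by parts in a strip and jumps at its nodes -/

namespace StripMesh

variable {𝒯 : Triangulation unitSquare} {n : ℕ} {x : ℕ → ℝ} (m : StripMesh 𝒯 n x)
  {s t : Finset Plane} {c₀ α M : ℝ} {f u uh : Plane → ℝ} {G : Plane → Plane}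

/-- The elements in the `k`-th strip. -/
def inStrip (k : ℕ) : Finset (Finset Plane) := {t ∈ 𝒯.elements | m.strip t = k}

lemma mem_inStrip {k : ℕ} : t ∈ m.inStrip k ↔ t ∈ 𝒯.elements ∧ m.strip t = k := by
  simp [inStrip]

open Classical in
/-- The elements in the `k`-th strip but the topmost one. -/
def belowTop (k : ℕ) : Finset (Finset Plane) :=
  {t ∈ m.inStrip k | ¬ (m.up t 0 = 1 ∧ m.up t 1 = 1)}

/-- Summation by parts over the elements in a strip, ordered from bottom to top. -/
lemma exists_next (k : ℕ) : ∃ nxt : Finset Plane → Finset Plane,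
    (∀ r ∈ m.belowTop k, nxt r ∈ m.inStrip k ∧ m.lo (nxt r) = m.up r) ∧
    (Set.InjOn nxt (m.belowTop k)) ∧
    ∀ φ : Finset Plane → ℝ, ∀ d : (Fin 2 → ℝ) → ℝ,
      (∀ t ∈ m.inStrip k, m.up t 0 = 1 ∧ m.up t 1 = 1 → φ t = 0) →
      (∀ t ∈ m.inStrip k, m.lo t 0 = 0 ∧ m.lo t 1 = 0 → φ t = 0) →
      ∑ t ∈ m.inStrip k, φ t * (d (m.lo t) - d (m.up t)) =
        ∑ t ∈ m.belowTop k, (φ (nxt t) - φ t) * d (m.up t) := by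
  classical
  have hex : ∀ r ∈ m.belowTop k, ∃ s, s ∈ m.inStrip k ∧ m.lo s = m.up r := by
    intro r hr
    obtain ⟨h1, h2⟩ := Finset.mem_filter.1 hr
    obtain ⟨h3, h4⟩ := m.mem_inStrip.1 h1
    obtain ⟨s, hs, hs1, hs2⟩ := m.exists_above h3 h2
    exact ⟨s, m.mem_inStrip.2 ⟨hs, hs1.trans h4⟩, hs2⟩
  choose! nxt hn1 hn2 using hex
  have hinj : Set.InjOn nxt (m.belowTop k) := by
    intro r hr r' hr' h
    have h1 := m.mem_inStrip.1 (Finset.mem_filter.1 hr).1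
    have h2 := m.mem_inStrip.1 (Finset.mem_filter.1 hr').1
    refine m.eq_of_up_eq h1.1 h2.1 (h1.2.trans h2.2.symm) ?_
    rw [← hn2 r hr, ← hn2 r' hr', h]
  refine ⟨nxt, fun r hr => ⟨hn1 r hr, hn2 r hr⟩, hinj, ?_⟩
  intro φ d htop hbot
  have e1 : ∑ t ∈ m.inStrip k, φ t * d (m.up t) = ∑ t ∈ m.belowTop k, φ t * d (m.up t) := by
    refine (Finset.sum_subset (Finset.filter_subset _ _) fun r hr hr' => ?_).symm
    have : m.up r 0 = 1 ∧ m.up r 1 = 1 := by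
      by_contra h; exact hr' (Finset.mem_filter.2 ⟨hr, h⟩)
    rw [htop r hr this, zero_mul]
  -- Index shift: every element but the bottom one is the successor of exactly one element, and φ
  -- vanishes at the bottom.
  have e2 : ∑ t ∈ m.inStrip k, φ t * d (m.lo t) =
      ∑ t ∈ m.belowTop k, φ (nxt t) * d (m.up t) := by
    have e3 : ∑ t ∈ m.belowTop k, φ (nxt t) * d (m.up t) =
        ∑ t ∈ (m.belowTop k).image nxt, φ t * d (m.lo t) := by
      rw [Finset.sum_image hinj]
      exact Finset.sum_congr rfl fun r hr => by rw [hn2 r hr]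
    rw [e3]
    refine (Finset.sum_subset (fun r hr => ?_) fun s hs hs' => ?_).symm
    · obtain ⟨q, hq, rfl⟩ := Finset.mem_image.1 hr
      exact hn1 q hq
    · have hb : m.lo s 0 = 0 ∧ m.lo s 1 = 0 := by
        by_contra h
        obtain ⟨hs1, hs2⟩ := m.mem_inStrip.1 hs
        obtain ⟨r, hr, hr1, hr2⟩ := m.exists_below hs1 h
        have hrb : r ∈ m.belowTop k := by
          refine Finset.mem_filter.2 ⟨m.mem_inStrip.2 ⟨hr, hr1.trans hs2⟩, ?_⟩
          rw [hr2]
          rintro ⟨h1, h2⟩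
          have h3 := m.height_pos hs1
          have h4 := (m.bounds hs1 0).2
          have h5 := (m.bounds hs1 1).2
          simp only [height] at h3
          linarith
        refine hs' (Finset.mem_image.2 ⟨r, hrb, ?_⟩)
        have h1 := m.mem_inStrip.1 (hn1 r hrb)
        exact m.eq_of_lo_eq h1.1 hs1 (h1.2.trans hs2.symm) ((hn2 r hrb).trans hr2)
      rw [hbot s hs hb, zero_mul]
  simp_rw [mul_sub, sub_mul]
  rw [Finset.sum_sub_distrib, Finset.sum_sub_distrib, e1, e2]

/-- The node at height `z` on the vertical line at the side `b` of the `k`-th strip. -/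
def sideNode (x : ℕ → ℝ) (k : ℕ) (b : Fin 2) (z : ℝ) : Plane := pt (x (k + b)) z

lemma sideNode_lo_mem (ht : t ∈ 𝒯.elements) (b : Fin 2) :
    sideNode x (m.strip t) b (m.lo t b) ∈ t := by
  fin_cases b
  · exact (m.vertex_mem ht).1
  · exact (m.vertex_mem ht).2.2.1

lemma sideNode_up_mem (ht : t ∈ 𝒯.elements) (b : Fin 2) :
    sideNode x (m.strip t) b (m.up t b) ∈ t := by
  fin_cases b
  · exact (m.vertex_mem ht).2.1
  · exact (m.vertex_mem ht).2.2.2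

/-- The jump at height `z` of the `x`-derivative along a side of the `k`-th strip. -/
def sideJump (v : Plane → ℝ) (k : ℕ) (b : Fin 2) (z : ℝ) : ℝ :=
  ∑ t ∈ m.inStrip k, elementGradient v t 0 *
    ((if m.lo t b = z then 1 else 0) - if m.up t b = z then 1 else 0)

open Classical in
/-- The squared local errors near a node. -/
def nodeError (f uh : Plane → ℝ) (G : Plane → Plane) (k : ℕ) (z : Plane) : ℝ :=
  ∑ t ∈ {t ∈ m.inStrip k | z ∈ t}, localError f uh G t

/-- The nodal jump is the sum of the jumps of ∂_x u_h across the long edges of the strip that end at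
the node, at most M in number. Continuity expresses each as slope times the jump of ∂_y u_h,
controlled by `exists_jump_le`; the squared slope supplies the gain (h/H)². The height may be that
of any element at the node, in either strip. -/
theorem exists_sideJump_sq_le (c₀ α M : ℝ) : ∃ C : ℝ, 0 < C ∧
    ∀ {𝒯 : Triangulation unitSquare} {n : ℕ} {x : ℕ → ℝ} (m : StripMesh 𝒯 n x)
      {f u uh : Plane → ℝ} {G : Plane → Plane}, DiscreteProblem c₀ α M 𝒯 f u uh G →
    ∀ {k : ℕ} (b : Fin 2) (z : ℝ) {t : Finset Plane}, k < n → t ∈ 𝒯.elements →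
      sideNode x k b z ∈ t →
      (x (k + 1) - x k) ^ 3 * m.sideJump uh k b z ^ 2 ≤
        C * m.height t * m.nodeError f uh G k (sideNode x k b z) := by
  classical
  obtain ⟨C, hC, hjump⟩ := exists_jump_le c₀ α M
  refine ⟨2 * C * (|M| + 1) ^ 7, by positivity, ?_⟩
  intro 𝒯 n x m f u uh G P k b z t hk ht hz
  have hM := P.one_le
  obtain ⟨nxt, hn, hinj, hsum⟩ := m.exists_next k
  set H := x (k + 1) - x k with hH
  have hHpos : 0 < H := sub_pos.2 (m.x_lt k hk)
  have hw : ∀ r ∈ m.inStrip k, m.width r = H := fun r hr => by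
    simp only [width, (m.mem_inStrip.1 hr).2, hH]
  set g : Finset Plane → Plane := elementGradient uh
  -- Summation by parts with φ = ∂_x u_h and d the indicator of the ordinate z on the side b; the
  -- boundary condition disposes of the top and bottom terms.
  have e1 : m.sideJump uh k b z = ∑ r ∈ m.belowTop k, (g (nxt r) 0 - g r 0) *
      (if m.up r b = z then 1 else 0) :=
    hsum (fun t => g t 0) (fun y => if y b = z then 1 else 0)
      (fun r hr h => m.gradient_zero_of_top P.discrete (m.mem_inStrip.1 hr).1 h)
      (fun r hr h => m.gradient_zero_of_bot P.discrete (m.mem_inStrip.1 hr).1 h)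
  set B := {r ∈ m.belowTop k | m.up r b = z} with hB
  have e2 : m.sideJump uh k b z = ∑ r ∈ B, (g (nxt r) 0 - g r 0) := by
    rw [e1, hB, Finset.sum_filter]
    exact Finset.sum_congr rfl fun r _ => by split_ifs <;> simp
  have hBm : ∀ r ∈ B, r ∈ m.inStrip k ∧ r ∈ m.belowTop k ∧ sideNode x k b z ∈ r ∧
      sideNode x k b z ∈ nxt r := by
    intro r hr
    obtain ⟨h1, h2⟩ := Finset.mem_filter.1 hr
    have h3 := (Finset.mem_filter.1 h1).1
    have h4 := m.mem_inStrip.1 h3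
    have h5 := m.mem_inStrip.1 (hn r h1).1
    refine ⟨h3, h1, ?_, ?_⟩
    · have := m.sideNode_up_mem h4.1 b
      rwa [h2, h4.2] at this
    · have := m.sideNode_lo_mem h5.1 b
      rwa [(hn r h1).2, h2, h5.2] at this
  have hcard : (B.card : ℝ) ≤ M := by
    refine le_trans ?_ (m.card_le P.anisotropic ht hz)
    exact_mod_cast Finset.card_le_card fun r hr => by
      obtain ⟨h1, -, h2, -⟩ := hBm r hr
      exact Finset.mem_filter.2 ⟨(m.mem_inStrip.1 h1).1, h2⟩
  have hterm : ∀ r ∈ B, H ^ 3 * (g (nxt r) 0 - g r 0) ^ 2 ≤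
      C * M ^ 6 * m.height t * (localError f uh G r + localError f uh G (nxt r)) := by
    intro r hr
    obtain ⟨h1, h2, h3, h4⟩ := hBm r hr
    have hr' := m.mem_inStrip.1 h1
    have hs' := m.mem_inStrip.1 (hn r h2).1
    have hj := hjump m P hr'.1 hs'.1 (hr'.2.trans hs'.2.symm) (hn r h2).2
    have hgj := m.gradient_jump P.discrete hs'.1 hr'.1 (hs'.2.trans hr'.2.symm) (hn r h2).2
    rw [hw _ (hn r h2).1] at hj
    rw [hw _ h1] at hgj
    have hslope : |m.up r 1 - m.up r 0| ≤ M ^ 2 / 2 * m.height t := by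
      have v1 := (m.vertex_mem hr'.1).2.2.2
      have v0 := (m.vertex_mem hr'.1).2.1
      have := m.extent_le P.anisotropic P.oriented (by linarith) hr'.1 ht h3 hz
        (subset_convexHull ℝ _ v1) (subset_convexHull ℝ _ v0)
      rwa [pt_one, pt_one] at this
    have hcmp : m.height t ≤ M ^ 2 / 2 * m.height (nxt r) :=
      m.height_le P.anisotropic P.oriented (by linarith) ht hs'.1 hz h4
    have hht := m.height_pos ht
    set δ := g (nxt r) 1 - g r 1
    set δ₀ := g (nxt r) 0 - g r 0
    set E := localError f uh G r + localError f uh G (nxt r)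
    have hE : 0 ≤ E := add_nonneg (localError_nonneg _ _ _ _) (localError_nonneg _ _ _ _)
    -- Hδ₀ is minus δ times the rise of the edge, and the rise is at most M²/2 times the height.
    have q1 : (δ₀ * H) ^ 2 ≤ (M ^ 2 / 2 * m.height t) ^ 2 * δ ^ 2 := by
      have : δ₀ * H = -(δ * (m.up r 1 - m.up r 0)) := by linarith
      rw [this, neg_sq, mul_pow, mul_comm, ← sq_abs (m.up r 1 - m.up r 0)]
      gcongr
    have q2 : m.height t * H * δ ^ 2 ≤ M ^ 2 / 2 * (C * E) := by
      calc m.height t * H * δ ^ 2 ≤ M ^ 2 / 2 * m.height (nxt r) * H * δ ^ 2 := by gcongr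
        _ = M ^ 2 / 2 * (m.height (nxt r) * H * δ ^ 2) := by ring
        _ ≤ M ^ 2 / 2 * (C * E) := by gcongr
    calc H ^ 3 * δ₀ ^ 2 = H * (δ₀ * H) ^ 2 := by ring
      _ ≤ H * ((M ^ 2 / 2 * m.height t) ^ 2 * δ ^ 2) := by gcongr
      _ = M ^ 4 / 4 * m.height t * (m.height t * H * δ ^ 2) := by ring
      _ ≤ M ^ 4 / 4 * m.height t * (M ^ 2 / 2 * (C * E)) := by gcongr
      _ = C * M ^ 6 * m.height t * E * (1 / 8) := by ring
      _ ≤ C * M ^ 6 * m.height t * E * 1 := by gcongr; norm_num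
      _ = _ := mul_one _
  have hht := m.height_pos ht
  have hN : ∑ r ∈ B, (localError f uh G r + localError f uh G (nxt r)) ≤
      2 * m.nodeError f uh G k (sideNode x k b z) := by
    have i1 : ∑ r ∈ B, localError f uh G r ≤ m.nodeError f uh G k (sideNode x k b z) := by
      refine Finset.sum_le_sum_of_subset_of_nonneg (fun r hr => ?_)
        fun _ _ _ => localError_nonneg _ _ _ _
      obtain ⟨h1, -, h2, -⟩ := hBm r hr
      exact Finset.mem_filter.2 ⟨h1, h2⟩
    have i2 : ∑ r ∈ B, localError f uh G (nxt r) ≤ m.nodeError f uh G k (sideNode x k b z) := by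
      rw [← Finset.sum_image (f := fun r => localError f uh G r) (g := nxt)
        (fun r hr r' hr' h => hinj (hBm r hr).2.1 (hBm r' hr').2.1 h)]
      refine Finset.sum_le_sum_of_subset_of_nonneg (fun s hs => ?_)
        fun _ _ _ => localError_nonneg _ _ _ _
      obtain ⟨r, hr, rfl⟩ := Finset.mem_image.1 hs
      obtain ⟨-, h1, -, h2⟩ := hBm r hr
      exact Finset.mem_filter.2 ⟨(hn r h1).1, h2⟩
    rw [Finset.sum_add_distrib]; linarith
  have hcs := sq_sum_le_card_mul_sum_sq (s := B) (f := fun r => g (nxt r) 0 - g r 0)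
  have hN0 : 0 ≤ ∑ r ∈ B, (localError f uh G r + localError f uh G (nxt r)) :=
    Finset.sum_nonneg fun _ _ => add_nonneg (localError_nonneg _ _ _ _) (localError_nonneg _ _ _ _)
  rw [e2]
  calc H ^ 3 * (∑ r ∈ B, (g (nxt r) 0 - g r 0)) ^ 2
      ≤ H ^ 3 * (B.card * ∑ r ∈ B, (g (nxt r) 0 - g r 0) ^ 2) := by gcongr
    _ ≤ H ^ 3 * (M * ∑ r ∈ B, (g (nxt r) 0 - g r 0) ^ 2) := by
      have : 0 ≤ ∑ r ∈ B, (g (nxt r) 0 - g r 0) ^ 2 := Finset.sum_nonneg fun _ _ => sq_nonneg _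
      gcongr
    _ = M * ∑ r ∈ B, H ^ 3 * (g (nxt r) 0 - g r 0) ^ 2 := by
      rw [← Finset.mul_sum]; ring
    _ ≤ M * ∑ r ∈ B, C * M ^ 6 * m.height t *
        (localError f uh G r + localError f uh G (nxt r)) :=
      mul_le_mul_of_nonneg_left (Finset.sum_le_sum hterm) (by linarith)
    _ = C * M ^ 7 * m.height t *
        ∑ r ∈ B, (localError f uh G r + localError f uh G (nxt r)) := by
      rw [← Finset.mul_sum]; ring
    _ ≤ C * (|M| + 1) ^ 7 * m.height t *
        (2 * m.nodeError f uh G k (sideNode x k b z)) := by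
      have : M ^ 7 ≤ (|M| + 1) ^ 7 := by
        refine pow_le_pow_left₀ (by linarith) ?_ 7
        linarith [le_abs_self M]
      gcongr
    _ = _ := by ring

end StripMesh

/-! ### Cut-offs around a vertical line with vanishing moments -/

lemma deriv_eq_zero_of_eqOn_Icc {w : ℝ → ℝ} (hw : Differentiable ℝ w) {a b c : ℝ} (hab : a < b)
    (h : ∀ y ∈ Set.Icc a b, w y = c) {y : ℝ} (hy : y ∈ Set.Icc a b) : deriv w y = 0 := by
  have h1 : HasDerivWithinAt w (deriv w y) (Set.Icc a b) y := (hw y).hasDerivAt.hasDerivWithinAt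
  have h2 : HasDerivWithinAt w 0 (Set.Icc a b) y :=
    (hasDerivWithinAt_const y (Set.Icc a b) c).congr h (h y hy)
  exact (uniqueDiffOn_Icc hab y hy).eq_deriv _ h1 h2

/-- A cutoff function around `c` with vanishing moments on both sides. -/
lemma exists_two_sided_cutoff : ∃ B : ℝ, 0 < B ∧ ∀ c l₀ l₁ : ℝ, 0 < l₀ → 0 < l₁ →
    ∃ ψ : ℝ → ℝ, ContDiff ℝ ∞ ψ ∧ ψ c = 1 ∧
      (∀ X, X ∉ Set.Icc (c - l₀) (c + l₁) → ψ X = 0 ∧ deriv ψ X = 0) ∧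
      (∀ R, l₁ ≤ R → ∫ X in c..(c + R), ψ X = 0 ∧ ∫ X in c..(c + R), ψ X * X = 0) ∧
      (∀ R, l₀ ≤ R → ∫ X in (c - R)..c, ψ X = 0 ∧ ∫ X in (c - R)..c, ψ X * X = 0) ∧
      ∀ X, |ψ X| ≤ B ∧ |deriv ψ X| ≤ B * (1 / l₀ + 1 / l₁) := by
  obtain ⟨Ψ, hΨ, hΨ1, hΨ0, hm0, hm1⟩ := exists_cutoff
  obtain ⟨B, hB, hΨb⟩ := exists_deriv_bound hΨ hΨ1 hΨ0
  have hΨc := hΨ.continuous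
  have mom0 : ∀ S, 1 ≤ S → ∫ t in (0 : ℝ)..S, Ψ t = 0 := by
    intro S hS
    rw [← intervalIntegral.integral_add_adjacent_intervals (b := 1)
      (hΨc.intervalIntegrable _ _) (hΨc.intervalIntegrable _ _), hm0]
    have : ∫ t in (1 : ℝ)..S, Ψ t = ∫ t in (1 : ℝ)..S, (0 : ℝ) := by
      refine intervalIntegral.integral_congr fun r hr => ?_
      rw [Set.uIcc_of_le hS] at hr
      exact hΨ0 r hr.1
    rw [this]; simp
  have mom1 : ∀ S, 1 ≤ S → ∫ t in (0 : ℝ)..S, Ψ t * t = 0 := by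
    intro S hS
    have hc : Continuous fun t => Ψ t * t := hΨc.mul continuous_id
    rw [← intervalIntegral.integral_add_adjacent_intervals (b := 1)
      (hc.intervalIntegrable _ _) (hc.intervalIntegrable _ _)]
    have e1 : ∫ t in (0 : ℝ)..1, Ψ t * t = 0 :=
      (intervalIntegral.integral_congr fun r _ => mul_comm (Ψ r) r).trans hm1
    have e2 : ∫ t in (1 : ℝ)..S, Ψ t * t = ∫ t in (1 : ℝ)..S, (0 : ℝ) := by
      refine intervalIntegral.integral_congr fun r hr => ?_
      rw [Set.uIcc_of_le hS] at hr
      simp [hΨ0 r hr.1]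
    rw [e1, e2]; simp
  refine ⟨B ^ 2, by positivity, fun c l₀ l₁ hl₀ hl₁ => ?_⟩
  -- Each factor equals 1 on the other side of c, so on either side the product is a rescaled Ψ; the
  -- negative divisor reflects it.
  set ψ₁ : ℝ → ℝ := fun X => Ψ ((X - c) / l₁)
  set ψ₀ : ℝ → ℝ := fun X => Ψ ((X - c) / -l₀)
  have h1 : ContDiff ℝ ∞ ψ₁ := contDiff_comp_div hΨ c l₁
  have h0 : ContDiff ℝ ∞ ψ₀ := contDiff_comp_div hΨ c (-l₀)
  have one₁ : ∀ X ≤ c, ψ₁ X = 1 := fun X hX => hΨ1 _ (by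
    rw [div_le_iff₀ hl₁]; linarith)
  have one₀ : ∀ X, c ≤ X → ψ₀ X = 1 := fun X hX => hΨ1 _ (by
    rw [div_neg, neg_le, le_div_iff₀ hl₀]; linarith)
  have zero₁ : ∀ X, c + l₁ ≤ X → ψ₁ X = 0 := fun X hX => hΨ0 _ (by
    rw [le_div_iff₀ hl₁]; linarith)
  have zero₀ : ∀ X ≤ c - l₀, ψ₀ X = 0 := fun X hX => hΨ0 _ (by
    rw [div_neg, le_neg, div_le_iff₀ hl₀]; linarith)
  -- Substituting X = lr + c turns both integrals into combinations of the moments of Ψ over [0, S].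
  -- It is applied with l = l₁ and l = -l₀.
  have mom : ∀ l S, 1 ≤ S → ∫ X in c..(l * S + c), Ψ ((X - c) / l) = 0 ∧
      ∫ X in c..(l * S + c), Ψ ((X - c) / l) * X = 0 := by
    intro l S hS
    rcases eq_or_ne l 0 with rfl | hl
    · simp
    have e0 := intervalIntegral.smul_integral_comp_mul_add (a := 0) (b := S)
      (fun X => Ψ ((X - c) / l)) l c
    have e1 := intervalIntegral.smul_integral_comp_mul_add (a := 0) (b := S)
      (fun X => Ψ ((X - c) / l) * X) l c
    have e2 : ∀ r, (l * r + c - c) / l = r := fun r => by field_simp; ring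
    have e3 : ∀ r, Ψ r * (l * r + c) = l * (Ψ r * r) + c * Ψ r := fun r => by ring
    simp only [e2, e3, mul_zero, zero_add] at e0 e1
    rw [← e0, ← e1, intervalIntegral.integral_add (f := fun r => l * (Ψ r * r))
      (g := fun r => c * Ψ r)
      ((continuous_const.mul (hΨc.mul continuous_id)).intervalIntegrable _ _)
      ((continuous_const.mul hΨc).intervalIntegrable _ _), intervalIntegral.integral_const_mul,
      intervalIntegral.integral_const_mul, mom0 S hS, mom1 S hS]
    simp
  have int₁ : ∀ R, l₁ ≤ R → ∫ X in c..(c + R), ψ₁ X = 0 ∧ ∫ X in c..(c + R), ψ₁ X * X = 0 := by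
    intro R hR
    have := mom l₁ (R / l₁) ((one_le_div hl₁).2 hR)
    rwa [mul_div_cancel₀ _ hl₁.ne', add_comm R] at this
  have int₀ : ∀ R, l₀ ≤ R → ∫ X in (c - R)..c, ψ₀ X = 0 ∧ ∫ X in (c - R)..c, ψ₀ X * X = 0 := by
    intro R hR
    have := mom (-l₀) (R / l₀) ((one_le_div hl₀).2 hR)
    rw [neg_mul, mul_div_cancel₀ _ hl₀.ne', neg_add_eq_sub] at this
    rw [intervalIntegral.integral_symm, intervalIntegral.integral_symm c]
    exact ⟨neg_eq_zero.2 this.1, neg_eq_zero.2 this.2⟩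
  refine ⟨fun X => ψ₁ X * ψ₀ X, h1.mul h0, ?_, ?_, ?_, ?_, ?_⟩
  · simp [one₁ c le_rfl, one₀ c le_rfl]
  · intro X hX
    rw [Set.mem_Icc, not_and_or, not_le, not_le] at hX
    rcases hX with h | h
    · refine ⟨by simp [zero₀ X h.le], ?_⟩
      exact deriv_eq_zero_of_eqOn_const isOpen_Iio (c := 0)
        (fun t (ht : t < c - l₀) => by simp [zero₀ t ht.le]) h
    · refine ⟨by simp [zero₁ X h.le], ?_⟩
      exact deriv_eq_zero_of_eqOn_const isOpen_Ioi (c := 0)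
        (fun t (ht : c + l₁ < t) => by simp [zero₁ t ht.le]) h
  · intro R hR
    refine ⟨Eq.trans ?_ (int₁ R hR).1, Eq.trans ?_ (int₁ R hR).2⟩ <;>
    · refine intervalIntegral.integral_congr fun X hX => ?_
      rw [Set.uIcc_of_le (by linarith)] at hX
      simp [one₀ X hX.1]
  · intro R hR
    refine ⟨Eq.trans ?_ (int₀ R hR).1, Eq.trans ?_ (int₀ R hR).2⟩ <;>
    · refine intervalIntegral.integral_congr fun X hX => ?_
      rw [Set.uIcc_of_le (by linarith)] at hX
      simp [one₁ X hX.2]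
  · intro X
    constructor
    · rw [abs_mul, sq]
      exact mul_le_mul (hΨb _).1 (hΨb _).1 (abs_nonneg _) hB.le
    · have d := ((h1.differentiable (by simp) X).hasDerivAt.mul
        (h0.differentiable (by simp) X).hasDerivAt).deriv
      change |deriv (ψ₁ * ψ₀) X| ≤ _
      rw [d]
      have d1 : |deriv ψ₁ X| ≤ B / l₁ := by
        rw [deriv_comp_div hΨ, abs_div, abs_of_pos hl₁]
        exact div_le_div_of_nonneg_right (hΨb _).2 hl₁.le
      have d0 : |deriv ψ₀ X| ≤ B / l₀ := by
        rw [deriv_comp_div hΨ, abs_div, abs_neg, abs_of_pos hl₀]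
        exact div_le_div_of_nonneg_right (hΨb _).2 hl₀.le
      calc _ ≤ |deriv ψ₁ X * ψ₀ X| + |ψ₁ X * deriv ψ₀ X| := abs_add_le _ _
        _ = |deriv ψ₁ X| * |ψ₀ X| + |ψ₁ X| * |deriv ψ₀ X| := by rw [abs_mul, abs_mul]
        _ ≤ B / l₁ * B + B * (B / l₀) := by
          have := (hΨb ((X - c) / -l₀)).1
          have := (hΨb ((X - c) / l₁)).1
          gcongr
        _ = _ := by ring

/-- The integrals over a triangle of a product, if the first two moments of the first factor
vanish. -/
lemma StripTriangle.integrals_of_moments {t : Finset Plane} {X₀ X₁ : ℝ} {lo up : Fin 2 → ℝ}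
    (h : StripTriangle t X₀ X₁ lo up) {χ w : ℝ → ℝ} (hχ : ContDiff ℝ ∞ χ) (hw : ContDiff ℝ ∞ w)
    {r₀ r₁ wu wl : ℝ}
    (hr : ∀ x ∈ Set.Icc X₀ X₁, x ∉ Set.Icc r₀ r₁ → χ x = 0)
    (hup : ∀ x ∈ Set.Icc r₀ r₁, w (lerp X₀ X₁ (up 0) (up 1) x) = wu)
    (hlo : ∀ x ∈ Set.Icc r₀ r₁, w (lerp X₀ X₁ (lo 0) (lo 1) x) = wl)
    (m0 : ∫ x in X₀..X₁, χ x = 0) (m1 : ∫ x in X₀..X₁, χ x * x = 0) (g : Plane) :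
    (∫ p in hull t, shearProd χ w 0 0 p = 0) ∧
    ∫ p in hull t, ⟪g, gradient (shearProd χ w 0 0) p⟫ =
      g 0 * (χ X₁ * (∫ y in (lo 1)..(up 1), w y) - χ X₀ * ∫ y in (lo 0)..(up 0), w y) := by
  obtain ⟨i1, i2, i3⟩ := h.integrals_shearProd hχ hw 0 0 (r₀ := r₀) (r₁ := r₁) (wu := wu)
    (wl := wl) hr (fun x hx => by simpa using hup x hx) (fun x hx => by simpa using hlo x hx)
  have m2 : ∫ x in X₀..X₁, χ x * (x - r₀) = 0 := by
    have e : ∀ x, χ x * (x - r₀) = χ x * x - r₀ * χ x := fun x => by ring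
    simp_rw [e]
    rw [intervalIntegral.integral_sub (f := fun x => χ x * x) (g := fun x => r₀ * χ x) ((hχ.continuous.mul continuous_id).intervalIntegrable _ _)
      ((continuous_const.mul hχ.continuous).intervalIntegrable _ _), m1,
      intervalIntegral.integral_const_mul, m0]
    ring
  rw [m0, mul_zero] at i1
  rw [m0, mul_zero, sub_zero] at i2
  rw [m0, m2, mul_zero, mul_zero, add_zero] at i3
  refine ⟨i3, ?_⟩
  rw [setIntegral_inner_gradient_shearProd hχ hw, i1, i2]
  beta_reduce
  rw [lerp_left, lerp_left, lerp_right h.lt,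
    lerp_right h.lt]
  simp

/-! ### Slanted sides near a vertical line -/

namespace StripMesh

variable {𝒯 : Triangulation unitSquare} {n : ℕ} {x : ℕ → ℝ} (m : StripMesh 𝒯 n x)
  {r s t : Finset Plane} {c₀ α M : ℝ} {f u uh : Plane → ℝ} {G : Plane → Plane} {k : ℕ}
  {b : Fin 2} {X : ℝ}

open Classical in
/-- The elements in the `k`-th strip with an edge on its side `b`. -/
def atSide (k : ℕ) (b : Fin 2) : Finset (Finset Plane) :=
  {t ∈ m.inStrip k | m.lo t b < m.up t b}

lemma mem_atSide : t ∈ m.atSide k b ↔ (t ∈ 𝒯.elements ∧ m.strip t = k) ∧ m.lo t b < m.up t b := by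
  rw [atSide, Finset.mem_filter, mem_inStrip]

lemma height_eq (ht : t ∈ m.atSide k b) : m.height t = m.up t b - m.lo t b := by
  obtain ⟨⟨h1, -⟩, h2⟩ := m.mem_atSide.1 ht
  simp only [height]
  fin_cases b <;> rcases (m.tri t h1).shape with h | h <;> simp at h2 ⊢ <;> linarith

/-- The elements on the two sides of a vertical line correspond to each other. -/
lemma exists_partner (hk : k + 1 < n) : ∃ π : Finset Plane → Finset Plane,
    (∀ t ∈ m.atSide (k + 1) 0, π t ∈ m.atSide k 1 ∧ m.lo (π t) 1 = m.lo t 0 ∧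
      m.up (π t) 1 = m.up t 0) ∧
    (∀ s ∈ m.atSide k 1, ∃ t ∈ m.atSide (k + 1) 0, π t = s) ∧
    Set.InjOn π (m.atSide (k + 1) 0) := by
  have hex : ∀ t ∈ m.atSide (k + 1) 0, ∃ s, s ∈ m.atSide k 1 ∧ m.lo s 1 = m.lo t 0 ∧
      m.up s 1 = m.up t 0 := by
    intro t ht
    obtain ⟨⟨h1, h2⟩, h3⟩ := m.mem_atSide.1 ht
    obtain ⟨s, hs, hs1, hs2, hs3⟩ := m.exists_left h1 h3 (by omega)
    exact ⟨s, m.mem_atSide.2 ⟨⟨hs, by omega⟩, by rw [hs2, hs3]; exact h3⟩, hs2, hs3⟩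
  choose! π hπ using hex
  -- An edge on a line belongs to only one element of the adjacent strip, since sides on the line do
  -- not overlap.
  have huniq : ∀ {k b} {s t : Finset Plane}, s ∈ m.atSide k b → t ∈ m.atSide k b →
      m.lo s b = m.lo t b → m.up s b = m.up t b → s = t := by
    intro k b s t hs ht h1 h2
    obtain ⟨⟨s1, s2⟩, s3⟩ := m.mem_atSide.1 hs
    obtain ⟨⟨t1, t2⟩, t3⟩ := m.mem_atSide.1 ht
    by_contra hst
    rcases m.side_disjoint s1 t1 (s2.trans t2.symm) hst b with h | h <;> linarith
  refine ⟨π, hπ, ?_, ?_⟩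
  · intro s hs
    obtain ⟨⟨h1, h2⟩, h3⟩ := m.mem_atSide.1 hs
    obtain ⟨t, ht, ht1, ht2, ht3⟩ := m.exists_right h1 h3 (by omega)
    have htm : t ∈ m.atSide (k + 1) 0 :=
      m.mem_atSide.2 ⟨⟨ht, by omega⟩, by rw [ht2, ht3]; exact h3⟩
    refine ⟨t, htm, huniq (hπ t htm).1 hs ?_ ?_⟩
    · rw [(hπ t htm).2.1, ht2]
    · rw [(hπ t htm).2.2, ht3]
  · intro s hs t ht h
    refine huniq hs ht ?_ ?_
    · rw [← (hπ s hs).2.1, ← (hπ t ht).2.1, h]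
    · rw [← (hπ s hs).2.2, ← (hπ t ht).2.2, h]

lemma sum_atSide {φ : Finset Plane → ℝ}
    (h : ∀ t ∈ m.inStrip k, m.lo t b = m.up t b → φ t = 0) :
    ∑ t ∈ m.atSide k b, φ t = ∑ t ∈ m.inStrip k, φ t := by
  refine Finset.sum_subset (Finset.filter_subset _ _) fun t ht ht' => h t ht ?_
  have h1 := m.mem_inStrip.1 ht
  refine le_antisymm ((m.tri t h1.1).le b) ?_
  by_contra hlt
  exact ht' (m.mem_atSide.2 ⟨h1, not_le.1 hlt⟩)

lemma sum_partner {π : Finset Plane → Finset Plane}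
    (h1 : ∀ t ∈ m.atSide (k + 1) 0, π t ∈ m.atSide k 1)
    (h2 : ∀ s ∈ m.atSide k 1, ∃ t ∈ m.atSide (k + 1) 0, π t = s)
    (h3 : Set.InjOn π (m.atSide (k + 1) 0)) (φ : Finset Plane → ℝ) :
    ∑ t ∈ m.atSide (k + 1) 0, φ (π t) = ∑ s ∈ m.atSide k 1, φ s :=
  Finset.sum_bij (fun t _ => π t) h1 (fun _ ha _ hb h => h3 ha hb h)
    (fun s hs => by obtain ⟨t, ht, h⟩ := h2 s hs; exact ⟨t, ht, h⟩) fun _ _ => rfl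

/-- Points near the vertical line at the side `b`. -/
def NearSide (k : ℕ) (b : Fin 2) (X : ℝ) : Prop :=
  X ∈ Set.Icc (x k) (x (k + 1)) ∧ ∀ t ∈ m.atSide k b,
    |m.loAt t X - m.lo t b| ≤ (m.up t b - m.lo t b) / 4 ∧
    |m.upAt t X - m.up t b| ≤ (m.up t b - m.lo t b) / 4

/-- A slanted side rises by at most M²/2 times the height over the full width, hence by at most a
quarter of the height over the fraction 1/(2M²) of the width. -/
lemma nearSide_of_abs_le (hA : 𝒯.AllNodesAnisotropic c₀ M) (hG : 𝒯.GlobalOrientation M)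
    (hM : 0 ≤ M) (hX : X ∈ Set.Icc (x k) (x (k + 1)))
    (h : |X - x (k + b)| * (2 * M ^ 2) ≤ x (k + 1) - x k) : m.NearSide k b X := by
  refine ⟨hX, fun t ht => ?_⟩
  obtain ⟨⟨h1, h2⟩, h3⟩ := m.mem_atSide.1 ht
  rw [← m.height_eq ht]
  have hT := m.tri t h1
  obtain ⟨v1, v2, v3, v4⟩ := m.vertex_mem h1
  have hl := m.extent_le hA hG hM h1 h1 v1 v1 (subset_convexHull ℝ _ v3) (subset_convexHull ℝ _ v1)
  have hu := m.extent_le hA hG hM h1 h1 v1 v1 (subset_convexHull ℝ _ v4) (subset_convexHull ℝ _ v2)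
  rw [pt_one, pt_one] at hl hu
  have hw := m.width_pos h1
  have hwk : x (m.strip t + 1) - x (m.strip t) = x (k + 1) - x k := by rw [h2]
  have hh := m.height_pos h1
  have key : ∀ y₀ y₁ : ℝ, |y₁ - y₀| ≤ M ^ 2 / 2 * m.height t →
      |(y₁ - y₀) / (x (m.strip t + 1) - x (m.strip t)) * (X - x (k + b))| ≤ m.height t / 4 := by
    intro y₀ y₁ hy
    have hw' : 0 < x (k + 1) - x k := by rw [← hwk]; exact hw
    rw [hwk, abs_mul, abs_div, abs_of_pos hw', div_mul_eq_mul_div, div_le_iff₀ hw']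
    calc |y₁ - y₀| * |X - x (k + b)| ≤ M ^ 2 / 2 * m.height t * |X - x (k + b)| := by gcongr
      _ = m.height t / 4 * (|X - x (k + b)| * (2 * M ^ 2)) := by ring
      _ ≤ m.height t / 4 * (x (k + 1) - x k) := by gcongr
  have hside : ∀ y : Fin 2 → ℝ, lerp (x (m.strip t)) (x (m.strip t + 1)) (y 0) (y 1) (x (k + b)) =
      y b := by
    intro y
    fin_cases b
    · simp [← h2, lerp_left]
    · simp [← h2, lerp_right hT.lt]
  have e1 := lerp_affine (x (m.strip t)) (x (m.strip t + 1)) (m.lo t 0) (m.lo t 1) (x (k + b)) X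
  have e2 := lerp_affine (x (m.strip t)) (x (m.strip t + 1)) (m.up t 0) (m.up t 1) (x (k + b)) X
  rw [hside] at e1 e2
  constructor
  · rw [loAt, e1, add_sub_cancel_left]; exact key _ _ hl
  · rw [upAt, e2, add_sub_cancel_left]; exact key _ _ hu

/-- Near a vertical line, a side of an element does not enter the middle parts of the edges on
this line. -/
lemma side_separated (hX : m.NearSide k b X) (hr : r ∈ m.inStrip k) (ht : t ∈ m.atSide k b) :
    ((∀ y ∈ Set.uIcc (m.lo r b) (m.loAt r X), y ≤ m.lo t b + (m.up t b - m.lo t b) / 4) ∨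
      (∀ y ∈ Set.uIcc (m.lo r b) (m.loAt r X), m.up t b - (m.up t b - m.lo t b) / 4 ≤ y)) ∧
    ((∀ y ∈ Set.uIcc (m.up r b) (m.upAt r X), y ≤ m.lo t b + (m.up t b - m.lo t b) / 4) ∨
      (∀ y ∈ Set.uIcc (m.up r b) (m.upAt r X), m.up t b - (m.up t b - m.lo t b) / 4 ≤ y)) := by
  obtain ⟨hr1, hr2⟩ := m.mem_inStrip.1 hr
  obtain ⟨⟨h1, h2⟩, h3⟩ := m.mem_atSide.1 ht
  obtain ⟨n1, n2⟩ := hX.2 t ht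
  rw [abs_le] at n1 n2
  have hXr : X ∈ Set.Icc (x (m.strip r)) (x (m.strip r + 1)) := by rw [hr2]; exact hX.1
  have hle : m.loAt r X ≤ m.upAt r X := (m.tri r hr1).lerp_le hXr
  have hleb : m.lo r b ≤ m.up r b := (m.tri r hr1).le b
  have low : ∀ {p q : ℝ}, p ≤ m.lo t b + (m.up t b - m.lo t b) / 4 →
      q ≤ m.lo t b + (m.up t b - m.lo t b) / 4 →
      ∀ y ∈ Set.uIcc p q, y ≤ m.lo t b + (m.up t b - m.lo t b) / 4 :=
    fun hp hq y hy => hy.2.trans (sup_le hp hq)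
  have high : ∀ {p q : ℝ}, m.up t b - (m.up t b - m.lo t b) / 4 ≤ p →
      m.up t b - (m.up t b - m.lo t b) / 4 ≤ q →
      ∀ y ∈ Set.uIcc p q, m.up t b - (m.up t b - m.lo t b) / 4 ≤ y :=
    fun hp hq y hy => (le_inf hp hq).trans hy.1
  by_cases hrt : r = t
  · subst hrt
    exact ⟨Or.inl (low (by linarith) (by linarith)), Or.inr (high (by linarith) (by linarith))⟩
  · have hk := hr2.trans h2.symm
    rcases m.ordered hr1 h1 hk hrt with h | h
    · have a1 := h X hXr
      have a2 : m.up r b ≤ m.lo t b := by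
        fin_cases b
        · have := h _ (Set.left_mem_Icc.2 (m.tri r hr1).lt.le)
          rw [m.upAt_left, hk, m.loAt_left] at this
          exact this
        · have := h _ (Set.right_mem_Icc.2 (m.tri r hr1).lt.le)
          rw [m.upAt_right hr1, hk, m.loAt_right h1] at this
          exact this
      exact ⟨Or.inl (low (by linarith) (by linarith)), Or.inl (low (by linarith) (by linarith))⟩
    · have a1 := h X hXr
      have a2 : m.up t b ≤ m.lo r b := by
        fin_cases b
        · have := h _ (Set.left_mem_Icc.2 (m.tri r hr1).lt.le)
          rw [m.loAt_left, hk, m.upAt_left] at this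
          exact this
        · have := h _ (Set.right_mem_Icc.2 (m.tri r hr1).lt.le)
          rw [m.loAt_right hr1, hk, m.upAt_right h1] at this
          exact this
      exact ⟨Or.inr (high (by linarith) (by linarith)), Or.inr (high (by linarith) (by linarith))⟩

/-- A function that is constant near the nodes on a vertical line. -/
def FlatAtNodes (k : ℕ) (b : Fin 2) (w : ℝ → ℝ) : Prop :=
  ∀ y y', (∀ t ∈ m.atSide k b, (y ≤ m.lo t b + (m.up t b - m.lo t b) / 4 ∧
      y' ≤ m.lo t b + (m.up t b - m.lo t b) / 4) ∨
    (m.up t b - (m.up t b - m.lo t b) / 4 ≤ y ∧ m.up t b - (m.up t b - m.lo t b) / 4 ≤ y')) →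
    w y = w y'

/-- Between its end on the line and the abscissa X, the side stays in outer quarters of edges, where
the function does not change. -/
lemma FlatAtNodes.eq_side {w : ℝ → ℝ} (hw : m.FlatAtNodes k b w) (hX : m.NearSide k b X)
    (hr : r ∈ m.inStrip k) :
    (∀ y ∈ Set.uIcc (m.lo r b) (m.loAt r X), w y = w (m.lo r b)) ∧
      ∀ y ∈ Set.uIcc (m.up r b) (m.upAt r X), w y = w (m.up r b) := by
  constructor
  · intro y hy
    refine hw _ _ fun t ht => ?_
    rcases (m.side_separated hX hr ht).1 with h | h
    · exact Or.inl ⟨h y hy, h _ Set.left_mem_uIcc⟩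
    · exact Or.inr ⟨h y hy, h _ Set.left_mem_uIcc⟩
  · intro y hy
    refine hw _ _ fun t ht => ?_
    rcases (m.side_separated hX hr ht).2 with h | h
    · exact Or.inl ⟨h y hy, h _ Set.left_mem_uIcc⟩
    · exact Or.inr ⟨h y hy, h _ Set.left_mem_uIcc⟩

/-- The section at X may stick out beyond the trace of the element on the line, but only through
regions swept by its slanted sides, where the function keeps its nodal value and has derivative
zero. So bounds on the line carry over. -/
lemma FlatAtNodes.bound {w : ℝ → ℝ} (hw : m.FlatAtNodes k b w) (hwd : Differentiable ℝ w)
    (hX : m.NearSide k b X) (hr : r ∈ m.inStrip k) {W W' : ℝ}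
    (hb : ∀ y ∈ Set.Icc (m.lo r b) (m.up r b), |w y| ≤ W ∧ |deriv w y| ≤ W') {y : ℝ}
    (hy : y ∈ Set.Icc (m.loAt r X) (m.upAt r X)) : |w y| ≤ W ∧ |deriv w y| ≤ W' := by
  obtain ⟨e1, e2⟩ := hw.eq_side m hX hr
  have hleb : m.lo r b ≤ m.up r b := (m.tri r (m.mem_inStrip.1 hr).1).le b
  have hW' : 0 ≤ W' := (abs_nonneg _).trans (hb _ ⟨le_rfl, hleb⟩).2
  rcases lt_or_ge y (m.lo r b) with h | h
  · have hlt : m.loAt r X < m.lo r b := hy.1.trans_lt h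
    rw [Set.uIcc_comm, Set.uIcc_of_le hlt.le] at e1
    rw [e1 y ⟨hy.1, h.le⟩, deriv_eq_zero_of_eqOn_Icc hwd hlt e1 ⟨hy.1, h.le⟩, abs_zero]
    exact ⟨(hb _ ⟨le_rfl, hleb⟩).1, hW'⟩
  rcases lt_or_ge (m.up r b) y with h' | h'
  · have hlt : m.up r b < m.upAt r X := h'.trans_le hy.2
    rw [Set.uIcc_of_le hlt.le] at e2
    rw [e2 y ⟨h'.le, hy.2⟩, deriv_eq_zero_of_eqOn_Icc hwd hlt e2 ⟨h'.le, hy.2⟩, abs_zero]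
    exact ⟨(hb _ ⟨hleb, le_rfl⟩).1, hW'⟩
  · exact hb y ⟨h, h'⟩

end StripMesh

/-- The absorption argument for the jumps across the edges on a vertical line. -/
lemma sum_jump_sq_le {ι : Type*} (L : Finset ι) (h J E I : ι → ℝ) {H c R N ms : ℝ} (hH : 0 < H)
    (hh : ∀ t ∈ L, 0 < h t) (hE : ∀ t ∈ L, 0 ≤ E t) (hc : ∀ t ∈ L, h t ≤ c * H) (hc0 : 0 ≤ c)
    (hI : ∀ t ∈ L, |I t - h t * J t| ≤ h t * E t)
    (hN : ∑ t ∈ L, H ^ 3 * E t ^ 2 / h t ≤ N) (hms : 0 ≤ ms)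
    (hsum : |∑ t ∈ L, J t * I t| ≤
      R * √(∑ t ∈ L, ((|J t| + E t) / H + E t / h t) ^ 2 * (h t * H)) * √ms) :
    ∑ t ∈ L, h t * H * J t ^ 2 ≤ 2 * (c ^ 2 + (1 + c) ^ 2) * N + 4 * R ^ 2 * ms := by
  set q := ∑ t ∈ L, h t * H * J t ^ 2 with hq
  set Q := ∑ t ∈ L, ((|J t| + E t) / H + E t / h t) ^ 2 * (h t * H) with hQ
  have hQ0 : 0 ≤ Q := Finset.sum_nonneg fun t ht => by
    have := hh t ht; positivity
  -- Since h ≤ cH, the term E/H is dominated by c · E/h, so the gradient weight is at most |J|/H +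
  -- (1+c)E/h.
  have hQle : H ^ 2 * Q ≤ 2 * q + 2 * (1 + c) ^ 2 * N := by
    calc H ^ 2 * Q = ∑ t ∈ L, H ^ 2 * (((|J t| + E t) / H + E t / h t) ^ 2 * (h t * H)) := by
          rw [hQ, Finset.mul_sum]
      _ ≤ ∑ t ∈ L, (2 * (h t * H * J t ^ 2) + 2 * (1 + c) ^ 2 * (H ^ 3 * E t ^ 2 / h t)) := by
          refine Finset.sum_le_sum fun t ht => ?_
          have h1 := hh t ht
          have h2 := hE t ht
          have h3 := hc t ht
          have e1 : (|J t| + E t) / H + E t / h t ≤ |J t| / H + (1 + c) * (E t / h t) := by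
            have : E t / H ≤ c * (E t / h t) := by
              rw [mul_div_assoc', div_le_div_iff₀ hH h1]
              calc E t * h t ≤ E t * (c * H) := by gcongr
                _ = _ := by ring
            rw [add_div]; linarith
          calc H ^ 2 * (((|J t| + E t) / H + E t / h t) ^ 2 * (h t * H))
              ≤ H ^ 2 * ((|J t| / H + (1 + c) * (E t / h t)) ^ 2 * (h t * H)) := by gcongr
            _ ≤ H ^ 2 * ((2 * (|J t| / H) ^ 2 + 2 * ((1 + c) * (E t / h t)) ^ 2) * (h t * H)) := by
              gcongr
              nlinarith [sq_nonneg (|J t| / H - (1 + c) * (E t / h t))]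
            _ = 2 * (h t * H * |J t| ^ 2) + 2 * (1 + c) ^ 2 * (H ^ 3 * E t ^ 2 / h t) := by
              field_simp
            _ = _ := by rw [sq_abs]
      _ = 2 * q + 2 * (1 + c) ^ 2 * ∑ t ∈ L, H ^ 3 * E t ^ 2 / h t := by
          rw [Finset.sum_add_distrib, ← Finset.mul_sum, ← Finset.mul_sum]
      _ ≤ _ := by gcongr
  have hEN : ∑ t ∈ L, h t * H * E t ^ 2 ≤ c ^ 2 * N := by
    calc ∑ t ∈ L, h t * H * E t ^ 2 ≤ ∑ t ∈ L, c ^ 2 * (H ^ 3 * E t ^ 2 / h t) := by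
          refine Finset.sum_le_sum fun t ht => ?_
          have h1 := hh t ht
          rw [mul_div_assoc', le_div_iff₀ h1]
          calc h t * H * E t ^ 2 * h t = h t ^ 2 * (H * E t ^ 2) := by ring
            _ ≤ (c * H) ^ 2 * (H * E t ^ 2) := by gcongr; exact hc t ht
            _ = _ := by ring
      _ = c ^ 2 * ∑ t ∈ L, H ^ 3 * E t ^ 2 / h t := by rw [Finset.mul_sum]
      _ ≤ _ := by gcongr
  have h1 : ∑ t ∈ L, H * (J t * (h t * J t - I t)) ≤ q / 4 + c ^ 2 * N := by
    calc ∑ t ∈ L, H * (J t * (h t * J t - I t)) ≤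
        ∑ t ∈ L, (1 / 4 * (h t * H * J t ^ 2) + h t * H * E t ^ 2) := by
          refine Finset.sum_le_sum fun t ht => ?_
          have h1 := hh t ht
          have h2 := hI t ht
          rw [abs_sub_comm] at h2
          calc H * (J t * (h t * J t - I t)) ≤ H * |J t * (h t * J t - I t)| := by
                gcongr; exact le_abs_self _
            _ = H * (|J t| * |h t * J t - I t|) := by rw [abs_mul]
            _ ≤ H * (|J t| * (h t * E t)) := by gcongr
            _ = h t * H * (|J t| * E t) := by ring
            _ ≤ h t * H * (1 / 4 * |J t| ^ 2 + E t ^ 2) := by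
              have : |J t| * E t ≤ 1 / 4 * |J t| ^ 2 + E t ^ 2 := by
                nlinarith [sq_nonneg (|J t| / 2 - E t)]
              gcongr
            _ = _ := by rw [sq_abs]; ring
      _ = q / 4 + ∑ t ∈ L, h t * H * E t ^ 2 := by
          rw [Finset.sum_add_distrib, ← Finset.mul_sum]; ring
      _ ≤ _ := by gcongr
  -- Each term h J² is split into J(hJ - I), small because w is close to J on the edge, and the
  -- tested quantity J I.
  have h2 : q = ∑ t ∈ L, H * (J t * (h t * J t - I t)) + H * ∑ t ∈ L, J t * I t := by
    rw [hq, Finset.mul_sum, ← Finset.sum_add_distrib]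
    exact Finset.sum_congr rfl fun t _ => by ring
  -- Young's inequality with weight 1/8: by the bound of H²Q this costs q/4, and the previous
  -- splitting another q/4, which leaves q/2 to absorb.
  have h3 : H * ∑ t ∈ L, J t * I t ≤ H ^ 2 * Q / 8 + 2 * R ^ 2 * ms := by
    have e1 := (le_abs_self _).trans hsum
    have s1 := Real.sq_sqrt hQ0
    have s2 := Real.sq_sqrt hms
    calc H * ∑ t ∈ L, J t * I t ≤ H * (R * √Q * √ms) := by gcongr
      _ ≤ H ^ 2 * √Q ^ 2 / 8 + 2 * R ^ 2 * √ms ^ 2 := by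
        nlinarith [sq_nonneg (H * √Q - 4 * (R * √ms))]
      _ = _ := by rw [s1, s2]
  have hN0 : 0 ≤ N := le_trans (Finset.sum_nonneg fun t ht => by
    have := hh t ht; positivity) hN
  have h4 : 0 ≤ (1 + c) ^ 2 * N := by positivity
  linarith

/-! ### Overlap counts and the pairing of edges across a line -/

namespace StripMesh

variable {𝒯 : Triangulation unitSquare} {n : ℕ} {x : ℕ → ℝ} (m : StripMesh 𝒯 n x)
  {r s t : Finset Plane} {c₀ α M : ℝ} {f u uh : Plane → ℝ} {G : Plane → Plane} {k : ℕ}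
  {b : Fin 2} {X : ℝ}

include m in
open Classical in
lemma card_neighbours_le (hA : 𝒯.AllNodesAnisotropic c₀ M) (ht : t ∈ 𝒯.elements) :
    (({s ∈ 𝒯.elements | ∃ z ∈ t, z ∈ s}).card : ℝ) ≤ 3 * M := by
  have h1 : ({s ∈ 𝒯.elements | ∃ z ∈ t, z ∈ s}) ⊆ t.biUnion fun z => {s ∈ 𝒯.elements | z ∈ s} := by
    intro s hs
    obtain ⟨h1, z, h2, h3⟩ := Finset.mem_filter.1 hs
    exact Finset.mem_biUnion.2 ⟨z, h2, Finset.mem_filter.2 ⟨h1, h3⟩⟩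
  have h2 : (({s ∈ 𝒯.elements | ∃ z ∈ t, z ∈ s}).card : ℝ) ≤
      ∑ z ∈ t, (({s ∈ 𝒯.elements | z ∈ s}).card : ℝ) := by
    exact_mod_cast (Finset.card_le_card h1).trans Finset.card_biUnion_le
  refine h2.trans ((Finset.sum_le_sum fun z hz => m.card_le hA ht hz).trans ?_)
  rw [Finset.sum_const, (mem_elements.1 ht).2, nsmul_eq_mul]
  norm_num

open Classical in
/-- Sums over pairs of neighbouring elements. -/
lemma sum_neighbours_le (hA : 𝒯.AllNodesAnisotropic c₀ M) {A B : Finset (Finset Plane)}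
    (hAe : A ⊆ 𝒯.elements) (hBe : B ⊆ 𝒯.elements) {φ : Finset Plane → ℝ} (hφ : ∀ r, 0 ≤ φ r)
    (m : StripMesh 𝒯 n x) :
    ∑ t ∈ A, ∑ r ∈ {r ∈ B | ∃ z ∈ t, z ∈ r}, φ r ≤ 3 * M * ∑ r ∈ B, φ r := by
  simp_rw [Finset.sum_filter]
  rw [Finset.sum_comm, Finset.mul_sum]
  refine Finset.sum_le_sum fun r hr => ?_
  rw [← Finset.sum_filter, Finset.sum_const, nsmul_eq_mul]
  refine mul_le_mul_of_nonneg_right ?_ (hφ r)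
  refine le_trans ?_ (m.card_neighbours_le hA (hBe hr))
  exact_mod_cast Finset.card_le_card fun t ht => by
    obtain ⟨h1, z, h2, h3⟩ := Finset.mem_filter.1 ht
    exact Finset.mem_filter.2 ⟨hAe h1, z, h3, h2⟩

lemma inStrip_subset : m.inStrip k ⊆ 𝒯.elements := Finset.filter_subset _ _

lemma atSide_subset : m.atSide k b ⊆ m.inStrip k := Finset.filter_subset _ _

lemma inStrip_disjoint : Disjoint (m.inStrip k) (m.inStrip (k + 1)) := by
  rw [Finset.disjoint_left]
  intro r h1 h2
  have := (m.mem_inStrip.1 h1).2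
  have := (m.mem_inStrip.1 h2).2
  omega

/-- A correspondence between the elements on the two sides of a vertical line. -/
structure IsPartner (k : ℕ) (π : Finset Plane → Finset Plane) : Prop where
  mem : ∀ t ∈ m.atSide (k + 1) 0, π t ∈ m.atSide k 1
  lo : ∀ t ∈ m.atSide (k + 1) 0, m.lo (π t) 1 = m.lo t 0
  up : ∀ t ∈ m.atSide (k + 1) 0, m.up (π t) 1 = m.up t 0
  surj : ∀ s ∈ m.atSide k 1, ∃ t ∈ m.atSide (k + 1) 0, π t = s
  inj : Set.InjOn π (m.atSide (k + 1) 0)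

variable {π : Finset Plane → Finset Plane}

/-- The step function is a difference of traces from the right and the left strip. Elements touching
the line only at a point have `lo` = `up` there and contribute nothing, so the sums extend to the
whole strips. -/
lemma stepJump_eq (hπ : m.IsPartner k π) (v : Plane → ℝ) (z : ℝ) :
    stepJump (m.atSide (k + 1) 0) (fun t => m.lo t 0) (fun t => m.up t 0)
      (fun t => elementGradient v t 0 - elementGradient v (π t) 0) z =
    m.sideJump v (k + 1) 0 z - m.sideJump v k 1 z := by
  have e1 : m.sideJump v (k + 1) 0 z = ∑ t ∈ m.atSide (k + 1) 0, elementGradient v t 0 *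
      ((if m.lo t 0 = z then 1 else 0) - if m.up t 0 = z then 1 else 0) :=
    (m.sum_atSide fun t _ h => by rw [h, sub_self, mul_zero]).symm
  have e2 : m.sideJump v k 1 z = ∑ t ∈ m.atSide k 1, elementGradient v t 0 *
      ((if m.lo t 1 = z then 1 else 0) - if m.up t 1 = z then 1 else 0) :=
    (m.sum_atSide fun t _ h => by rw [h, sub_self, mul_zero]).symm
  rw [e1, e2, ← m.sum_partner hπ.mem hπ.surj hπ.inj, ← Finset.sum_sub_distrib, stepJump]
  refine Finset.sum_congr rfl fun t ht => ?_
  rw [hπ.lo t ht, hπ.up t ht, sub_mul]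

lemma flatAtNodes_left (hπ : m.IsPartner k π) {w : ℝ → ℝ} (hw : m.FlatAtNodes (k + 1) 0 w) :
    m.FlatAtNodes k 1 w := by
  intro y y' h
  refine hw y y' fun t ht => ?_
  have := h (π t) (hπ.mem t ht)
  rwa [hπ.lo t ht, hπ.up t ht] at this

/-- The gradient of the discrete solution, tested with a product with vanishing moments. -/
lemma sum_integral_shearProd (hπ : m.IsPartner k π) {ψ w : ℝ → ℝ}
    (hψ : ContDiff ℝ ∞ ψ)
    (hw : ContDiff ℝ ∞ w) (hflat : m.FlatAtNodes (k + 1) 0 w) {l₀ l₁ : ℝ}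
    (hl₀' : l₀ < x (k + 1) - x k) (hl₁' : l₁ < x (k + 2) - x (k + 1))
    (h1 : ψ (x (k + 1)) = 1)
    (h0 : ∀ X, X ∉ Set.Icc (x (k + 1) - l₀) (x (k + 1) + l₁) → ψ X = 0)
    (hm₁ : ∀ R, l₁ ≤ R → ∫ X in (x (k + 1))..(x (k + 1) + R), ψ X = 0 ∧
      ∫ X in (x (k + 1))..(x (k + 1) + R), ψ X * X = 0)
    (hm₀ : ∀ R, l₀ ≤ R → ∫ X in (x (k + 1) - R)..(x (k + 1)), ψ X = 0 ∧
      ∫ X in (x (k + 1) - R)..(x (k + 1)), ψ X * X = 0)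
    (hnear₀ : ∀ X ∈ Set.Icc (x (k + 1) - l₀) (x (k + 1)), m.NearSide k 1 X)
    (hnear₁ : ∀ X ∈ Set.Icc (x (k + 1)) (x (k + 1) + l₁), m.NearSide (k + 1) 0 X)
    (g : Finset Plane → Plane) :
    (∀ r ∈ m.inStrip k ∪ m.inStrip (k + 1), ∫ p in hull r, shearProd ψ w 0 0 p = 0) ∧
    ∑ r ∈ m.inStrip k ∪ m.inStrip (k + 1), ∫ p in hull r, ⟪g r, gradient (shearProd ψ w 0 0) p⟫ =
      - ∑ t ∈ m.atSide (k + 1) 0, (g t 0 - g (π t) 0) * ∫ y in (m.lo t 0)..(m.up t 0), w y := by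
  -- With both moments zero, only the boundary term on the common line survives, where ψ = 1; at the
  -- far line ψ = 0. The left strip gives the opposite sign.
  have right : ∀ r ∈ m.inStrip (k + 1), (∫ p in hull r, shearProd ψ w 0 0 p = 0) ∧
      ∫ p in hull r, ⟪g r, gradient (shearProd ψ w 0 0) p⟫ =
        -(g r 0 * ∫ y in (m.lo r 0)..(m.up r 0), w y) := by
    intro r hr
    obtain ⟨r1, r2⟩ := m.mem_inStrip.1 hr
    have hT : StripTriangle r (x (k + 1)) (x (k + 2)) (m.lo r) (m.up r) := by
      have := m.tri r r1; rwa [r2] at this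
    have hR := hm₁ (x (k + 2) - x (k + 1)) hl₁'.le
    rw [add_sub_cancel] at hR
    have := hT.integrals_of_moments hψ hw (r₀ := x (k + 1)) (r₁ := x (k + 1) + l₁)
      (wu := w (m.up r 0)) (wl := w (m.lo r 0))
      (fun X hX hX' => h0 X fun h => hX' ⟨hX.1, h.2⟩)
      (fun X hX => by
        have h := ((hflat.eq_side m (hnear₁ X hX) hr).2 _ Set.right_mem_uIcc)
        simp only [upAt, r2] at h; exact h)
      (fun X hX => by
        have h := ((hflat.eq_side m (hnear₁ X hX) hr).1 _ Set.right_mem_uIcc)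
        simp only [loAt, r2] at h; exact h) hR.1 hR.2 (g r)
    rw [h1, h0 (x (k + 2)) (fun h => by linarith [h.2])] at this
    refine ⟨this.1, this.2.trans (by ring)⟩
  have left : ∀ r ∈ m.inStrip k, (∫ p in hull r, shearProd ψ w 0 0 p = 0) ∧
      ∫ p in hull r, ⟪g r, gradient (shearProd ψ w 0 0) p⟫ =
        g r 0 * ∫ y in (m.lo r 1)..(m.up r 1), w y := by
    intro r hr
    obtain ⟨r1, r2⟩ := m.mem_inStrip.1 hr
    have hT : StripTriangle r (x k) (x (k + 1)) (m.lo r) (m.up r) := by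
      have := m.tri r r1; rwa [r2] at this
    have hR := hm₀ (x (k + 1) - x k) hl₀'.le
    rw [sub_sub_cancel] at hR
    have hflat' := m.flatAtNodes_left hπ hflat
    have := hT.integrals_of_moments hψ hw (r₀ := x (k + 1) - l₀) (r₁ := x (k + 1))
      (wu := w (m.up r 1)) (wl := w (m.lo r 1))
      (fun X hX hX' => h0 X fun h => hX' ⟨h.1, hX.2⟩)
      (fun X hX => by
        have h := ((hflat'.eq_side m (hnear₀ X hX) hr).2 _ Set.right_mem_uIcc)
        simp only [upAt, r2] at h; exact h)
      (fun X hX => by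
        have h := ((hflat'.eq_side m (hnear₀ X hX) hr).1 _ Set.right_mem_uIcc)
        simp only [loAt, r2] at h; exact h) hR.1 hR.2 (g r)
    rw [h1, h0 (x k) (fun h => by linarith [h.1])] at this
    refine ⟨this.1, this.2.trans (by ring)⟩
  constructor
  · intro r hr
    rcases Finset.mem_union.1 hr with h | h
    · exact (left r h).1
    · exact (right r h).1
  · rw [Finset.sum_union m.inStrip_disjoint, Finset.sum_congr rfl fun r hr => (left r hr).2,
      Finset.sum_congr rfl fun r hr => (right r hr).2,
      ← m.sum_atSide (k := k) (b := 1) fun t _ h => by rw [h]; simp,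
      ← m.sum_atSide (k := k + 1) (b := 0) fun t _ h => by rw [h]; simp,
      ← m.sum_partner hπ.mem hπ.surj hπ.inj, ← Finset.sum_add_distrib, ← Finset.sum_neg_distrib]
    refine Finset.sum_congr rfl fun t ht => ?_
    rw [hπ.lo t ht, hπ.up t ht]; ring

end StripMesh

/-! ### The discontinuities of the step function on a line -/

namespace StripMesh

variable {𝒯 : Triangulation unitSquare} {n : ℕ} {x : ℕ → ℝ} (m : StripMesh 𝒯 n x)
  {r s t : Finset Plane} {c₀ α M : ℝ} {f u uh v : Plane → ℝ} {G : Plane → Plane} {k : ℕ}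
  {b : Fin 2} {X : ℝ} {π : Finset Plane → Finset Plane}

lemma partner_node_mem (hπ : m.IsPartner k π) (ht : t ∈ m.atSide (k + 1) 0) :
    pt (x (k + 1)) (m.lo t 0) ∈ t ∧ pt (x (k + 1)) (m.up t 0) ∈ t ∧
      pt (x (k + 1)) (m.lo t 0) ∈ π t ∧ pt (x (k + 1)) (m.up t 0) ∈ π t := by
  obtain ⟨⟨h1, h2⟩, -⟩ := m.mem_atSide.1 ht
  obtain ⟨⟨h3, h4⟩, -⟩ := m.mem_atSide.1 (hπ.mem t ht)
  obtain ⟨v1, v2, -, -⟩ := m.vertex_mem h1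
  obtain ⟨-, -, w3, w4⟩ := m.vertex_mem h3
  rw [h2] at v1 v2
  rw [h4, hπ.lo t ht] at w3
  rw [h4, hπ.up t ht] at w4
  exact ⟨v1, v2, w3, w4⟩

/-- The two elements at a vertical edge have the same height, so comparability of areas is
comparability of strip widths. -/
lemma width_comparable (hA : 𝒯.AllNodesAnisotropic c₀ M) (hπ : m.IsPartner k π)
    (ht : t ∈ m.atSide (k + 1) 0) :
    x (k + 2) - x (k + 1) ≤ M * (x (k + 1) - x k) ∧
      x (k + 1) - x k ≤ M * (x (k + 2) - x (k + 1)) := by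
  have hs := hπ.mem t ht
  obtain ⟨v1, -, w1, -⟩ := m.partner_node_mem hπ ht
  have eh : m.height (π t) = m.height t := by
    rw [m.height_eq hs, m.height_eq ht, hπ.lo t ht, hπ.up t ht]
  obtain ⟨⟨h1, h2⟩, -⟩ := m.mem_atSide.1 ht
  obtain ⟨⟨h3, h4⟩, -⟩ := m.mem_atSide.1 hs
  have a1 := area_le hA h1 h3 v1 w1
  have a2 := area_le hA h3 h1 w1 v1
  rw [m.area_hull h1, m.area_hull h3, eh] at a1 a2
  have e1 : m.width t = x (k + 2) - x (k + 1) := by simp only [width, h2]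
  have e2 : m.width (π t) = x (k + 1) - x k := by simp only [width, h4]
  rw [e1, e2] at a1 a2
  have hh := m.height_pos h1
  exact ⟨le_of_mul_le_mul_left (by linarith) hh, le_of_mul_le_mul_left (by linarith) hh⟩

/-- The jumps at the nodes on a vertical line of the step function of the jumps across the edges
on this line. -/
def partnerJump (π : Finset Plane → Finset Plane) (v : Plane → ℝ) (k : ℕ) (z : ℝ) : ℝ :=
  stepJump (m.atSide (k + 1) 0) (fun t => m.lo t 0) (fun t => m.up t 0)
    (fun t => elementGradient v t 0 - elementGradient v (π t) 0) z

/-- Each discontinuity is a difference of nodal jumps from the two strips, bounded by the errors of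
elements at the node. Summing over all edges counts each element boundedly often. The weight H³/h is
the one under which the absorption argument needs the discontinuities to be small. -/
theorem exists_sum_partnerJump_le (c₀ α M : ℝ) : ∃ C : ℝ, 0 < C ∧
    ∀ {𝒯 : Triangulation unitSquare} {n : ℕ} {x : ℕ → ℝ} (m : StripMesh 𝒯 n x)
      {f u uh : Plane → ℝ} {G : Plane → Plane}, DiscreteProblem c₀ α M 𝒯 f u uh G →
    ∀ {k : ℕ} {π : Finset Plane → Finset Plane}, k + 1 < n → m.IsPartner k π →
      ∑ t ∈ m.atSide (k + 1) 0, (x (k + 2) - x (k + 1)) ^ 3 *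
        (|m.partnerJump π uh k (m.lo t 0)| + |m.partnerJump π uh k (m.up t 0)|) ^ 2 /
          m.height t ≤
      C * ∑ r ∈ m.inStrip k ∪ m.inStrip (k + 1), localError f uh G r := by
  classical
  obtain ⟨C, hC, hside⟩ := exists_sideJump_sq_le c₀ α M
  refine ⟨24 * C * (|M| + 1) ^ 4, by positivity, ?_⟩
  intro 𝒯 n x m f u uh G P k π hk hπ
  have hM := P.one_le
  set H := x (k + 2) - x (k + 1) with hH
  have hHpos : 0 < H := sub_pos.2 (m.x_lt (k + 1) hk)
  have hHlpos : 0 < x (k + 1) - x k := sub_pos.2 (m.x_lt k (by omega))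
  set S : ℕ → Finset Plane → ℝ := fun j t =>
    ∑ r ∈ {r ∈ m.inStrip j | ∃ z ∈ t, z ∈ r}, localError f uh G r with hS
  have hS0 : ∀ j t, 0 ≤ S j t := fun j t => Finset.sum_nonneg fun _ _ => localError_nonneg _ _ _ _
  have hnode : ∀ j, ∀ t : Finset Plane, ∀ z ∈ t, m.nodeError f uh G j z ≤ S j t := by
    intro j t z hz
    refine Finset.sum_le_sum_of_subset_of_nonneg (fun r hr => ?_)
      fun _ _ _ => localError_nonneg _ _ _ _
    obtain ⟨h1, h2⟩ := Finset.mem_filter.1 hr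
    exact Finset.mem_filter.2 ⟨h1, z, hz, h2⟩
  have hD : ∀ t ∈ m.atSide (k + 1) 0, ∀ z, pt (x (k + 1)) z ∈ t →
      H ^ 3 * m.partnerJump π uh k z ^ 2 ≤
        2 * C * M ^ 3 * m.height t * (S k t + S (k + 1) t) := by
    intro t ht z hz
    have h1 := (m.mem_atSide.1 ht).1.1
    have hh := m.height_pos h1
    have e : m.partnerJump π uh k z = m.sideJump uh (k + 1) 0 z - m.sideJump uh k 1 z :=
      m.stepJump_eq hπ uh z
    have b1 := hside m P (k := k + 1) 0 z hk h1 hz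
    have b2 := hside m P (k := k) 1 z (by omega) h1 hz
    have n1 := hnode (k + 1) t _ hz
    have n2 := hnode k t _ hz
    have w1 := (m.width_comparable P.anisotropic hπ ht).1
    set F₁ := m.sideJump uh (k + 1) 0 z
    set F₀ := m.sideJump uh k 1 z
    rw [e]
    have b1' : H ^ 3 * F₁ ^ 2 ≤ C * m.height t * S (k + 1) t :=
      b1.trans (mul_le_mul_of_nonneg_left n1 (by positivity))
    have b2' : (x (k + 1) - x k) ^ 3 * F₀ ^ 2 ≤ C * m.height t * S k t :=
      b2.trans (mul_le_mul_of_nonneg_left n2 (by positivity))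
    have s0 := hS0 k t
    have s1 := hS0 (k + 1) t
    have hM3 : 1 ≤ M ^ 3 := one_le_pow₀ hM
    -- The left nodal jump is controlled with the width of its own strip; the factor M³ converts it
    -- to the right width.
    calc H ^ 3 * (F₁ - F₀) ^ 2 ≤ H ^ 3 * (2 * F₁ ^ 2 + 2 * F₀ ^ 2) := by
          gcongr; nlinarith [sq_nonneg (F₁ + F₀)]
      _ = 2 * (H ^ 3 * F₁ ^ 2) + 2 * (H ^ 3 * F₀ ^ 2) := by ring
      _ ≤ 2 * (C * m.height t * S (k + 1) t) +
          2 * ((M * (x (k + 1) - x k)) ^ 3 * F₀ ^ 2) := by gcongr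
      _ = 2 * (1 * (C * m.height t * S (k + 1) t)) +
          2 * (M ^ 3 * ((x (k + 1) - x k) ^ 3 * F₀ ^ 2)) := by ring
      _ ≤ 2 * (M ^ 3 * (C * m.height t * S (k + 1) t)) +
          2 * (M ^ 3 * (C * m.height t * S k t)) := by gcongr
      _ = _ := by ring
  have hterm : ∀ t ∈ m.atSide (k + 1) 0, H ^ 3 *
      (|m.partnerJump π uh k (m.lo t 0)| + |m.partnerJump π uh k (m.up t 0)|) ^ 2 / m.height t ≤
      8 * C * M ^ 3 * (S k t + S (k + 1) t) := by
    intro t ht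
    have hh := m.height_pos (m.mem_atSide.1 ht).1.1
    obtain ⟨v1, v2, -, -⟩ := m.partner_node_mem hπ ht
    have d1 := hD t ht _ v1
    have d2 := hD t ht _ v2
    rw [div_le_iff₀ hh]
    set A := m.partnerJump π uh k (m.lo t 0)
    set B := m.partnerJump π uh k (m.up t 0)
    have : (|A| + |B|) ^ 2 ≤ 2 * A ^ 2 + 2 * B ^ 2 := by
      rw [← sq_abs A, ← sq_abs B]; nlinarith [sq_nonneg (|A| - |B|)]
    calc H ^ 3 * (|A| + |B|) ^ 2 ≤ H ^ 3 * (2 * A ^ 2 + 2 * B ^ 2) := by gcongr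
      _ = 2 * (H ^ 3 * A ^ 2) + 2 * (H ^ 3 * B ^ 2) := by ring
      _ ≤ 2 * (2 * C * M ^ 3 * m.height t * (S k t + S (k + 1) t)) +
          2 * (2 * C * M ^ 3 * m.height t * (S k t + S (k + 1) t)) := by gcongr
      _ = _ := by ring
  have hsub : m.atSide (k + 1) 0 ⊆ 𝒯.elements := m.atSide_subset.trans m.inStrip_subset
  have q0 := m.sum_neighbours_le P.anisotropic hsub (m.inStrip_subset (k := k))
    (fun r => localError_nonneg f uh G r)
  have q1 := m.sum_neighbours_le P.anisotropic hsub (m.inStrip_subset (k := k + 1))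
    (fun r => localError_nonneg f uh G r)
  have hm0 : 0 ≤ ∑ r ∈ m.inStrip k, localError f uh G r +
      ∑ r ∈ m.inStrip (k + 1), localError f uh G r :=
    add_nonneg (Finset.sum_nonneg fun _ _ => localError_nonneg _ _ _ _)
      (Finset.sum_nonneg fun _ _ => localError_nonneg _ _ _ _)
  rw [Finset.sum_union m.inStrip_disjoint]
  calc _ ≤ ∑ t ∈ m.atSide (k + 1) 0, 8 * C * M ^ 3 * (S k t + S (k + 1) t) :=
        Finset.sum_le_sum hterm
    _ = 8 * C * M ^ 3 * (∑ t ∈ m.atSide (k + 1) 0, S k t +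
          ∑ t ∈ m.atSide (k + 1) 0, S (k + 1) t) := by
        rw [← Finset.mul_sum, Finset.sum_add_distrib]
    _ ≤ 8 * C * M ^ 3 * (3 * M * ∑ r ∈ m.inStrip k, localError f uh G r +
          3 * M * ∑ r ∈ m.inStrip (k + 1), localError f uh G r) := by gcongr
    _ = 24 * C * M ^ 4 * (∑ r ∈ m.inStrip k, localError f uh G r +
          ∑ r ∈ m.inStrip (k + 1), localError f uh G r) := by ring
    _ ≤ _ := by
      have : M ≤ |M| + 1 := by linarith [le_abs_self M]
      gcongr

end StripMesh

/-! ### The jumps across all edges on one line -/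

namespace StripMesh

variable {𝒯 : Triangulation unitSquare} {n : ℕ} {x : ℕ → ℝ} (m : StripMesh 𝒯 n x)
  {r s t : Finset Plane} {c₀ α M : ℝ} {f u uh v : Plane → ℝ} {G : Plane → Plane} {k : ℕ}
  {b : Fin 2} {X y : ℝ} {π : Finset Plane → Finset Plane}

/-- Traces of different elements on a line do not overlap, so a common point is an endpoint of both.
Thus only elements sharing a node see each other's edges. -/
lemma exists_shared_node (hr : r ∈ m.inStrip k) (ht : t ∈ m.atSide k b)
    (h1 : y ∈ Set.Icc (m.lo r b) (m.up r b)) (h2 : y ∈ Set.Icc (m.lo t b) (m.up t b)) :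
    ∃ z ∈ r, z = sideNode x k b (m.lo t b) ∨ z = sideNode x k b (m.up t b) := by
  obtain ⟨r1, r2⟩ := m.mem_inStrip.1 hr
  obtain ⟨⟨t1, t2⟩, t3⟩ := m.mem_atSide.1 ht
  have u1 := m.sideNode_up_mem r1 b
  have l1 := m.sideNode_lo_mem r1 b
  rw [r2] at u1 l1
  by_cases hrt : r = t
  · subst hrt
    exact ⟨_, l1, Or.inl rfl⟩
  · rcases m.side_disjoint r1 t1 (r2.trans t2.symm) hrt b with h | h
    · have : m.up r b = m.lo t b := le_antisymm h (h2.1.trans h1.2)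
      exact ⟨_, u1, Or.inl (by rw [this])⟩
    · have : m.lo r b = m.up t b := le_antisymm (h1.1.trans h2.2) h
      exact ⟨_, l1, Or.inr (by rw [this])⟩

lemma exists_shared_node_left (hπ : m.IsPartner k π) (hr : r ∈ m.inStrip k)
    (ht : t ∈ m.atSide (k + 1) 0)
    (h1 : y ∈ Set.Icc (m.lo r 1) (m.up r 1)) (h2 : y ∈ Set.Icc (m.lo t 0) (m.up t 0)) :
    ∃ z ∈ r, z ∈ t := by
  have h2' : y ∈ Set.Icc (m.lo (π t) 1) (m.up (π t) 1) := by rwa [hπ.lo t ht, hπ.up t ht]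
  obtain ⟨z, hz, h⟩ := m.exists_shared_node hr (hπ.mem t ht) h1 h2'
  obtain ⟨v1, v2, -, -⟩ := m.partner_node_mem hπ ht
  rw [hπ.lo t ht, hπ.up t ht] at h
  refine ⟨z, hz, ?_⟩
  rcases h with rfl | rfl
  · exact v1
  · exact v2

lemma exists_shared_node_right (hπ : m.IsPartner k π) (hr : r ∈ m.inStrip (k + 1))
    (ht : t ∈ m.atSide (k + 1) 0)
    (h1 : y ∈ Set.Icc (m.lo r 0) (m.up r 0)) (h2 : y ∈ Set.Icc (m.lo t 0) (m.up t 0)) :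
    ∃ z ∈ r, z ∈ t := by
  obtain ⟨z, hz, h⟩ := m.exists_shared_node hr ht h1 h2
  obtain ⟨v1, v2, -, -⟩ := m.partner_node_mem hπ ht
  refine ⟨z, hz, ?_⟩
  rcases h with rfl | rfl
  · exact v1
  · exact v2

open Classical in
-- Cauchy–Schwarz over pairs of neighbours; every element occurs in at most 3M pairs, which bounds
-- both factors.
lemma sum_neighbours_mul_le (hA : 𝒯.AllNodesAnisotropic c₀ M) {A B : Finset (Finset Plane)}
    (hAe : A ⊆ 𝒯.elements) (hBe : B ⊆ 𝒯.elements) (hM : 0 ≤ M) (X Y : Finset Plane → ℝ)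
    (m : StripMesh 𝒯 n x) :
    ∑ r ∈ A, ∑ t ∈ {t ∈ B | ∃ z ∈ r, z ∈ t}, X t * Y r ≤
      3 * M * √(∑ t ∈ B, X t ^ 2) * √(∑ r ∈ A, Y r ^ 2) := by
  have h1 := m.sum_neighbours_le hA hAe hBe (fun r => sq_nonneg (X r))
  have h2 : ∑ r ∈ A, ∑ t ∈ {t ∈ B | ∃ z ∈ r, z ∈ t}, Y r ^ 2 ≤ 3 * M * ∑ r ∈ A, Y r ^ 2 := by
    rw [Finset.mul_sum]
    refine Finset.sum_le_sum fun r hr => ?_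
    rw [Finset.sum_const, nsmul_eq_mul]
    refine mul_le_mul_of_nonneg_right ?_ (sq_nonneg _)
    refine le_trans ?_ (m.card_neighbours_le hA (hAe hr))
    exact_mod_cast Finset.card_le_card (Finset.filter_subset_filter _ hBe)
  have h3 := Real.sum_mul_le_sqrt_mul_sqrt (A.sigma fun r => {t ∈ B | ∃ z ∈ r, z ∈ t})
    (fun p => X p.2) (fun p => Y p.1)
  rw [Finset.sum_sigma, Finset.sum_sigma, Finset.sum_sigma] at h3
  refine h3.trans ?_
  calc _ ≤ √(3 * M * ∑ t ∈ B, X t ^ 2) * √(3 * M * ∑ r ∈ A, Y r ^ 2) := by gcongr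
    _ = √(3 * M) ^ 2 * √(∑ t ∈ B, X t ^ 2) * √(∑ r ∈ A, Y r ^ 2) := by
      rw [Real.sqrt_mul (by positivity : 0 ≤ 3 * M) (∑ t ∈ B, X t ^ 2),
        Real.sqrt_mul (by positivity : 0 ≤ 3 * M) (∑ r ∈ A, Y r ^ 2)]; ring
    _ = _ := by rw [Real.sq_sqrt (by positivity)]

set_option maxHeartbeats 1600000 in
/-- The estimate of the jumps of the gradient across the edges on a vertical line. -/
theorem exists_sum_partner_le (c₀ α M : ℝ) : ∃ C : ℝ, 0 < C ∧
    ∀ {𝒯 : Triangulation unitSquare} {n : ℕ} {x : ℕ → ℝ} (m : StripMesh 𝒯 n x)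
      {f u uh : Plane → ℝ} {G : Plane → Plane}, DiscreteProblem c₀ α M 𝒯 f u uh G →
    ∀ {k : ℕ} {π : Finset Plane → Finset Plane}, k + 1 < n → m.IsPartner k π →
      ∑ t ∈ m.atSide (k + 1) 0, m.height t * (x (k + 2) - x (k + 1)) *
        (elementGradient uh t 0 - elementGradient uh (π t) 0) ^ 2 ≤
      C * ∑ r ∈ m.inStrip k ∪ m.inStrip (k + 1), localError f uh G r := by
  classical
  obtain ⟨CD, hCD, hsumD⟩ := exists_sum_partnerJump_le c₀ α M
  obtain ⟨K, hK, hsteps⟩ := exists_smooth_steps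
  obtain ⟨B, hB, hcut⟩ := exists_two_sided_cutoff
  set c := √(angleConst α) with hc
  have hc0 : 0 ≤ c := Real.sqrt_nonneg _
  set K' := B * (2 * M ^ 2 * (M + 1) + K) with hK'
  set R := K' * √M * (3 * M) with hR
  refine ⟨2 * (c ^ 2 + (1 + c) ^ 2) * CD + 4 * R ^ 2, by positivity, ?_⟩
  intro 𝒯 n x m f u uh G P k π hk hπ
  have hM := P.one_le
  have hM0 : 0 < M := by linarith
  set L := m.atSide (k + 1) 0 with hL
  set D := m.inStrip k ∪ m.inStrip (k + 1) with hD
  set ms := ∑ r ∈ D, localError f uh G r with hms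
  have hms0 : 0 ≤ ms := Finset.sum_nonneg fun _ _ => localError_nonneg _ _ _ _
  set H := x (k + 2) - x (k + 1) with hH
  set Hl := x (k + 1) - x k with hHl
  have hHpos : 0 < H := sub_pos.2 (m.x_lt (k + 1) hk)
  have hHlpos : 0 < Hl := sub_pos.2 (m.x_lt k (by omega))
  -- Comparing the widths of the two strips requires an edge on the line; without one there is
  -- nothing to estimate.
  rcases L.eq_empty_or_nonempty with hLe | hLne
  · rw [hLe, Finset.sum_empty]
    exact mul_nonneg (by positivity) hms0
  have hcmp : H ≤ M * Hl ∧ Hl ≤ M * H := by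
    obtain ⟨t, ht⟩ := hLne
    exact m.width_comparable P.anisotropic hπ ht
  set g := elementGradient uh
  set J : Finset Plane → ℝ := fun t => g t 0 - g (π t) 0 with hJ
  set E : Finset Plane → ℝ := fun t =>
    |m.partnerJump π uh k (m.lo t 0)| + |m.partnerJump π uh k (m.up t 0)| with hE
  have hE0 : ∀ t, 0 ≤ E t := fun t => add_nonneg (abs_nonneg _) (abs_nonneg _)
  have hLel : ∀ t ∈ L, t ∈ 𝒯.elements := fun t ht => (m.mem_atSide.1 ht).1.1
  have hhpos : ∀ t ∈ L, 0 < m.height t := fun t ht => m.height_pos (hLel t ht)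
  have hDel : D ⊆ 𝒯.elements := Finset.union_subset m.inStrip_subset m.inStrip_subset
  have hwL : ∀ t ∈ L, m.width t = H := fun t ht => by
    simp only [width, (m.mem_atSide.1 ht).1.2, hH]
  -- Smoothing of the jumps J across the edges on the line, with transitions in the middle halves of
  -- the edges.
  obtain ⟨w, hw, hw1, hw2, hw3⟩ := hsteps L (fun t => m.lo t 0) (fun t => m.up t 0) J
    (fun t ht => (m.mem_atSide.1 ht).2)
    (fun s hs t ht hst => m.side_disjoint (hLel s hs) (hLel t ht)
      ((m.mem_atSide.1 hs).1.2.trans (m.mem_atSide.1 ht).1.2.symm) hst 0)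
  have hflat : m.FlatAtNodes (k + 1) 0 w := hw3
  have hflat' := m.flatAtNodes_left hπ hflat
  -- The fraction of the strip widths on which slanted sides move by at most a quarter of the
  -- height; ψ is supported there.
  set τ := 1 / (2 * M ^ 2) with hτ
  have hτ0 : 0 < τ := by positivity
  have hτ1 : τ ≤ 1 / 2 := by
    rw [hτ]; exact one_div_le_one_div_of_le (by norm_num) (by nlinarith)
  have hτM : τ * (2 * M ^ 2) = 1 := by rw [hτ]; field_simp
  set l₀ := τ * Hl with hl₀
  set l₁ := τ * H with hl₁
  have hl₀0 : 0 < l₀ := by positivity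
  have hl₁0 : 0 < l₁ := by positivity
  have hl₀' : l₀ < Hl := by nlinarith
  have hl₁' : l₁ < H := by nlinarith
  obtain ⟨ψ, hψ, hψ1, hψ0, hm₁, hm₀, hψb⟩ := hcut (x (k + 1)) l₀ l₁ hl₀0 hl₁0
  have hnear₀ : ∀ X ∈ Set.Icc (x (k + 1) - l₀) (x (k + 1)), m.NearSide k 1 X := by
    intro X hX
    refine m.nearSide_of_abs_le P.anisotropic P.oriented hM0.le ⟨by linarith [hX.1], hX.2⟩ ?_
    have : |X - x (k + 1)| ≤ l₀ := by rw [abs_le]; constructor <;> linarith [hX.1, hX.2]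
    calc |X - x (k + 1)| * (2 * M ^ 2) ≤ l₀ * (2 * M ^ 2) := by gcongr
      _ = Hl * (τ * (2 * M ^ 2)) := by rw [hl₀]; ring
      _ ≤ Hl := by rw [hτM, mul_one]
  have hnear₁ : ∀ X ∈ Set.Icc (x (k + 1)) (x (k + 1) + l₁), m.NearSide (k + 1) 0 X := by
    intro X hX
    have h2 : X ≤ x (k + 1 + 1) := by
      have : X ≤ x (k + 2) := by linarith [hX.2]
      exact this
    refine m.nearSide_of_abs_le P.anisotropic P.oriented hM0.le ⟨hX.1, h2⟩ ?_
    have : |X - x (k + 1)| ≤ l₁ := by rw [abs_le]; constructor <;> linarith [hX.1, hX.2]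
    calc |X - x (k + 1)| * (2 * M ^ 2) ≤ l₁ * (2 * M ^ 2) := by gcongr
      _ = H * (τ * (2 * M ^ 2)) := by rw [hl₁]; ring
      _ ≤ H := by rw [hτM, mul_one]
  obtain ⟨hmean, hident⟩ := m.sum_integral_shearProd hπ hψ hw hflat hl₀' hl₁' hψ1
    (fun X hX => (hψ0 X hX).1) hm₁ hm₀ hnear₀ hnear₁ g
  set V := shearProd ψ w 0 0 with hV
  have hVc : ContDiff ℝ ∞ V := contDiff_shearProd hψ hw 0 0
  have hVp : ∀ p, V p = ψ (p 0) * w (p 1) := fun p => by simp [hV, shearProd]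
  have htest : IsTestFunction unitSquare V := by
    obtain ⟨t₀, ht₀, hmin⟩ := L.exists_min_image m.height hLne
    set ε := m.height t₀ / 4 with hε
    have hε0 : 0 < ε := by have := hhpos t₀ ht₀; positivity
    have hquart : ∀ t ∈ L, ε ≤ (m.up t 0 - m.lo t 0) / 4 := by
      intro t ht
      rw [← m.height_eq ht]; have := hmin t ht; linarith
    -- Such y lies below the middle part of every edge, as does -1, so w takes the same value at
    -- both; and -1 is outside all edges. This keeps the support of the test function away from the
    -- horizontal boundary.
    have wlow : ∀ y ≤ ε, w y = 0 := by
      intro y hy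
      rw [hw3 y (-1) fun t ht => Or.inl ⟨by
          have := hquart t ht; have := (m.bounds (hLel t ht) 0).1; linarith, by
          have := hquart t ht; have := (m.bounds (hLel t ht) 0).1; linarith⟩]
      exact (hw2 (-1) fun t ht h => by
        have := (m.bounds (hLel t ht) 0).1; have := h.1; linarith).1
    have whigh : ∀ y, 1 - ε ≤ y → w y = 0 := by
      intro y hy
      rw [hw3 y 2 fun t ht => Or.inr ⟨by
          have := hquart t ht; have := (m.bounds (hLel t ht) 0).2; linarith, by
          have := hquart t ht; have := (m.bounds (hLel t ht) 0).2; linarith⟩]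
      exact (hw2 2 fun t ht h => by
        have := (m.bounds (hLel t ht) 0).2; have := h.2; linarith).1
    refine isTestFunction_of_eq_zero hVc (K := {p | p 0 ∈ Set.Icc (x (k + 1) - l₀) (x (k + 1) + l₁)
      ∧ p 1 ∈ Set.Icc ε (1 - ε)}) ?_ ?_ ?_
    · exact (isClosed_Icc.preimage (continuous_coord 0)).inter
        (isClosed_Icc.preimage (continuous_coord 1))
    · rintro p ⟨hp, hp'⟩
      have a0 : 0 ≤ x k := by
        have := m.x_mono (i := 0) (j := k) (by omega) (by omega); rwa [m.x_zero] at this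
      have a1 : x (k + 2) ≤ 1 := by
        have := m.x_mono (i := k + 2) (j := n) (by omega) le_rfl; rwa [m.x_last] at this
      exact ⟨by linarith [hp.1], by linarith [hp.2], by linarith [hp'.1], by linarith [hp'.2]⟩
    · intro p hp
      rw [Set.mem_ofPred_eq, not_and_or, Set.mem_Icc (a := ε), not_and_or, not_le, not_le] at hp
      rw [hVp]
      rcases hp with h | h | h
      · rw [(hψ0 _ h).1, zero_mul]
      · rw [wlow _ h.le, mul_zero]
      · rw [whigh _ h.le, mul_zero]
  have hvanish : ∀ r ∈ 𝒯.elements, r ∉ D → ∀ p ∈ interior (hull r), V p = 0 := by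
    intro r hr hrD p hp
    obtain ⟨q1, q2, -, -⟩ := (m.mem_hull hr).1 (interior_subset hp)
    rw [hVp, (hψ0 (p 0) ?_).1, zero_mul]
    rintro ⟨h1, h2⟩
    have hkr := m.strip_lt r hr
    have hne : m.strip r ≠ k ∧ m.strip r ≠ k + 1 := by
      constructor <;> intro h
      · exact hrD (Finset.mem_union_left _ (m.mem_inStrip.2 ⟨hr, h⟩))
      · exact hrD (Finset.mem_union_right _ (m.mem_inStrip.2 ⟨hr, h⟩))
    rcases lt_or_ge (m.strip r) k with h | h
    · have := m.x_mono (i := m.strip r + 1) (j := k) h (by omega)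
      linarith
    · have := m.x_mono (i := k + 2) (j := m.strip r) (by omega) hkr.le
      linarith
  set T : Finset Plane → Finset (Finset Plane) := fun r => {t ∈ L | ∃ z ∈ r, z ∈ t} with hT
  set A : Finset Plane → ℝ := fun t => (|J t| + E t) / H + E t / m.height t with hA
  have hA0 : ∀ t ∈ L, 0 ≤ A t := fun t ht => by
    have := hhpos t ht; have := hE0 t; positivity
  -- An edge containing y belongs to a neighbour of r. Bounding by the sum over all neighbours
  -- avoids singling out the edge and also covers points on no edge.
  have hwT : ∀ r, ∀ y : ℝ, (∀ t ∈ L, y ∈ Set.Icc (m.lo t 0) (m.up t 0) → ∃ z ∈ r, z ∈ t) →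
      |w y| ≤ ∑ t ∈ T r, (|J t| + E t) ∧ |deriv w y| ≤ ∑ t ∈ T r, K * (E t / m.height t) := by
    intro r y hy
    have p1 : ∀ t ∈ T r, 0 ≤ |J t| + E t := fun t _ => add_nonneg (abs_nonneg _) (hE0 t)
    have p2 : ∀ t ∈ T r, 0 ≤ K * (E t / m.height t) := fun t ht => by
      have := hhpos t (Finset.mem_filter.1 ht).1; have := hE0 t; positivity
    by_cases h : ∃ t ∈ L, y ∈ Set.Icc (m.lo t 0) (m.up t 0)
    · obtain ⟨t, ht, hyt⟩ := h
      have htT : t ∈ T r := Finset.mem_filter.2 ⟨ht, hy t ht hyt⟩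
      obtain ⟨b1, b2⟩ := hw1 t ht y hyt
      constructor
      · refine le_trans ?_ (Finset.single_le_sum p1 htT)
        have := abs_sub_abs_le_abs_sub (w y) (J t)
        change |w y - J t| ≤ E t at b1
        linarith
      · refine le_trans ?_ (Finset.single_le_sum p2 htT)
        rw [m.height_eq ht]
        refine b2.trans (le_of_eq ?_)
        change K / (m.up t 0 - m.lo t 0) * E t = _
        ring
    · push Not at h
      obtain ⟨b1, b2⟩ := hw2 y h
      rw [b1, b2, abs_zero]
      exact ⟨Finset.sum_nonneg p1, Finset.sum_nonneg p2⟩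
  have hbound : ∀ r ∈ D, ∀ p ∈ hull r, p 0 ∈ Set.Icc (x (k + 1) - l₀) (x (k + 1) + l₁) →
      |w (p 1)| ≤ ∑ t ∈ T r, (|J t| + E t) ∧
        |deriv w (p 1)| ≤ ∑ t ∈ T r, K * (E t / m.height t) := by
    intro r hr p hp hpI
    have hwd : Differentiable ℝ w := hw.differentiable (by simp)
    obtain ⟨q1, q2, q3, q4⟩ := (m.mem_hull (hDel hr)).1 hp
    rcases Finset.mem_union.1 hr with h | h
    · rw [(m.mem_inStrip.1 h).2] at q2
      exact hflat'.bound m hwd (hnear₀ (p 0) ⟨hpI.1, q2⟩) h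
        (fun y hy => hwT r y fun t ht hyt => m.exists_shared_node_left hπ h ht hy hyt) ⟨q3, q4⟩
    · rw [(m.mem_inStrip.1 h).2] at q1
      exact hflat.bound m hwd (hnear₁ (p 0) ⟨q1, hpI.2⟩) h
        (fun y hy => hwT r y fun t ht hyt => m.exists_shared_node_right hπ h ht hy hyt) ⟨q3, q4⟩
  set a : Finset Plane → ℝ := fun r => K' * ∑ t ∈ T r, A t with ha
  have hK'0 : 0 < K' := by positivity
  have hTA : ∀ r, 0 ≤ ∑ t ∈ T r, A t := fun r =>
    Finset.sum_nonneg fun t ht => hA0 t (Finset.mem_filter.1 ht).1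
  have hsplit : ∀ r, ∑ t ∈ T r, A t =
      (∑ t ∈ T r, (|J t| + E t)) / H + ∑ t ∈ T r, E t / m.height t := fun r => by
    rw [Finset.sum_div, ← Finset.sum_add_distrib]
  -- Both half-widths of the cut-off are comparable to H, so derivatives of ψ are of size 1/H, with
  -- no 1/h.
  have hll : 1 / l₀ + 1 / l₁ ≤ 2 * M ^ 2 * (M + 1) / H := by
    have e1 : 1 / l₁ = 2 * M ^ 2 / H := by rw [hl₁, hτ]; field_simp
    have e0 : 1 / l₀ = 2 * M ^ 2 / Hl := by rw [hl₀, hτ]; field_simp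
    have e2 : 2 * M ^ 2 / Hl ≤ 2 * M ^ 2 * M / H := by
      rw [div_le_div_iff₀ hHlpos hHpos]
      calc 2 * M ^ 2 * H ≤ 2 * M ^ 2 * (M * Hl) := by gcongr; exact hcmp.1
        _ = _ := by ring
    rw [e0, e1, mul_add, add_div, mul_one]
    linarith
  have hS2 : ∀ r, 0 ≤ ∑ t ∈ T r, E t / m.height t := fun r =>
    Finset.sum_nonneg fun t ht => div_nonneg (hE0 t) (hhpos t (Finset.mem_filter.1 ht).1).le
  have hS1 : ∀ r, 0 ≤ ∑ t ∈ T r, (|J t| + E t) := fun r =>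
    Finset.sum_nonneg fun t ht => add_nonneg (abs_nonneg _) (hE0 t)
  have hgrad : ∀ r ∈ D, ∀ p ∈ hull r, ‖gradient V p‖ ≤ a r := by
    intro r hr p hp
    refine (norm_gradient_shearProd_le hψ hw 0 0 p).trans ?_
    rw [zero_mul, add_zero, sub_zero, abs_zero, zero_add, one_mul]
    by_cases hpI : p 0 ∈ Set.Icc (x (k + 1) - l₀) (x (k + 1) + l₁)
    · obtain ⟨b1, b2⟩ := hbound r hr p hp hpI
      obtain ⟨c1, c2⟩ := hψb (p 0)
      rw [← Finset.mul_sum] at b2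
      have s1 := hS1 r
      have s2 := hS2 r
      set S1 := ∑ t ∈ T r, (|J t| + E t)
      set S2 := ∑ t ∈ T r, E t / m.height t
      calc |deriv ψ (p 0)| * |w (p 1)| + |ψ (p 0)| * |deriv w (p 1)|
          ≤ B * (1 / l₀ + 1 / l₁) * S1 + B * (K * S2) := by gcongr
        _ ≤ B * (2 * M ^ 2 * (M + 1) / H) * S1 + B * (K * S2) := by gcongr
        _ = B * (2 * M ^ 2 * (M + 1)) * (S1 / H) + B * K * S2 := by ring
        _ ≤ K' * (S1 / H) + K' * S2 := by
          have e1 : B * (2 * M ^ 2 * (M + 1)) ≤ K' := by rw [hK']; gcongr; linarith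
          have e2 : B * K ≤ K' := by
            rw [hK']; gcongr
            have : 0 ≤ 2 * M ^ 2 * (M + 1) := by positivity
            linarith
          gcongr
        _ = a r := by simp only [ha, hsplit]; ring
    · rw [(hψ0 _ hpI).1, (hψ0 _ hpI).2]
      simpa using mul_nonneg hK'0.le (hTA r)
  -- Elements of either strip have diameter at least H/M, which compensates the 1/H in the gradient
  -- weight.
  have hval : ∀ r ∈ D, ∀ p ∈ hull r, |V p| ≤ Metric.diam (hull r) * a r := by
    intro r hr p hp
    by_cases hpI : p 0 ∈ Set.Icc (x (k + 1) - l₀) (x (k + 1) + l₁)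
    · obtain ⟨b1, -⟩ := hbound r hr p hp hpI
      have hdiam : H / M ≤ Metric.diam (hull r) := by
        have := (m.tri r (hDel hr)).width_le_diam
        refine le_trans ?_ this
        rw [div_le_iff₀ hM0]
        rcases Finset.mem_union.1 hr with h | h
        · rw [(m.mem_inStrip.1 h).2, mul_comm]; exact hcmp.1
        · rw [(m.mem_inStrip.1 h).2]
          exact le_mul_of_one_le_right hHpos.le hM
      have s1 := hS1 r
      have s2 := hS2 r
      rw [hVp, abs_mul]
      simp only [ha, hsplit]
      set S1 := ∑ t ∈ T r, (|J t| + E t)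
      set S2 := ∑ t ∈ T r, E t / m.height t
      calc |ψ (p 0)| * |w (p 1)| ≤ B * S1 := by
            have := (hψb (p 0)).1
            gcongr
        _ = H / M * (B * M * (S1 / H)) := by field_simp
        _ ≤ H / M * (K' * (S1 / H + S2)) := by
          have e1 : B * M ≤ K' := by
            rw [hK']; gcongr; nlinarith [mul_pos hM0 hM0]
          have e2 : S1 / H ≤ S1 / H + S2 := by linarith
          gcongr
        _ ≤ _ := by gcongr
    · rw [hVp, (hψ0 _ hpI).1]
      simpa using mul_nonneg Metric.diam_nonneg (mul_nonneg hK'0.le (hTA r))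
  have key := abs_sum_inner_gradient_le (uh := uh) P.data P.weak htest hDel hvanish hmean hgrad hval
  rw [hident, abs_neg] at key
  -- The area of r is exchanged for that of its neighbour t at the cost of M, and the double sum
  -- over neighbours is separated into edge weights and errors.
  have hRHS : ∑ r ∈ D, a r * √(2 * area (hull r) * localError f uh G r) ≤
      R * √(∑ t ∈ L, A t ^ 2 * (m.height t * H)) * √ms := by
    have e1 : ∀ r ∈ D, a r * √(2 * area (hull r) * localError f uh G r) ≤
        K' * √M * ∑ t ∈ T r, √(A t ^ 2 * (m.height t * H)) * √(localError f uh G r) := by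
      intro r hr
      simp only [ha]
      rw [mul_assoc K', mul_assoc K' √M, Finset.sum_mul, Finset.mul_sum (a := √M)]
      refine mul_le_mul_of_nonneg_left (Finset.sum_le_sum fun t ht => ?_) hK'0.le
      obtain ⟨htL, z, hzr, hzt⟩ := Finset.mem_filter.1 ht
      have ha1 := area_le P.anisotropic (hDel hr) (hLel t htL) hzr hzt
      rw [m.area_hull (hLel t htL), hwL t htL] at ha1
      have hm := localError_nonneg f uh G r
      have hh := hhpos t htL
      rw [Real.sqrt_mul (sq_nonneg _), Real.sqrt_sq (hA0 t htL)]
      calc A t * √(2 * area (hull r) * localError f uh G r)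
          ≤ A t * √(M * (m.height t * H) * localError f uh G r) := by
            have h2 : 2 * area (hull r) ≤ M * (m.height t * H) := by linarith
            exact mul_le_mul_of_nonneg_left
              (Real.sqrt_le_sqrt (mul_le_mul_of_nonneg_right h2 hm)) (hA0 t htL)
        _ = _ := by
          rw [Real.sqrt_mul (by positivity), Real.sqrt_mul hM0.le]; ring
    refine (Finset.sum_le_sum e1).trans ?_
    rw [← Finset.mul_sum, hR, mul_assoc (K' * √M), mul_assoc (K' * √M)]
    refine mul_le_mul_of_nonneg_left ?_ (by positivity)
    have := m.sum_neighbours_mul_le P.anisotropic hDel (fun t ht => hLel t ht) hM0.le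
      (fun t => √(A t ^ 2 * (m.height t * H))) (fun r => √(localError f uh G r))
    refine this.trans (le_of_eq ?_)
    have i1 : ∑ t ∈ L, √(A t ^ 2 * (m.height t * H)) ^ 2 = ∑ t ∈ L, A t ^ 2 * (m.height t * H) :=
      Finset.sum_congr rfl fun t ht => Real.sq_sqrt (by have := hhpos t ht; positivity)
    have i2 : ∑ r ∈ D, √(localError f uh G r) ^ 2 = ms :=
      Finset.sum_congr rfl fun r _ => Real.sq_sqrt (localError_nonneg _ _ _ _)
    rw [i1, i2]
  -- On each edge ∫w differs from h J by at most h E, and the E are small in the sum; the absorption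
  -- argument applies.
  have final := sum_jump_sq_le L m.height J E (fun t => ∫ y in (m.lo t 0)..(m.up t 0), w y)
    (c := c) (R := R) (N := CD * ms) (ms := ms) hHpos hhpos (fun t _ => hE0 t)
    (fun t ht => by
      have := m.height_le_mul_width P.angle_lt P.maxAngle (hLel t ht)
      rwa [hwL t ht] at this) hc0
    (fun t ht => by
      have hlt := (m.mem_atSide.1 ht).2
      have e1 : (∫ y in (m.lo t 0)..(m.up t 0), w y) - m.height t * J t =
          ∫ y in (m.lo t 0)..(m.up t 0), (w y - J t) := by
        rw [intervalIntegral.integral_sub (hw.continuous.intervalIntegrable _ _)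
          (continuous_const.intervalIntegrable _ _), intervalIntegral.integral_const,
          m.height_eq ht, smul_eq_mul]
      rw [e1, m.height_eq ht, mul_comm]
      have := intervalIntegral.norm_integral_le_of_norm_le_const (a := m.lo t 0) (b := m.up t 0)
        (f := fun y => w y - J t) (C := E t) (fun y hy => by
          rw [Set.uIoc_of_le hlt.le] at hy
          exact (hw1 t ht y ⟨hy.1.le, hy.2⟩).1)
      rwa [abs_of_pos (sub_pos.2 hlt)] at this)
    (hsumD m P hk hπ) hms0 (key.trans hRHS)
  refine final.trans (le_of_eq ?_)
  ring

end StripMesh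

/-! ### Edges, their two elements and their normal jumps -/

lemma Triangulation.mem_elementsAt {Ω : Set Plane} {𝒯 : Triangulation Ω} {S t : Finset Plane} :
    t ∈ 𝒯.elementsAt S ↔ t ∈ 𝒯.elements ∧ S ⊆ t := by
  simp [elementsAt]

namespace StripMesh

variable {𝒯 : Triangulation unitSquare} {n : ℕ} {x : ℕ → ℝ} (m : StripMesh 𝒯 n x)
  {r s t : Finset Plane} {c₀ α M : ℝ} {f u uh v : Plane → ℝ} {G : Plane → Plane} {k : ℕ}
  {b : Fin 2} {X y : ℝ} {π : Finset Plane → Finset Plane}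

lemma side_eq (ht : t ∈ 𝒯.elements) {y₀ y₁ : ℝ} (h0 : pt (x (m.strip t)) y₀ ∈ t)
    (h1 : pt (x (m.strip t + 1)) y₁ ∈ t) :
    (y₀ = m.lo t 0 ∧ y₁ = m.lo t 1) ∨ (y₀ = m.up t 0 ∧ y₁ = m.up t 1) := by
  have hs := (m.tri t ht).shape
  rcases m.eq_lo_or_up_zero ht h0 with h | h <;> rcases m.eq_lo_or_up_one ht h1 with h' | h' <;>
    rcases hs with ⟨-, e⟩ | ⟨e, -⟩ <;> simp [h, h', e]

/-- The edge of an element along its upper side. -/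
def upperEdge (t : Finset Plane) : Set Plane :=
  {pt (x (m.strip t)) (m.up t 0), pt (x (m.strip t + 1)) (m.up t 1)}

/-- The edge of an element on the left vertical line. -/
def leftEdge (t : Finset Plane) : Set Plane :=
  {pt (x (m.strip t)) (m.lo t 0), pt (x (m.strip t)) (m.up t 0)}

/-- An edge joining neighbouring lines fixes the strip of any element containing it and is its lower
or upper side; lower and upper sides determine the element. -/
lemma elementsAt_upperEdge {S : Finset Plane} (hS : (S : Set Plane) = m.upperEdge s)
    (hs : s ∈ 𝒯.elements) (ht : t ∈ 𝒯.elements) (hst : m.strip s = m.strip t)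
    (h : m.lo t = m.up s) : 𝒯.elementsAt S = {s, t} := by
  have hsub : ∀ r : Finset Plane, S ⊆ r ↔ pt (x (m.strip s)) (m.up s 0) ∈ r ∧
      pt (x (m.strip s + 1)) (m.up s 1) ∈ r := by
    intro r
    rw [← Finset.coe_subset, hS, upperEdge, Set.insert_subset_iff, Set.singleton_subset_iff]
    rfl
  ext r
  rw [mem_elementsAt, hsub, Finset.mem_insert, Finset.mem_singleton]
  constructor
  · rintro ⟨hr, h0, h1⟩
    have hk := m.strip_eq_of_mem hr (m.strip_lt s hs) h0 h1
    rw [← hk] at h0 h1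
    rcases m.side_eq hr h0 h1 with ⟨e0, e1⟩ | ⟨e0, e1⟩
    · right
      refine m.eq_of_lo_eq hr ht (hk.trans hst) ?_
      rw [h]; funext b; fin_cases b
      · exact e0.symm
      · exact e1.symm
    · left
      refine m.eq_of_up_eq hr hs hk ?_
      funext b; fin_cases b
      · exact e0.symm
      · exact e1.symm
  · rintro (rfl | rfl)
    · exact ⟨hs, (m.vertex_mem hs).2.1, (m.vertex_mem hs).2.2.2⟩
    · refine ⟨ht, ?_, ?_⟩
      · rw [← h, hst]; exact (m.vertex_mem ht).1
      · rw [← h, hst]; exact (m.vertex_mem ht).2.2.1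

lemma mem_atSide_left_eq (hr : r ∈ 𝒯.elements) (hk : m.strip r = k + 1)
    (ht : t ∈ m.atSide (k + 1) 0) (hrS : pt (x (k + 1)) (m.lo t 0) ∈ r)
    (hrS' : pt (x (k + 1)) (m.up t 0) ∈ r) : r = t := by
  obtain ⟨⟨t1, t2⟩, t3⟩ := m.mem_atSide.1 ht
  rw [← hk] at hrS hrS'
  by_contra hne
  have hle := (m.tri r hr).le 0
  rcases m.side_disjoint hr t1 (hk.trans t2.symm) hne 0 with h | h <;>
  rcases m.eq_lo_or_up_zero hr hrS with e | e <;>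
  rcases m.eq_lo_or_up_zero hr hrS' with e' | e' <;> linarith

lemma mem_atSide_right_eq (hr : r ∈ 𝒯.elements) (hk : m.strip r = k)
    (ht : t ∈ m.atSide k 1) (hrS : pt (x (k + 1)) (m.lo t 1) ∈ r)
    (hrS' : pt (x (k + 1)) (m.up t 1) ∈ r) : r = t := by
  obtain ⟨⟨t1, t2⟩, t3⟩ := m.mem_atSide.1 ht
  rw [← hk] at hrS hrS'
  by_contra hne
  have hle := (m.tri r hr).le 1
  rcases m.side_disjoint hr t1 (hk.trans t2.symm) hne 1 with h | h <;>
  rcases m.eq_lo_or_up_one hr hrS with e | e <;>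
  rcases m.eq_lo_or_up_one hr hrS' with e' | e' <;> linarith

lemma strip_of_vertex (hr : r ∈ 𝒯.elements) {j : ℕ} (hj : j ≤ n) (h : pt (x j) y ∈ r) :
    m.strip r = j ∨ m.strip r + 1 = j := by
  have hk := m.strip_lt r hr
  rcases (m.tri r hr).mem_iff.1 h with h | h | h | h
  · exact Or.inl (m.x_inj hk.le hj (pt_inj.1 h).1.symm)
  · exact Or.inl (m.x_inj hk.le hj (pt_inj.1 h).1.symm)
  · exact Or.inr (m.x_inj hk hj (pt_inj.1 h).1.symm)
  · exact Or.inr (m.x_inj hk hj (pt_inj.1 h).1.symm)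

lemma elementsAt_leftEdge {S : Finset Plane} (hS : (S : Set Plane) = m.leftEdge t)
    (hπ : m.IsPartner k π) (ht : t ∈ m.atSide (k + 1) 0) : 𝒯.elementsAt S = {π t, t} := by
  obtain ⟨⟨t1, t2⟩, t3⟩ := m.mem_atSide.1 ht
  obtain ⟨⟨s1, s2⟩, s3⟩ := m.mem_atSide.1 (hπ.mem t ht)
  obtain ⟨v1, v2, w1, w2⟩ := m.partner_node_mem hπ ht
  have hsub : ∀ r : Finset Plane, S ⊆ r ↔ pt (x (k + 1)) (m.lo t 0) ∈ r ∧
      pt (x (k + 1)) (m.up t 0) ∈ r := by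
    intro r
    rw [← Finset.coe_subset, hS, leftEdge, Set.insert_subset_iff, Set.singleton_subset_iff, t2]
    rfl
  ext r
  rw [mem_elementsAt, hsub, Finset.mem_insert, Finset.mem_singleton]
  constructor
  · rintro ⟨hr, h0, h1⟩
    have hn := m.strip_lt t t1
    rcases m.strip_of_vertex hr (by omega) h0 with h | h
    · exact Or.inr (m.mem_atSide_left_eq hr h ht h0 h1)
    · left
      refine m.mem_atSide_right_eq hr (by omega) (hπ.mem t ht) ?_ ?_
      · rw [hπ.lo t ht]; exact h0
      · rw [hπ.up t ht]; exact h1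
  · rintro (rfl | rfl)
    · exact ⟨s1, w1, w2⟩
    · exact ⟨t1, v1, v2⟩

/-- The jump in terms of a unit normal to the edge. -/
lemma jump_eq_of_normal {S : Finset Plane} (hS : 𝒯.elementsAt S = {s, t}) (hst : s ≠ t)
    {p q rs rt N : Plane} (hSpq : (S : Set Plane) = {p, q}) (hs : (s : Set Plane) = {p, q, rs})
    (ht : (t : Set Plane) = {p, q, rt}) (hpq : p ≠ q) (hN : ‖N‖ = 1) (hNpq : ⟪N, q - p⟫ = 0)
    (hrs : ⟪N, rs - p⟫ < 0) (hrt : 0 < ⟪N, rt - p⟫) (v : Plane → ℝ) :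
    𝒯.jump v S = ⟪elementGradient v s - elementGradient v t, N⟫ := by
  rw [jump, hS, Finset.sum_pair hst, outerNormal_eq hSpq ht hpq hN hNpq hrt,
    outerNormal_eq (N := -N) hSpq hs hpq (by rwa [norm_neg]) (by rw [inner_neg_left, hNpq, neg_zero])
      (by rw [inner_neg_left]; linarith), neg_neg, inner_neg_right, inner_sub_left]
  ring

/-- The normal jump is the component of the difference of the two gradients along a unit vector. -/
lemma jump_upperEdge_sq_le {S : Finset Plane} (hS : (S : Set Plane) = m.upperEdge s)
    (hs : s ∈ 𝒯.elements) (ht : t ∈ 𝒯.elements) (hst : m.strip s = m.strip t)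
    (h : m.lo t = m.up s) (v : Plane → ℝ) : 𝒯.jump v S ^ 2 ≤
      (elementGradient v t 0 - elementGradient v s 0) ^ 2 +
        (elementGradient v t 1 - elementGradient v s 1) ^ 2 := by
  have hne : s ≠ t := by
    rintro rfl
    have h1 := congrFun h 0
    have h2 := congrFun h 1
    have := m.height_pos hs
    simp only [height] at this
    linarith
  have hTt : StripTriangle t (x (m.strip s)) (x (m.strip s + 1)) (m.lo t) (m.up t) := by
    rw [hst]; exact m.tri t ht
  have hw := m.width_pos hs
  set H := m.width s with hH
  have hX1 : x (m.strip s + 1) = x (m.strip s) + H := by rw [hH, width]; ring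
  set X₀ := x (m.strip s) with hX₀
  set p := pt X₀ (m.up s 0) with hp
  set q := pt (X₀ + H) (m.up s 1) with hq
  have hpq : p ≠ q := fun e => by
    have := (pt_inj.1 e).1; linarith
  set d := m.up s 1 - m.up s 0 with hd
  set ν := √(d ^ 2 + H ^ 2) with hν
  have hν0 : 0 < ν := Real.sqrt_pos.2 (by positivity)
  have hνsq : ν ^ 2 = d ^ 2 + H ^ 2 := Real.sq_sqrt (by positivity)
  -- The unit normal pointing upwards, from s to t; the edge has direction (H, d).
  set N := pt (-d / ν) (H / ν) with hNdef
  have hN : ‖N‖ = 1 := by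
    have : ‖N‖ ^ 2 = 1 := by
      rw [plane_norm_sq, hNdef, pt_zero, pt_one, div_pow, div_pow, neg_sq, ← add_div, ← hνsq,
        div_self (by positivity)]
    exact (pow_eq_one_iff_of_nonneg (norm_nonneg _) two_ne_zero).1 this
  have hSpq : (S : Set Plane) = {p, q} := by rw [hS, upperEdge, hX1]
  have hNpq : ⟪N, q - p⟫ = 0 := by
    rw [plane_inner]
    simp only [hNdef, hp, hq, PiLp.sub_apply, pt_zero, pt_one]
    field_simp; ring
  have hTs := m.tri s hs
  rw [hX1, h] at hTt
  rw [hX1] at hTs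
  obtain ⟨rs, hrs, hrs'⟩ : ∃ rs, (s : Set Plane) = {p, q, rs} ∧ ⟪N, rs - p⟫ < 0 := by
    rcases hTs.shape with ⟨h1, h2⟩ | ⟨h1, h2⟩
    · refine ⟨pt X₀ (m.lo s 0), ?_, ?_⟩
      · rw [hTs.coe_eq, h2]; ext z; simp [hp, hq]; tauto
      · rw [plane_inner]
        simp only [hNdef, hp, PiLp.sub_apply, pt_zero, pt_one, sub_self, mul_zero, zero_add]
        exact mul_neg_of_pos_of_neg (by positivity) (by linarith)
    · refine ⟨pt (X₀ + H) (m.lo s 1), ?_, ?_⟩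
      · rw [hTs.coe_eq, h1]; ext z; simp [hp, hq]; tauto
      · rw [plane_inner]
        simp only [hNdef, hp, PiLp.sub_apply, pt_zero, pt_one]
        have : -d / ν * (X₀ + H - X₀) + H / ν * (m.lo s 1 - m.up s 0) =
            H / ν * (m.lo s 1 - m.up s 1) := by rw [hd]; field_simp; ring
        rw [this]
        exact mul_neg_of_pos_of_neg (by positivity) (by linarith)
  obtain ⟨rt, hrt, hrt'⟩ : ∃ rt, (t : Set Plane) = {p, q, rt} ∧ 0 < ⟪N, rt - p⟫ := by
    rcases hTt.shape with ⟨h1, h2⟩ | ⟨h1, h2⟩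
    · refine ⟨pt X₀ (m.up t 0), ?_, ?_⟩
      · rw [hTt.coe_eq, ← h2]; ext z; simp [hp, hq]; tauto
      · rw [plane_inner]
        simp only [hNdef, hp, PiLp.sub_apply, pt_zero, pt_one, sub_self, mul_zero, zero_add]
        exact mul_pos (by positivity) (by linarith)
    · refine ⟨pt (X₀ + H) (m.up t 1), ?_, ?_⟩
      · rw [hTt.coe_eq, ← h1]; ext z; simp [hp, hq]
      · rw [plane_inner]
        simp only [hNdef, hp, PiLp.sub_apply, pt_zero, pt_one]
        have : -d / ν * (X₀ + H - X₀) + H / ν * (m.up t 1 - m.up s 0) =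
            H / ν * (m.up t 1 - m.up s 1) := by rw [hd]; field_simp; ring
        rw [this]
        exact mul_pos (by positivity) (by linarith)
  rw [jump_eq_of_normal (m.elementsAt_upperEdge hS hs ht hst h) hne hSpq hrs hrt hpq hN hNpq hrs'
    hrt' v]
  have hcs := abs_real_inner_le_norm (elementGradient v s - elementGradient v t) N
  rw [hN, mul_one] at hcs
  have h2 := plane_norm_sq (elementGradient v s - elementGradient v t)
  simp only [PiLp.sub_apply] at h2
  rw [← sq_abs]
  calc _ ≤ ‖elementGradient v s - elementGradient v t‖ ^ 2 := by gcongr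
    _ = _ := by rw [h2]; ring

lemma jump_leftEdge {S : Finset Plane} (hS : (S : Set Plane) = m.leftEdge t)
    (hπ : m.IsPartner k π) (ht : t ∈ m.atSide (k + 1) 0) (v : Plane → ℝ) :
    𝒯.jump v S ^ 2 = (elementGradient v t 0 - elementGradient v (π t) 0) ^ 2 := by
  obtain ⟨⟨t1, t2⟩, t3⟩ := m.mem_atSide.1 ht
  obtain ⟨⟨s1, s2⟩, s3⟩ := m.mem_atSide.1 (hπ.mem t ht)
  have hne : π t ≠ t := fun e => by rw [e] at s2; omega
  have hN : ‖pt 1 0‖ = 1 := by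
    have : ‖pt 1 0‖ ^ 2 = 1 := by rw [plane_norm_sq]; simp
    exact (pow_eq_one_iff_of_nonneg (norm_nonneg _) two_ne_zero).1 this
  have hSpq : (S : Set Plane) = {pt (x (k + 1)) (m.lo t 0), pt (x (k + 1)) (m.up t 0)} := by
    rw [hS, leftEdge, t2]
  have hT := m.tri t t1
  have hTs := m.tri _ s1
  rw [t2] at hT
  rw [s2] at hTs
  have e1 : m.lo t 1 = m.up t 1 := by
    rcases hT.shape with h | h
    · exact h.2
    · exact absurd h.1 t3.ne
  have e0 : m.lo (π t) 0 = m.up (π t) 0 := by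
    rcases hTs.shape with h | h
    · exact absurd h.2 s3.ne
    · exact h.1
  have hrt : (t : Set Plane) = {pt (x (k + 1)) (m.lo t 0), pt (x (k + 1)) (m.up t 0),
      pt (x (k + 1 + 1)) (m.up t 1)} := by
    rw [hT.coe_eq, e1]; ext z; simp
  have hrs : ((π t : Finset Plane) : Set Plane) = {pt (x (k + 1)) (m.lo t 0),
      pt (x (k + 1)) (m.up t 0), pt (x k) (m.up (π t) 0)} := by
    rw [hTs.coe_eq, e0, hπ.lo t ht, hπ.up t ht]; ext z; simp; tauto
  have hx1 := m.x_lt (k + 1) (by have := m.strip_lt t t1; omega)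
  have hx0 := m.x_lt k (by have := m.strip_lt t t1; omega)
  rw [jump_eq_of_normal (m.elementsAt_leftEdge hS hπ ht) hne hSpq hrs hrt
    (fun e => t3.ne (pt_inj.1 e).2) hN (by rw [plane_inner]; simp)
    (by rw [plane_inner]; simpa using hx0) (by rw [plane_inner]; simpa using hx1) v, plane_inner]
  simp only [PiLp.sub_apply, pt_zero, pt_one]
  ring

end StripMesh

/-- A label is chosen for every S; since a label determines S, the choice is injective and the sum
over S embeds into the sum over labels. -/
lemma sum_le_sum_of_classified {ι κ : Type*} [DecidableEq κ] {A : Finset ι} {B : Finset κ}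
    {f : ι → ℝ} {F : κ → ℝ} {rel : κ → ι → Prop} (hF : ∀ b ∈ B, 0 ≤ F b)
    (h : ∀ S ∈ A, ∃ b ∈ B, rel b S ∧ f S ≤ F b) (huniq : ∀ b S S', rel b S → rel b S' → S = S') :
    ∑ S ∈ A, f S ≤ ∑ b ∈ B, F b := by
  rcases A.eq_empty_or_nonempty with rfl | ⟨S₀, hS₀⟩
  · simpa using Finset.sum_nonneg hF
  have : Nonempty κ := ⟨(h S₀ hS₀).choose⟩
  choose! e he1 he2 he3 using h
  calc ∑ S ∈ A, f S ≤ ∑ S ∈ A, F (e S) := Finset.sum_le_sum he3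
    _ = ∑ b ∈ A.image e, F b := by
      rw [Finset.sum_image]
      intro S hS S' hS' hee
      exact huniq (e S) S S' (he2 S hS) (hee ▸ he2 S' hS')
    _ ≤ ∑ b ∈ B, F b := by
      refine Finset.sum_le_sum_of_subset_of_nonneg (fun b hb => ?_) fun b hb _ => hF b hb
      obtain ⟨S, hS, rfl⟩ := Finset.mem_image.1 hb
      exact he1 S hS

lemma Triangulation.area_edgePatch_le {𝒯 : Triangulation unitSquare} {S s t : Finset Plane}
    (h : 𝒯.elementsAt S = {s, t}) : area (𝒯.edgePatch S) ≤ area (hull s) + area (hull t) := by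
  have : 𝒯.edgePatch S = hull s ∪ hull t := by
    rw [edgePatch, h]; ext p; simp
  rw [this]
  exact measureReal_union_le _ _

/-! ### Local errors in two strips and the classification of edges -/

namespace StripMesh

variable {𝒯 : Triangulation unitSquare} {n : ℕ} {x : ℕ → ℝ} (m : StripMesh 𝒯 n x)
  {r s t : Finset Plane} {c₀ α M : ℝ} {f u uh v : Plane → ℝ} {G : Plane → Plane} {k : ℕ}
  {b : Fin 2} {X y : ℝ} {π : Finset Plane → Finset Plane}

lemma interior_hull_subset (hk : k + 1 < n) (hr : r ∈ m.inStrip k ∪ m.inStrip (k + 1)) :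
    interior (hull r) ⊆ openRect (x k) (x (k + 2)) 0 1 := by
  rw [← interior_closedRect]
  refine interior_mono fun p hp => ?_
  have hr1 : r ∈ 𝒯.elements := by
    rcases Finset.mem_union.1 hr with h | h <;> exact m.inStrip_subset h
  have hpc := 𝒯.subset_closure_of_mem_elements hr1 hp
  rw [closure_unitSquare] at hpc
  obtain ⟨q1, q2, -, -⟩ := (m.mem_hull hr1).1 hp
  have h1 := m.x_lt k (by omega)
  have h2 := m.x_lt (k + 1) hk
  rcases Finset.mem_union.1 hr with h | h
  · rw [(m.mem_inStrip.1 h).2] at q1 q2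
    exact ⟨q1, q2.trans h2.le, hpc.2.2⟩
  · rw [(m.mem_inStrip.1 h).2] at q1 q2
    exact ⟨h1.le.trans q1, q2, hpc.2.2⟩

/-- Elements of the two strips lie in the rectangle up to null sets and overlap only in null sets,
so their squared errors add up to at most the integrals over the rectangle. -/
lemma sum_localError_le (hu : IsWeakSolution unitSquare f u G) (huh : uh ∈ 𝒯.FESpace)
    (hk : k + 1 < n) :
    ∑ r ∈ m.inStrip k ∪ m.inStrip (k + 1), localError f uh G r ≤
      gradientError uh G (openRect (x k) (x (k + 2)) 0 1) ^ 2 +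
        𝒯.dataOscillation f (openRect (x k) (x (k + 2)) 0 1) ^ 2 := by
  set D := m.inStrip k ∪ m.inStrip (k + 1) with hD
  set Q := openRect (x k) (x (k + 2)) 0 1 with hQ
  have hDel : D ⊆ 𝒯.elements := Finset.union_subset m.inStrip_subset m.inStrip_subset
  set F : Plane → ℝ := fun p => ‖gradient uh p - G p‖ ^ 2 with hF
  have hae : ∀ t ∈ 𝒯.elements, (fun p => ‖elementGradient uh t - G p‖ ^ 2)
      =ᵐ[volume.restrict (hull t)] F := by
    intro t ht
    filter_upwards [ae_mem_interior_hull t] with p hp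
    simp only [hF, (m.elementGradient_spec huh ht).1 p hp]
  have hint : ∀ t ∈ 𝒯.elements, IntegrableOn F (hull t) := by
    intro t ht
    have hG2 : MemLp (fun p => elementGradient uh t - G p) 2 (volume.restrict (hull t)) := by
      have : IsFiniteMeasure (volume.restrict (hull t)) :=
        ⟨by rw [Measure.restrict_apply_univ]; exact (volume_hull_ne_top t).lt_top⟩
      exact (memLp_const _).sub (hu.1.2.1.mono_measure (restrict_hull_le ht))
    exact (hG2.integrable_norm_pow (by norm_num)).congr (hae t ht)
  have hQcl : Q ⊆ closure unitSquare := by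
    rw [closure_unitSquare]
    rintro p ⟨h1, h2, h3, h4⟩
    have a0 : 0 ≤ x k := by
      have := m.x_mono (i := 0) (j := k) (by omega) (by omega); rwa [m.x_zero] at this
    have a1 : x (k + 2) ≤ 1 := by
      have := m.x_mono (i := k + 2) (j := n) (by omega) le_rfl; rwa [m.x_last] at this
    exact ⟨by linarith, by linarith, h3.le, h4.le⟩
  have hFQ : IntegrableOn F Q := by
    have h1 : IntegrableOn F (⋃ t ∈ 𝒯.elements, hull t) :=
      (integrableOn_finset_iUnion).2 hint
    refine h1.mono_set (hQcl.trans fun p hp => ?_)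
    obtain ⟨t, ht, hpt⟩ := 𝒯.exists_element_of_mem hp
    exact Set.mem_biUnion (x := t) ht hpt
  have e1 : ∑ r ∈ D, ∫ p in hull r, ‖elementGradient uh r - G p‖ ^ 2 ≤
      gradientError uh G Q ^ 2 := by
    rw [gradientError, Real.sq_sqrt (integral_nonneg fun _ => sq_nonneg _)]
    have hsum : ∑ r ∈ D, ∫ p in hull r, ‖elementGradient uh r - G p‖ ^ 2 =
        ∑ r ∈ D, ∫ p in hull r ∩ Q, F p := by
      refine Finset.sum_congr rfl fun r hr => ?_
      rw [integral_congr_ae (hae r (hDel hr))]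
      refine setIntegral_congr_set ?_
      have h0 := ae_mem_interior_hull r
      rw [ae_restrict_iff' (measurableSet_hull r)] at h0
      filter_upwards [h0] with p hp
      refine propext ⟨fun h => ⟨h, m.interior_hull_subset hk hr (hp h)⟩, fun h => h.1⟩
    have hun : ∫ p in ⋃ r : D, hull (r : Finset Plane) ∩ Q, F p =
        ∑ r ∈ D, ∫ p in hull r ∩ Q, F p := by
      rw [integral_iUnion_ae, tsum_fintype,
        Finset.sum_coe_sort D (fun t => ∫ p in hull t ∩ Q, F p)]
      · exact fun t =>
          ((measurableSet_hull _).inter (measurableSet_openRect _ _ _ _)).nullMeasurableSet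
      · intro s t hst
        exact (aedisjoint_hull (hDel s.2) (hDel t.2) (fun h => hst (Subtype.ext h))).mono
          Set.inter_subset_left Set.inter_subset_left
      · exact hFQ.mono_set (Set.iUnion_subset fun r => Set.inter_subset_right)
    rw [hsum, ← hun]
    refine setIntegral_mono_set hFQ (ae_of_all _ fun _ => sq_nonneg _) ?_
    exact (Set.iUnion_subset fun r => Set.inter_subset_right).eventuallyLE
  have e2 : ∑ r ∈ D, (Metric.diam (hull r) * osc f (hull r)) ^ 2 * area (hull r) ≤
      𝒯.dataOscillation f Q ^ 2 := by
    have hnn : ∀ t, 0 ≤ (Metric.diam (hull t) * osc f (hull t)) ^ 2 * area (hull t ∩ Q) :=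
      fun t => mul_nonneg (sq_nonneg _) measureReal_nonneg
    rw [dataOscillation, Real.sq_sqrt (Finset.sum_nonneg fun t _ => hnn t)]
    refine le_trans (Finset.sum_le_sum fun r hr => ?_)
      (Finset.sum_le_sum_of_subset_of_nonneg hDel fun t _ _ => hnn t)
    refine le_of_eq ?_
    congr 1
    refine measureReal_congr ?_
    have h0 := ae_mem_interior_hull r
    rw [ae_restrict_iff' (measurableSet_hull r)] at h0
    filter_upwards [h0] with p hp
    exact propext ⟨fun h => ⟨h, m.interior_hull_subset hk hr (hp h)⟩, fun h => h.1⟩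
  simp only [localError]
  rw [Finset.sum_add_distrib]
  exact add_le_add e1 e2

/-- The conditions on the ordinates exclude the edges on y = 0 and y = 1. If the edge is the lower
side of t, the element below t has it as upper side. -/
lemma exists_upperEdge (ht : t ∈ 𝒯.elements) {p q : Plane} (hp : p ∈ t) (hq : q ∈ t)
    (hp0 : p 0 = x (m.strip t)) (hq0 : q 0 = x (m.strip t + 1)) (h0 : 0 < p 1 + q 1)
    (h1 : p 1 + q 1 < 2) : ∃ r ∈ m.belowTop (m.strip t), ({p, q} : Set Plane) = m.upperEdge r := by
  have hp' := pt_eta p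
  have hq' := pt_eta q
  rw [hp0] at hp'
  rw [hq0] at hq'
  rw [← hp'] at hp
  rw [← hq'] at hq
  rcases m.side_eq ht hp hq with ⟨e0, e1⟩ | ⟨e0, e1⟩
  · obtain ⟨r, hr, hr1, hr2⟩ := m.exists_below ht (fun h => by
      rw [e0, e1, h.1, h.2] at h0; linarith)
    refine ⟨r, Finset.mem_filter.2 ⟨m.mem_inStrip.2 ⟨hr, hr1⟩, fun h => ?_⟩, ?_⟩
    · rw [hr2] at h; rw [e0, e1, h.1, h.2] at h1; linarith
    · rw [upperEdge, hr2, hr1, ← e0, ← e1, hp', hq']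
  · refine ⟨t, Finset.mem_filter.2 ⟨m.mem_inStrip.2 ⟨ht, rfl⟩, fun h => ?_⟩, ?_⟩
    · rw [e0, e1, h.1, h.2] at h1; linarith
    · rw [upperEdge, ← e0, ← e1, hp', hq']

/-- The midpoint of the edge locates the strip of an element containing it, and the endpoints lie on
the lines bounding this strip: both on one line or one on each. -/
lemma classify_edge (hk : k + 1 < n) (hπ : m.IsPartner k π) {S : Finset Plane} (hS : S ∈ 𝒯.edges)
    (hSQ : hull S \ (S : Set Plane) ⊆ openRect (x k) (x (k + 2)) 0 1) :
    (∃ t ∈ m.atSide (k + 1) 0, (S : Set Plane) = m.leftEdge t) ∨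
    (∃ r ∈ m.belowTop k, (S : Set Plane) = m.upperEdge r) ∨
    ∃ r ∈ m.belowTop (k + 1), (S : Set Plane) = m.upperEdge r := by
  obtain ⟨hSf, hS2⟩ := mem_edges.1 hS
  obtain ⟨p, q, hpq, rfl⟩ := Finset.card_eq_two.1 hS2
  obtain ⟨t, htf, hSt, ht3⟩ := 𝒯.isPure _ hSf
  have ht : t ∈ 𝒯.elements := mem_elements.2 ⟨htf, ht3⟩
  have hp : p ∈ t := hSt (by simp)
  have hq : q ∈ t := hSt (by simp)
  rw [Finset.coe_pair] at hSQ ⊢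
  have hmid : pt ((p 0 + q 0) / 2) ((p 1 + q 1) / 2) ∈ hull {p, q} := by
    have := openSegment_subset_segment ℝ _ _ (mid_mem_openSegment (p 0) (q 0) (p 1) (q 1))
    rw [pt_eta, pt_eta] at this
    rw [hull, Finset.coe_pair, convexHull_pair]
    exact this
  have hmidQ : pt ((p 0 + q 0) / 2) ((p 1 + q 1) / 2) ∈ openRect (x k) (x (k + 2)) 0 1 := by
    refine hSQ ⟨hmid, ?_⟩
    rintro (h | h)
    · refine hpq (plane_ext ?_ ?_)
      · have := congrArg (fun z : Plane => z 0) h; simp at this; linarith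
      · have := congrArg (fun z : Plane => z 1) h; simp at this; linarith
    · have h' : pt ((p 0 + q 0) / 2) ((p 1 + q 1) / 2) = q := h
      refine hpq (plane_ext ?_ ?_)
      · have := congrArg (fun z : Plane => z 0) h'; simp at this; linarith
      · have := congrArg (fun z : Plane => z 1) h'; simp at this; linarith
  obtain ⟨c1, c2, c3, c4⟩ := hmidQ
  rw [pt_zero] at c1 c2
  rw [pt_one] at c3 c4
  have hhull : pt ((p 0 + q 0) / 2) ((p 1 + q 1) / 2) ∈ hull t :=
    convexHull_mono (by exact_mod_cast hSt) hmid
  obtain ⟨d1, d2, -, -⟩ := (m.mem_hull ht).1 hhull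
  rw [pt_zero] at d1 d2
  have hj := m.strip_lt t ht
  have hjk : m.strip t = k ∨ m.strip t = k + 1 := by
    rcases lt_or_ge (m.strip t) k with h | h
    · have := m.x_mono (i := m.strip t + 1) (j := k) h (by omega); linarith
    · rcases lt_or_ge (m.strip t) (k + 2) with h' | h'
      · omega
      · have := m.x_mono (i := k + 2) (j := m.strip t) h' hj.le; linarith
  have hx := m.x_lt _ hj
  have coord : ∀ z ∈ t, z 0 = x (m.strip t) ∨ z 0 = x (m.strip t + 1) := by
    intro z hz
    rcases (m.tri t ht).mem_iff.1 hz with h | h | h | h <;> simp [h]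
  have hstrips : ∀ r ∈ m.belowTop (m.strip t), ({p, q} : Set Plane) = m.upperEdge r →
      (∃ r ∈ m.belowTop k, ({p, q} : Set Plane) = m.upperEdge r) ∨
      ∃ r ∈ m.belowTop (k + 1), ({p, q} : Set Plane) = m.upperEdge r := by
    intro r hr h
    rcases hjk with e | e <;> rw [e] at hr
    · exact Or.inl ⟨r, hr, h⟩
    · exact Or.inr ⟨r, hr, h⟩
  have hpair : ∀ {X a b : ℝ}, p 0 = X → q 0 = X → (p 1 = a ∨ p 1 = b) → (q 1 = a ∨ q 1 = b) →
      ({p, q} : Set Plane) = {pt X a, pt X b} ∧ a ≠ b := by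
    intro X a b hpX hqX ha hb
    have hne : p 1 ≠ q 1 := fun h => hpq (plane_ext (hpX.trans hqX.symm) h)
    rw [← pt_eta p, ← pt_eta q, hpX, hqX]
    rcases ha with e | e <;> rcases hb with e' | e'
    · exact absurd (e.trans e'.symm) hne
    · rw [e, e'] at hne ⊢; exact ⟨rfl, hne⟩
    · rw [e, e'] at hne ⊢; exact ⟨Set.pair_comm _ _, hne.symm⟩
    · exact absurd (e.trans e'.symm) hne
  have hpe := pt_eta p
  have hqe := pt_eta q
  rcases coord p hp with ep | ep <;> rcases coord q hq with eq | eq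
  · left
    -- In the left strip this edge would lie on x = x_k, but its midpoint is strictly inside the
    -- rectangle.
    have hj1 : m.strip t = k + 1 := by
      rcases hjk with e | e
      · rw [ep, eq, e] at c1; linarith
      · exact e
    rw [ep] at hpe
    rw [eq] at hqe
    obtain ⟨h1, h2⟩ := hpair ep eq (m.eq_lo_or_up_zero ht (by rw [hpe]; exact hp))
      (m.eq_lo_or_up_zero ht (by rw [hqe]; exact hq))
    exact ⟨t, m.mem_atSide.2 ⟨⟨ht, hj1⟩, lt_of_le_of_ne ((m.tri t ht).le 0) h2⟩, h1⟩
  · obtain ⟨r, hr, h⟩ := m.exists_upperEdge ht hp hq ep eq (by linarith) (by linarith)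
    exact Or.inr (hstrips r hr h)
  · obtain ⟨r, hr, h⟩ := m.exists_upperEdge ht hq hp eq ep (by linarith) (by linarith)
    rw [Set.pair_comm] at h
    exact Or.inr (hstrips r hr h)
  · left
    have hj1 : m.strip t = k := by
      rcases hjk with e | e
      · exact e
      · rw [ep, eq, e] at c2
        have : x (k + 2) = x (k + 1 + 1) := rfl
        linarith
    rw [ep] at hpe
    rw [eq] at hqe
    obtain ⟨h1, h2⟩ := hpair ep eq (m.eq_lo_or_up_one ht (by rw [hpe]; exact hp))
      (m.eq_lo_or_up_one ht (by rw [hqe]; exact hq))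
    obtain ⟨t', ht', rfl⟩ := hπ.surj t
      (m.mem_atSide.2 ⟨⟨ht, hj1⟩, lt_of_le_of_ne ((m.tri t ht).le 1) h2⟩)
    refine ⟨t', ht', ?_⟩
    rw [h1, leftEdge, (m.mem_atSide.1 ht').1.2, hj1, hπ.lo t' ht', hπ.up t' ht']

end StripMesh

/-! ### Adding up the estimates of all edges -/

namespace StripMesh

variable {𝒯 : Triangulation unitSquare} {n : ℕ} {x : ℕ → ℝ} (m : StripMesh 𝒯 n x)
  {r s t : Finset Plane} {c₀ α M : ℝ} {f u uh v : Plane → ℝ} {G : Plane → Plane} {k : ℕ}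
  {π : Finset Plane → Finset Plane}

lemma leftEdge_term_le (hA : 𝒯.AllNodesAnisotropic c₀ M) {S : Finset Plane}
    (hS : (S : Set Plane) = m.leftEdge t) (hπ : m.IsPartner k π) (ht : t ∈ m.atSide (k + 1) 0)
    (v : Plane → ℝ) : area (𝒯.edgePatch S) * 𝒯.jump v S ^ 2 ≤
      (M + 1) * (m.height t * (x (k + 2) - x (k + 1)) *
        (elementGradient v t 0 - elementGradient v (π t) 0) ^ 2) := by
  have ht1 := (m.mem_atSide.1 ht).1
  have hs := hπ.mem t ht
  have hs1 := (m.mem_atSide.1 hs).1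
  have eh : m.height (π t) = m.height t := by
    rw [m.height_eq hs, m.height_eq ht, hπ.lo t ht, hπ.up t ht]
  have hh := m.height_pos ht1.1
  have ha := area_edgePatch_le (m.elementsAt_leftEdge hS hπ ht)
  rw [m.area_hull ht1.1, m.area_hull hs1.1, eh] at ha
  have e1 : m.width t = x (k + 2) - x (k + 1) := by simp only [width, ht1.2]
  have e2 : m.width (π t) = x (k + 1) - x k := by simp only [width, hs1.2]
  have hw := m.width_pos ht1.1
  rw [e1] at hw
  rw [e1, e2] at ha
  have hc := (m.width_comparable hA hπ ht).2
  rw [m.jump_leftEdge hS hπ ht]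
  have ha' : area (𝒯.edgePatch S) ≤ (M + 1) * (m.height t * (x (k + 2) - x (k + 1))) := by
    have h1 := mul_le_mul_of_nonneg_left hc hh.le
    have h2 : 0 ≤ area (𝒯.edgePatch S) := measureReal_nonneg
    linarith
  calc _ ≤ (M + 1) * (m.height t * (x (k + 2) - x (k + 1))) *
        (elementGradient v t 0 - elementGradient v (π t) 0) ^ 2 := by gcongr
    _ = _ := by ring

/-- The slope is at most M²/2 · c by the extent and height bounds, so the jump of ∂_x u_h is
controlled by that of ∂_y u_h; the area of the patch is comparable with that of t. -/
lemma upperEdge_term_le (P : DiscreteProblem c₀ α M 𝒯 f u uh G) {S : Finset Plane}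
    (hS : (S : Set Plane) = m.upperEdge s) (hs : s ∈ 𝒯.elements) (ht : t ∈ 𝒯.elements)
    (hst : m.strip s = m.strip t) (h : m.lo t = m.up s) :
    area (𝒯.edgePatch S) * 𝒯.jump uh S ^ 2 ≤
      (M + 1) * (1 + (M ^ 2 / 2 * √(angleConst α)) ^ 2) * (m.height t * m.width t *
        (elementGradient uh t 1 - elementGradient uh s 1) ^ 2) := by
  have hM := P.one_le
  have hj := m.jump_upperEdge_sq_le hS hs ht hst h uh
  have hgj := m.gradient_jump P.discrete ht hs hst.symm h
  have ha := area_edgePatch_le (m.elementsAt_upperEdge hS hs ht hst h)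
  have hw := m.width_pos ht
  have hwe : m.width s = m.width t := by simp only [width, hst]
  have v0 : pt (x (m.strip s)) (m.up s 0) ∈ s := (m.vertex_mem hs).2.1
  have v1 : pt (x (m.strip s + 1)) (m.up s 1) ∈ s := (m.vertex_mem hs).2.2.2
  have v0' : pt (x (m.strip s)) (m.up s 0) ∈ t := by
    have := (m.vertex_mem ht).1; rwa [h, ← hst] at this
  have hcmp := area_le P.anisotropic hs ht v0 v0'
  have hext := m.extent_le P.anisotropic P.oriented (by linarith) hs hs v1 v1
    (subset_convexHull ℝ _ v1) (subset_convexHull ℝ _ v0)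
  rw [pt_one, pt_one] at hext
  have hhw := m.height_le_mul_width P.angle_lt P.maxAngle hs
  rw [m.area_hull ht] at hcmp ha
  rw [hwe] at hgj hhw
  set ϱ := M ^ 2 / 2 * √(angleConst α) with hϱ
  set δ₀ := elementGradient uh t 0 - elementGradient uh s 0
  set δ₁ := elementGradient uh t 1 - elementGradient uh s 1
  have hd : |m.up s 1 - m.up s 0| ≤ ϱ * m.width t := by
    refine hext.trans ?_
    rw [hϱ, mul_assoc]
    exact mul_le_mul_of_nonneg_left hhw (by positivity)
  have hδ : δ₀ ^ 2 ≤ ϱ ^ 2 * δ₁ ^ 2 := by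
    have e1 : (δ₀ * m.width t) ^ 2 ≤ (ϱ ^ 2 * δ₁ ^ 2) * m.width t ^ 2 := by
      have : δ₀ * m.width t = -(δ₁ * (m.up s 1 - m.up s 0)) := by linarith
      rw [this, neg_sq, mul_pow, ← sq_abs (m.up s 1 - m.up s 0)]
      calc δ₁ ^ 2 * |m.up s 1 - m.up s 0| ^ 2 ≤ δ₁ ^ 2 * (ϱ * m.width t) ^ 2 := by gcongr
        _ = _ := by ring
    rw [mul_pow] at e1
    exact le_of_mul_le_mul_right e1 (by positivity)
  have hh := m.height_pos ht
  have ha' : area (𝒯.edgePatch S) ≤ (M + 1) * (m.height t * m.width t) := by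
    have h2 : 0 ≤ area (𝒯.edgePatch S) := measureReal_nonneg
    linarith
  calc area (𝒯.edgePatch S) * 𝒯.jump uh S ^ 2
      ≤ (M + 1) * (m.height t * m.width t) * (ϱ ^ 2 * δ₁ ^ 2 + δ₁ ^ 2) := by
        gcongr; linarith
    _ = _ := by ring

/-- The estimate of all the jumps across the edges near a vertical line. -/
theorem exists_sum_edges_le (c₀ α M : ℝ) : ∃ C : ℝ, 0 < C ∧
    ∀ {𝒯 : Triangulation unitSquare} {n : ℕ} {x : ℕ → ℝ} (m : StripMesh 𝒯 n x)
      {f u uh : Plane → ℝ} {G : Plane → Plane}, DiscreteProblem c₀ α M 𝒯 f u uh G →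
    ∀ {k : ℕ}, k + 1 < n → ∀ A ⊆ 𝒯.edges,
      (∀ S ∈ A, hull S \ (S : Set Plane) ⊆ openRect (x k) (x (k + 2)) 0 1) →
      ∑ S ∈ A, area (𝒯.edgePatch S) * 𝒯.jump uh S ^ 2 ≤
        C * ∑ r ∈ m.inStrip k ∪ m.inStrip (k + 1), localError f uh G r := by
  classical
  obtain ⟨C₁, hC₁, hvert⟩ := exists_sum_partner_le c₀ α M
  obtain ⟨C₂, hC₂, hlong⟩ := exists_jump_le c₀ α M
  set K := (1 + (M ^ 2 / 2 * √(angleConst α)) ^ 2) * C₂ with hK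
  have hK0 : 0 < K := by positivity
  refine ⟨(|M| + 1) * (C₁ + 2 * K), by positivity, ?_⟩
  intro 𝒯 n x m f u uh G P k hk A hA hAQ
  have hM := P.one_le
  rw [abs_of_pos (by linarith)]
  obtain ⟨π, h1, h2, h3⟩ := m.exists_partner hk
  have hπ : m.IsPartner k π :=
    ⟨fun t ht => (h1 t ht).1, fun t ht => (h1 t ht).2.1, fun t ht => (h1 t ht).2.2, h2, h3⟩
  obtain ⟨ν₀, hν₀, hinj₀, -⟩ := m.exists_next k
  obtain ⟨ν₁, hν₁, hinj₁, -⟩ := m.exists_next (k + 1)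
  set e : Finset Plane → ℝ := localError f uh G with he
  have he0 : ∀ r, 0 ≤ e r := localError_nonneg f uh G
  have hupper : ∀ {j : ℕ} {ν : Finset Plane → Finset Plane},
      (∀ r ∈ m.belowTop j, ν r ∈ m.inStrip j ∧ m.lo (ν r) = m.up r) →
      ∀ r ∈ m.belowTop j, ∀ S : Finset Plane, (S : Set Plane) = m.upperEdge r →
      area (𝒯.edgePatch S) * 𝒯.jump uh S ^ 2 ≤ (M + 1) * K * (e r + e (ν r)) := by
    intro j ν hν r hr S hS
    have hr' := m.mem_inStrip.1 (Finset.mem_filter.1 hr).1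
    have hs' := m.mem_inStrip.1 (hν r hr).1
    have hk' := hr'.2.trans hs'.2.symm
    refine (m.upperEdge_term_le P hS hr'.1 hs'.1 hk' (hν r hr).2).trans ?_
    have := hlong m P hr'.1 hs'.1 hk' (hν r hr).2
    calc _ ≤ (M + 1) * (1 + (M ^ 2 / 2 * √(angleConst α)) ^ 2) * (C₂ * (e r + e (ν r))) := by
          gcongr
      _ = _ := by rw [hK]; ring
  have hsum : ∀ {j : ℕ} {ν : Finset Plane → Finset Plane},
      (∀ r ∈ m.belowTop j, ν r ∈ m.inStrip j ∧ m.lo (ν r) = m.up r) →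
      Set.InjOn ν (m.belowTop j) →
      ∑ r ∈ m.belowTop j, (M + 1) * K * (e r + e (ν r)) ≤
        2 * ((M + 1) * K) * ∑ r ∈ m.inStrip j, e r := by
    intro j ν hν hinj
    have i1 : ∑ r ∈ m.belowTop j, e r ≤ ∑ r ∈ m.inStrip j, e r :=
      Finset.sum_le_sum_of_subset_of_nonneg (Finset.filter_subset _ _) fun _ _ _ => he0 _
    have i2 : ∑ r ∈ m.belowTop j, e (ν r) ≤ ∑ r ∈ m.inStrip j, e r := by
      rw [← Finset.sum_image (f := e) (g := ν) hinj]
      refine Finset.sum_le_sum_of_subset_of_nonneg (fun s hs => ?_) fun _ _ _ => he0 _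
      obtain ⟨r, hr, rfl⟩ := Finset.mem_image.1 hs
      exact (hν r hr).1
    rw [← Finset.mul_sum, Finset.sum_add_distrib]
    have : 0 ≤ (M + 1) * K := by positivity
    nlinarith
  -- Labels for the three classes: vertical edges on the line, and long edges in the left and right
  -- strips, each named by the element on one side.
  set F : Finset Plane ⊕ (Finset Plane ⊕ Finset Plane) → ℝ :=
    Sum.elim (fun t => (M + 1) * (m.height t * (x (k + 2) - x (k + 1)) *
        (elementGradient uh t 0 - elementGradient uh (π t) 0) ^ 2))
      (Sum.elim (fun r => (M + 1) * K * (e r + e (ν₀ r)))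
        fun r => (M + 1) * K * (e r + e (ν₁ r))) with hF
  set rel : Finset Plane ⊕ (Finset Plane ⊕ Finset Plane) → Finset Plane → Prop :=
    Sum.elim (fun t S => (S : Set Plane) = m.leftEdge t)
      (Sum.elim (fun r S => (S : Set Plane) = m.upperEdge r)
        fun r S => (S : Set Plane) = m.upperEdge r) with hrel
  have hH : 0 < x (k + 2) - x (k + 1) := sub_pos.2 (m.x_lt (k + 1) hk)
  have main := sum_le_sum_of_classified (A := A)
    (B := (m.atSide (k + 1) 0).disjSum ((m.belowTop k).disjSum (m.belowTop (k + 1))))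
    (f := fun S => area (𝒯.edgePatch S) * 𝒯.jump uh S ^ 2) (F := F) (rel := rel)
    (by
      rintro (t | r | r) hb
      · have ht := Finset.inl_mem_disjSum.1 hb
        have := m.height_pos (m.mem_atSide.1 ht).1.1
        simp only [hF, Sum.elim_inl]
        positivity
      · simp only [hF, Sum.elim_inr, Sum.elim_inl]
        have := he0 r; have := he0 (ν₀ r); positivity
      · simp only [hF, Sum.elim_inr]
        have := he0 r; have := he0 (ν₁ r); positivity)
    (by
      intro S hS
      rcases m.classify_edge hk hπ (hA hS) (hAQ S hS) with ⟨t, ht, h⟩ | ⟨r, hr, h⟩ | ⟨r, hr, h⟩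
      · exact ⟨Sum.inl t, Finset.inl_mem_disjSum.2 ht, h,
          m.leftEdge_term_le P.anisotropic h hπ ht uh⟩
      · exact ⟨Sum.inr (Sum.inl r), Finset.inr_mem_disjSum.2 (Finset.inl_mem_disjSum.2 hr), h,
          hupper hν₀ r hr S h⟩
      · exact ⟨Sum.inr (Sum.inr r), Finset.inr_mem_disjSum.2 (Finset.inr_mem_disjSum.2 hr), h,
          hupper hν₁ r hr S h⟩)
    (by
      rintro (t | r | r) S S' hS hS' <;> exact Finset.coe_injective (Eq.trans hS (Eq.symm hS')))
  rw [Finset.sum_disjSum, Finset.sum_disjSum] at main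
  simp only [hF, Sum.elim_inl, Sum.elim_inr] at main
  have b1 := hvert m P hk hπ
  have b2 := hsum hν₀ hinj₀
  have b3 := hsum hν₁ hinj₁
  refine main.trans ?_
  rw [← Finset.mul_sum]
  have hms : ∑ r ∈ m.inStrip k ∪ m.inStrip (k + 1), e r =
      ∑ r ∈ m.inStrip k, e r + ∑ r ∈ m.inStrip (k + 1), e r :=
    Finset.sum_union m.inStrip_disjoint
  have b1' := mul_le_mul_of_nonneg_left b1 (by linarith : 0 ≤ M + 1)
  rw [hms] at b1' ⊢
  linarith

end StripMesh

/-! ### Monotonicity in M and the conclusion -/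

lemma Triangulation.AllNodesAnisotropic.mono {𝒯 : Triangulation unitSquare} {c₀ M M' : ℝ}
    (h : 𝒯.AllNodesAnisotropic c₀ M) (hM : M ≤ M') : 𝒯.AllNodesAnisotropic c₀ M' :=
  fun z hz => ⟨(h z hz).1, fun t ht hzt => ((h z hz).2 t ht hzt).trans
    (mul_le_mul_of_nonneg_right hM measureReal_nonneg)⟩

lemma Triangulation.GlobalOrientation.mono {𝒯 : Triangulation unitSquare} {M M' : ℝ}
    (h : 𝒯.GlobalOrientation M) (hM : M ≤ M') : 𝒯.GlobalOrientation M' := by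
  intro z hz
  obtain ⟨a, b, c, d, h1, h2⟩ := h z hz
  exact ⟨a, b, c, d, h1, h2.trans (mul_le_mul_of_nonneg_right hM measureReal_nonneg)⟩

lemma Triangulation.mem_shortEdges {Ω : Set Plane} {𝒯 : Triangulation Ω} {c₀ : ℝ} {D : Set Plane}
    {S : Finset Plane} : S ∈ 𝒯.shortEdges c₀ D ↔ S ∈ 𝒯.edges ∧ ¬ hull S ⊆ frontier Ω ∧
      Metric.diam (hull S) < c₀ * Metric.diam (𝒯.edgePatch S) ∧ hull S \ (S : Set Plane) ⊆ D := by
  simp [shortEdges]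

end AnisoMesh

end

open AnisoMesh AnisoMesh.Triangulation in
theorem mainTheorem1 (c₀ α₀ M : ℝ) (hc₀ : 0 < c₀) (hα₀ : α₀ < Real.pi) :
    ∃ C : ℝ, 0 < C ∧
      ∀ (n : ℕ) (x : ℕ → ℝ), x 0 = 0 → x n = 1 → (∀ i < n, x i < x (i + 1)) →
      ∀ 𝒯 : Triangulation unitSquare,
        𝒯.MaxAngle α₀ →
        𝒯.LineStructured n x →
        𝒯.AllNodesAnisotropic c₀ M →
        𝒯.GlobalOrientation M →
      ∀ (f u uh : Plane → ℝ) (G : Plane → Plane),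
        MemLp f ⊤ (volume.restrict unitSquare) →
        IsWeakSolution unitSquare f u G →
        𝒯.IsFESolution f uh →
      ∀ i : ℕ, 1 ≤ i → i + 1 ≤ n →
        𝒯.shortEdgeEstimator c₀ uh (openRect (x (i - 1)) (x (i + 1)) 0 1) ≤
          C * (gradientError uh G (openRect (x (i - 1)) (x (i + 1)) 0 1) +
            𝒯.dataOscillation f (openRect (x (i - 1)) (x (i + 1)) 0 1)) := by
  -- Conditions A2 and A3 are preserved when M grows, so M may be replaced by a value that is at
  -- least 1; C is fixed before the mesh and the data.
  obtain ⟨C, hC, hmain⟩ := StripMesh.exists_sum_edges_le c₀ α₀ (max M 1)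
  refine ⟨√C, Real.sqrt_pos.2 hC, ?_⟩
  intro n x h0 h1 hx 𝒯 hang hLine hA hG f u uh G hf hu huh i hi hin
  obtain ⟨m⟩ := exists_stripMesh h0 h1 hx hLine
  have P : DiscreteProblem c₀ α₀ (max M 1) 𝒯 f u uh G :=
    ⟨hα₀, le_max_right _ _, hang, hA.mono (le_max_left _ _), hG.mono (le_max_left _ _), hf, hu,
      huh.1⟩
  obtain ⟨k, rfl⟩ : ∃ k, i = k + 1 := ⟨i - 1, by omega⟩
  rw [Nat.add_sub_cancel]
  have hk : k + 1 < n := hin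
  have key := hmain m P hk (𝒯.shortEdges c₀ (openRect (x k) (x (k + 2)) 0 1))
    (fun S hS => (mem_shortEdges.1 hS).1) fun S hS => (mem_shortEdges.1 hS).2.2.2
  have herr := m.sum_localError_le (f := f) hu huh.1 hk
  change 𝒯.shortEdgeEstimator c₀ uh (openRect (x k) (x (k + 2)) 0 1) ≤
    √C * (gradientError uh G (openRect (x k) (x (k + 2)) 0 1) +
      𝒯.dataOscillation f (openRect (x k) (x (k + 2)) 0 1))
  set a := gradientError uh G (openRect (x k) (x (k + 2)) 0 1)
  set b := 𝒯.dataOscillation f (openRect (x k) (x (k + 2)) 0 1)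
  have ha : 0 ≤ a := Real.sqrt_nonneg _
  have hb : 0 ≤ b := Real.sqrt_nonneg _
  rw [shortEdgeEstimator]
  -- The sum of squares of error and oscillation is at most the square of their sum.
  refine (Real.sqrt_le_sqrt (key.trans (mul_le_mul_of_nonneg_left
    (herr.trans (by nlinarith [mul_nonneg ha hb] : a ^ 2 + b ^ 2 ≤ (a + b) ^ 2)) hC.le))).trans ?_
  rw [Real.sqrt_mul hC.le, Real.sqrt_sq (add_nonneg ha hb)]
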